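/- Fix a source schema $\mathbf S$ and a target schema $\mathbf T$ (disjoint, finite) and countably infinite disjoint sets of constants and nulls, the nulls being partitioned into open and closed nulls. Instances are finite sets of facts over constants. An annotated bidirectional dependency (abd) is a sentence $\forall \bar x\,\bigl(\exists \bar y\,\alpha(\bar x,\bar y)\leftrightarrow\exists \bar z\,\beta(\bar x,\bar z)\bigr)$, where $\bar x,\bar y,\bar z$ are disjoint, $\alpha$ is a conjunction of atoms over $\mathbf S$ and $\beta$ is a conjunction of atoms over $\mathbf T$, each annotated with an integer ($\bar x$ are the variables common to $\alpha$ and $\beta$). An annotated egd (aegd) is a sentence $\forall\bar x\,(\beta(\bar x)\to x=y)$ with $\beta$ a conjunction of annotated atoms over $\mathbf T$ and $x,y\in\bar x$. Let $\Sigma^{\leftrightarrow}$ be a finite set of abds and aegds. In evaluating it each annotated symbol $R^i$ counts as a separate relation symbol. For a labeling $\ell$ of the facts of a target instance $J$ by nonempty sets of integers put $J_\ell=\{R^i(\bar a): R(\bar a)\in J,\ i\in\ell(R(\bar a))\}$. An instance $J$ is a solution for the source instance $I$, $J\in\mathrm{Sol}(I)$, if for some $\ell$: $(I,J_\ell)\models\Sigma^{\leftrightarrow}$,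 and every fact of $J_\ell$ lies in some $J'\subseteq J_\ell$ such that for some $I'\subseteq I$ we have $(I',J')\models\Sigma^{\leftrightarrow}$ and $(I',J'')\not\models\Sigma^{\leftrightarrow}$ for all $J''\subsetneq J'$. For a query $q$, $\mathrm{cert}(q,I)=\bigcap_{J\in \mathrm{Sol}(I)}q(J)$. A semi-naive table with global condition is a pair $(T,\varphi^*)$, where $T$ is a finite set of facts over $\mathbf T$ with constants, open nulls and closed nulls as entries and $\varphi^*$ is a conjunction of disjunctions of unequalities between entries of $T$. It represents the instances $v(\bigcup_{i=1}^n v_i(T))$ with $n\ge1$, $v$ a valuation of the closed nulls and $v_1,\dots,v_n$ valuations of the open nulls, such that $\varphi^*$ holds, where an unequality holds if it holds for all choices of the $v_i$ used on either side. It is a universal representative for $I$ if the set of instances that it represents is $\mathrm{Sol}(I)$. An annotated position $(R^i,j)$ is affected if an existentially quantified variable from $\bar z$ occurs there in some abd of $\Sigma^{\leftrightarrow}$. Theorem. Assume that 1. the aegds are safe: a variable that occurs at least twice in the body of an aegd occurs there in no affected position; 2. $\Sigma^{\leftrightarrow}$ has annotation density $1$: the largest number of occurrences of any $R^i$ in the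 abds is $1$; 3. $\Sigma^{\rightarrow}$ is GAV-reducible in the following sense: in each abd every existentially quantified variable from $\bar z$ occurs in only one atom of $\beta$ after the annotations are removed (repetitions of one and the same atom do not count); 4. no aegd equates two variables that both occur in affected positions of its body. Let $q$ be a safe conjunctive query over $\mathbf T$ with exactly one positive atom and any number of negated atoms (constants allowed; every variable occurs in the positive atom). Then, $\Sigma^{\leftrightarrow}$ and $q$ being fixed: (a) the problem to decide, given a source instance $I$ and a tuple $\bar t$ of constants occurring in $I$, whether $\bar t\in\mathrm{cert}(q,I)$ is solvable in polynomial time; (b) there is a polynomial-time algorithm that, given $I$, either finds a universal representative for $I$ or reports (correctly) that $\mathrm{Sol}(I)=\emptyset$; (c) there is a polynomial-time algorithm that, given any universal representative $(T,\varphi^*)$ for some source instance $I$ and a tuple $\bar t$ of constants occurring in $I$, decides whether $\bar t\in\mathrm{cert}(q,I)$. -/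

import Mathlib

namespace ABD

/-! ## Schemas, facts, instances -/

/-- A relational schema: finitely many relation symbols, each with an arity. The source and the
target schema of a mapping are two separate values, so their symbols are never shared. -/
structure Schema where
  card : ℕ
  arity : Fin card → ℕ

/-- A fact `R(a₁, …, aₙ)` with entries in `V`. With `V = ℕ` read as constants these are the tuples
of an instance; with `V = ℕ` read as variables these are the atoms of a dependency. -/
abbrev Fact (S : Schema) (V : Type) : Type := (R : Fin S.card) × (Fin (S.arity R) → V)

/-- An annotated fact (or atom) `Rⁱ(a₁, …, aₙ)`, with an integer annotation `i`. -/
abbrev AFact (T : Schema) (V : Type) : Type := ℤ × Fact T V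

/-- Apply a map to all entries of a fact. -/
def mapFact {S : Schema} {V W : Type} (h : V → W) (f : Fact S V) : Fact S W :=
  ⟨f.1, fun j => h (f.2 j)⟩

/-- Apply a map to all entries of an annotated fact. -/
def mapAFact {T : Schema} {V W : Type} (h : V → W) (f : AFact T V) : AFact T W :=
  (f.1, mapFact h f.2)

/-- Instances: finite sets of facts over the constants. The constants are the natural numbers. -/
abbrev Inst (S : Schema) : Type := Finset (Fact S ℕ)

/-- The constants that occur in an instance. -/
def dom {S : Schema} (I : Inst S) : Set ℕ := {a | ∃ f ∈ I, ∃ j, f.2 j = a}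

/-! ## Annotated dependencies -/

/-- The variables that occur in a conjunction of atoms. -/
def varsOf {S : Schema} (l : List (Fact S ℕ)) : Set ℕ := {x | ∃ A ∈ l, ∃ j, A.2 j = x}

/-- The variables that occur in a conjunction of annotated atoms. -/
def avarsOf {T : Schema} (l : List (AFact T ℕ)) : Set ℕ := {x | ∃ A ∈ l, ∃ j, A.2.2 j = x}

/-- An annotated bidirectional dependency `∀ x ((∃ y, α(x, y)) ↔ (∃ z, β(x, z)))`, with `α` over
the source and `β` annotated and over the target. The vector `x` consists of the variables common
to `α` and `β`, `y` of those only in `α` and `z` of those only in `β`. -/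
structure Abd (S T : Schema) where
  body : List (Fact S ℕ)
  head : List (AFact T ℕ)

/-- The universally quantified variables `x`. -/
def Abd.frontier {S T : Schema} (ξ : Abd S T) : Set ℕ := varsOf ξ.body ∩ avarsOf ξ.head

/-- The existentially quantified variables `z` of the target side. -/
def Abd.exVars {S T : Schema} (ξ : Abd S T) : Set ℕ := avarsOf ξ.head \ varsOf ξ.body

/-- An annotated equality-generating dependency `∀ x (α(x) → lhs = rhs)` over the target. -/
structure Aegd (T : Schema) where
  body : List (AFact T ℕ)
  lhs : ℕ
  rhs : ℕ
  lhs_mem : lhs ∈ avarsOf body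
  rhs_mem : rhs ∈ avarsOf body

/-- A finite set of abds and aegds. -/
structure Mapping (S T : Schema) where
  abds : Finset (Abd S T)
  aegds : Finset (Aegd T)

/-- Truth of an abd in a pair of a source database and an annotated target database, where each
annotated symbol `Rⁱ` counts as a relation symbol of its own. -/
def Abd.Sat {S T : Schema} (ξ : Abd S T) (I : Set (Fact S ℕ)) (K : Set (AFact T ℕ)) : Prop :=
  ∀ h : ℕ → ℕ,
    (∃ g : ℕ → ℕ, (∀ x ∈ ξ.frontier, g x = h x) ∧ ∀ A ∈ ξ.body, mapFact g A ∈ I) ↔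
    (∃ g : ℕ → ℕ, (∀ x ∈ ξ.frontier, g x = h x) ∧ ∀ A ∈ ξ.head, mapAFact g A ∈ K)

/-- Truth of an aegd in an annotated target database. -/
def Aegd.Sat {T : Schema} (ξ : Aegd T) (K : Set (AFact T ℕ)) : Prop :=
  ∀ h : ℕ → ℕ, (∀ A ∈ ξ.body, mapAFact h A ∈ K) → h ξ.lhs = h ξ.rhs

/-- Truth of all dependencies of a mapping. -/
def Mapping.Sat {S T : Schema} (M : Mapping S T) (I : Set (Fact S ℕ)) (K : Set (AFact T ℕ)) :
    Prop :=
  (∀ ξ ∈ M.abds, ξ.Sat I K) ∧ ∀ ξ ∈ M.aegds, ξ.Sat K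

/-! ## The ABD-semantics -/

/-- The annotated instance given by an instance and a tuple-labeling function. -/
def labelled {T : Schema} (J : Inst T) (ℓ : Fact T ℕ → Set ℤ) : Set (AFact T ℕ) :=
  {p | p.2 ∈ J ∧ p.1 ∈ ℓ p.2}

/-- The solutions for `I`: the target instances `J` whose tuples can be labeled, each with a
nonempty set of integers, so that all dependencies hold with respect to the labels, and every
labeled tuple belongs to a labeled part of `J` that is a subset-minimal model for some `I' ⊆ I`. -/
def Sol {S T : Schema} (M : Mapping S T) (I : Inst S) : Set (Inst T) :=
  {J | ∃ ℓ : Fact T ℕ → Set ℤ, (∀ f ∈ J, (ℓ f).Nonempty) ∧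
    M.Sat (↑I) (labelled J ℓ) ∧
    ∀ p ∈ labelled J ℓ, ∃ I' : Set (Fact S ℕ), I' ⊆ ↑I ∧ ∃ K : Set (AFact T ℕ),
      K ⊆ labelled J ℓ ∧ p ∈ K ∧ M.Sat I' K ∧ ∀ K' : Set (AFact T ℕ), K' ⊂ K → ¬ M.Sat I' K'}

/-! ## Restrictions on mappings -/

/-- The number of occurrences of the annotated symbol `Rⁱ` in the abds of a mapping. -/
def Mapping.occ {S T : Schema} (M : Mapping S T) (R : Fin T.card) (i : ℤ) : ℕ :=
  ∑ ξ ∈ M.abds, ξ.head.countP fun A => decide (A.1 = i ∧ A.2.1 = R)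

/-- The annotation density: the largest number of occurrences of any annotated symbol in the
abds. -/
noncomputable def Mapping.density {S T : Schema} (M : Mapping S T) : ℕ∞ :=
  ⨆ (R : Fin T.card) (i : ℤ), (M.occ R i : ℕ∞)

/-- An annotated position `(Rⁱ, j)`. -/
abbrev APos (T : Schema) : Type := ℤ × ((R : Fin T.card) × Fin (T.arity R))

/-- The affected positions: those where an existentially quantified variable occurs in the target
side of some abd. -/
def Mapping.aff {S T : Schema} (M : Mapping S T) : Set (APos T) :=
  {p | ∃ ξ ∈ M.abds, ∃ A ∈ ξ.head, ∃ j, A.2.2 j ∈ ξ.exVars ∧ p = (A.1, ⟨A.2.1, j⟩)}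

/-- The number of occurrences of a variable in the body of an aegd. -/
def Aegd.count {T : Schema} (ξ : Aegd T) (x : ℕ) : ℕ :=
  (ξ.body.map fun A => (List.ofFn A.2.2).count x).sum

/-- The variable `x` occurs in an affected position in the body of the aegd `ξ`. -/
def Mapping.OccursAffected {S T : Schema} (M : Mapping S T) (ξ : Aegd T) (x : ℕ) : Prop :=
  ∃ A ∈ ξ.body, ∃ j, A.2.2 j = x ∧ ((A.1, ⟨A.2.1, j⟩) : APos T) ∈ M.aff

/-- All aegds are safe: a variable that occurs at least twice in the body of an aegd occurs there
in no affected position. -/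
def Mapping.Safe {S T : Schema} (M : Mapping S T) : Prop :=
  ∀ ξ ∈ M.aegds, ∀ x, 2 ≤ ξ.count x → ¬ M.OccursAffected ξ x

/-- GAV-reducibility of the source-to-target tgds that are obtained by removing the annotations
and the right-to-left directions: in each of them, every existentially quantified variable occurs
in only one atom of the head (repetitions of one and the same atom do not count). -/
def Mapping.GAVReducible {S T : Schema} (M : Mapping S T) : Prop :=
  ∀ ξ ∈ M.abds, ∀ z ∈ ξ.exVars, ∀ A ∈ ξ.head, ∀ B ∈ ξ.head,
    (∃ j, A.2.2 j = z) → (∃ j, B.2.2 j = z) → A.2 = B.2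

/-- No aegd equates two variables that both occur in affected positions. -/
def Mapping.EquatesNoTwoAffected {S T : Schema} (M : Mapping S T) : Prop :=
  ∀ ξ ∈ M.aegds, ξ.lhs ≠ ξ.rhs → ¬ (M.OccursAffected ξ ξ.lhs ∧ M.OccursAffected ξ ξ.rhs)

/-! ## Conjunctive queries with one positive atom -/

/-- A term of a query. -/
inductive Term where
  | const (a : ℕ)
  | var (x : ℕ)

/-- The value of a term. -/
def Term.eval (h : ℕ → ℕ) : Term → ℕ
  | .const a => a
  | .var x => h x

/-- A conjunctive query with negation, `k` answer variables, exactly one positive atom and any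
number of negated atoms. As usual the query is safe: all its variables occur in the positive
atom. -/
structure NegCQ1 (T : Schema) (k : ℕ) where
  head : Fin k → ℕ
  pos : Fact T Term
  neg : List (Fact T Term)
  head_safe : ∀ i, ∃ j, pos.2 j = Term.var (head i)
  neg_safe : ∀ A ∈ neg, ∀ j x, A.2 j = Term.var x → ∃ j', pos.2 j' = Term.var x

/-- The answers of a query on an instance. -/
def NegCQ1.answers {T : Schema} {k : ℕ} (q : NegCQ1 T k) (J : Inst T) : Set (Fin k → ℕ) :=
  {t | ∃ h : ℕ → ℕ, (∀ i, h (q.head i) = t i) ∧ mapFact (Term.eval h) q.pos ∈ J ∧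
    ∀ A ∈ q.neg, mapFact (Term.eval h) A ∉ J}

/-- The certain answers: the tuples that are answers on all solutions. -/
def cert {S T : Schema} {k : ℕ} (M : Mapping S T) (q : NegCQ1 T k) (I : Inst S) :
    Set (Fin k → ℕ) :=
  ⋂ J ∈ Sol M I, q.answers J

/-! ## Semi-naive tables with a global condition -/

/-- The entries of a semi-naive table: constants, open nulls and closed nulls. -/
inductive Val where
  | const (a : ℕ)
  | opn (n : ℕ)
  | closed (n : ℕ)

/-- The value of an entry under a valuation `v` of the closed and a valuation `w` of the open
nulls. -/
def Val.eval (v w : ℕ → ℕ) : Val → ℕ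
  | .const a => a
  | .opn n => w n
  | .closed n => v n

/-- A semi-naive table with a global condition. The table is a finite set of facts, given by a
list. The condition is a conjunction of disjunctions of unequalities between entries of the
table. -/
structure CondTable (T : Schema) where
  facts : List (Fact T Val)
  cond : List (List (Val × Val))
  cond_dom : ∀ δ ∈ cond, ∀ e ∈ δ,
    (∃ f ∈ facts, ∃ j, f.2 j = e.1) ∧ (∃ f ∈ facts, ∃ j, f.2 j = e.2)

/-- A valuation `v` of the closed nulls and valuations `w₁, …, wₙ` of the open nulls satisfy the
global condition. -/
def CondTable.CondSat {T : Schema} (τ : CondTable T) {n : ℕ} (v : ℕ → ℕ) (w : Fin n → ℕ → ℕ) :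
    Prop :=
  ∀ δ ∈ τ.cond, ∃ e ∈ δ, ∀ i j : Fin n, e.1.eval v (w i) ≠ e.2.eval v (w j)

/-- The instances represented by a table: the unions of its images under one valuation of the
closed nulls and finitely many (at least one) valuations of the open nulls that together satisfy
the global condition. -/
def CondTable.Rep {T : Schema} (τ : CondTable T) : Set (Inst T) :=
  {J | ∃ n : ℕ, 1 ≤ n ∧ ∃ (v : ℕ → ℕ) (w : Fin n → ℕ → ℕ), τ.CondSat v w ∧
    ∀ f : Fact T ℕ, f ∈ J ↔ ∃ i, ∃ g ∈ τ.facts, f = mapFact (Val.eval v (w i)) g}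

/-- A universal representative: a table that represents exactly the solutions. -/
def IsUniversalRep {S T : Schema} (M : Mapping S T) (I : Inst S) (τ : CondTable T) : Prop :=
  Sol M I = τ.Rep

/-! ## Polynomial time

The machine model is the textbook WHILE language over binary trees: variables hold binary trees,
which are stored as shared pointer structures, so that pairing, taking a component and testing for
the empty tree take one step each. There is no other test (in particular no equality test in one
step). Polynomial time in this model agrees with polynomial time on Turing machines. -/

/-- Binary trees, the data of the model. -/
inductive Data where
  | nil
  | cons (l r : Data)

/-- The size of a tree: its number of nodes. -/
def Data.size : Data → ℕ
  | .nil => 1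
  | .cons l r => l.size + r.size + 1

/-- The left component. -/
def Data.hd : Data → Data
  | .nil => .nil
  | .cons l _ => l

/-- The right component. -/
def Data.tl : Data → Data
  | .nil => .nil
  | .cons _ r => r

/-- Expressions. -/
inductive Expr where
  | var (x : ℕ)
  | nil
  | cons (e f : Expr)
  | hd (e : Expr)
  | tl (e : Expr)

/-- The value of an expression in a store. -/
def Expr.eval (s : ℕ → Data) : Expr → Data
  | .var x => s x
  | .nil => .nil
  | .cons e f => .cons (e.eval s) (f.eval s)
  | .hd e => (e.eval s).hd
  | .tl e => (e.eval s).tl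

/-- The number of steps for evaluating an expression: one for each operation. -/
def Expr.cost : Expr → ℕ
  | .var _ => 1
  | .nil => 1
  | .cons e f => e.cost + f.cost + 1
  | .hd e => e.cost + 1
  | .tl e => e.cost + 1

/-- Programs. -/
inductive Prog where
  | skip
  | assign (x : ℕ) (e : Expr)
  | seq (c d : Prog)
  | ite (e : Expr) (c d : Prog)
  | loop (e : Expr) (c : Prog)

/-- `Exec c s s' n`: the program `c`, started in the store `s`, halts in the store `s'` after `n`
steps. The tree `nil` counts as false, all other trees as true. -/
inductive Exec : Prog → (ℕ → Data) → (ℕ → Data) → ℕ → Prop where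
  | skip (s : ℕ → Data) : Exec .skip s s 1
  | assign (x : ℕ) (e : Expr) (s : ℕ → Data) :
      Exec (.assign x e) s (Function.update s x (e.eval s)) (e.cost + 1)
  | seq {c d : Prog} {s s' s'' : ℕ → Data} {m n : ℕ} :
      Exec c s s' m → Exec d s' s'' n → Exec (.seq c d) s s'' (m + n)
  | ite_true {e : Expr} {c d : Prog} {s s' : ℕ → Data} {n : ℕ} :
      e.eval s ≠ .nil → Exec c s s' n → Exec (.ite e c d) s s' (e.cost + 1 + n)
  | ite_false {e : Expr} {c d : Prog} {s s' : ℕ → Data} {n : ℕ} :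
      e.eval s = .nil → Exec d s s' n → Exec (.ite e c d) s s' (e.cost + 1 + n)
  | loop_done {e : Expr} {c : Prog} {s : ℕ → Data} :
      e.eval s = .nil → Exec (.loop e c) s s (e.cost + 1)
  | loop_step {e : Expr} {c : Prog} {s s' s'' : ℕ → Data} {m n : ℕ} :
      e.eval s ≠ .nil → Exec c s s' m → Exec (.loop e c) s' s'' n →
      Exec (.loop e c) s s'' (e.cost + 1 + m + n)

/-- The initial store: the input in variable `0`, all other variables empty. -/
def initStore (x : Data) : ℕ → Data := Function.update (fun _ => .nil) 0 x

/-- `Runs c x y n`: on input `x` the program `c` halts after `n` steps with output `y`, read from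
variable `0`. -/
def Runs (c : Prog) (x y : Data) (n : ℕ) : Prop := ∃ s, Exec c (initStore x) s n ∧ s 0 = y

/-- The property `L` of inputs from `D`, presented by `enc`, is decided by one program in time
polynomial in the size of the presentation. -/
def DecidablePolyTime {α : Type} (enc : α → Data) (D L : Set α) : Prop :=
  ∃ (c : Prog) (b : Polynomial ℕ), ∀ a ∈ D, ∃ (y : Data) (n : ℕ),
    Runs c (enc a) y n ∧ n ≤ b.eval (enc a).size ∧ (y ≠ .nil ↔ a ∈ L)

/-- For every input, some output in the relation `G` is computed by one program in time polynomial
in the size of the presentation of the input. As trees are stored with sharing, the size of the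
output, written out as a tree, is bounded separately. -/
def ComputablePolyTime {α β : Type} (encα : α → Data) (encβ : β → Data) (G : α → β → Prop) : Prop :=
  ∃ (c : Prog) (b : Polynomial ℕ), ∀ a, ∃ (r : β) (n : ℕ),
    Runs c (encα a) (encβ r) n ∧ n ≤ b.eval (encα a).size ∧
    (encβ r).size ≤ b.eval (encα a).size ∧ G a r

/-! ## Presentation of inputs and outputs by trees -/

/-- Lists as right-nested pairs. -/
def encList {α : Type} (f : α → Data) : List α → Data
  | [] => .nil
  | a :: l => .cons (f a) (encList f l)

/-- Truth values. -/
def encBool : Bool → Data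
  | false => .nil
  | true => .cons .nil .nil

/-- Natural numbers in binary, least significant bit first. -/
def encNat (n : ℕ) : Data := encList encBool n.bits

/-- Facts: the number of the relation symbol and the list of the entries. -/
def encFact {S : Schema} {V : Type} (f : V → Data) (A : Fact S V) : Data :=
  .cons (encNat A.1) (encList f (List.ofFn A.2))

/-- Instances, given by a list of their facts. -/
def encInst {S : Schema} (l : List (Fact S ℕ)) : Data := encList (encFact encNat) l

/-- Tuples of constants. -/
def encTuple {k : ℕ} (t : Fin k → ℕ) : Data := encList encNat (List.ofFn t)

/-- Entries of semi-naive tables, with a tag for their kind. -/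
def encVal : Val → Data
  | .const a => .cons (encNat 0) (encNat a)
  | .opn n => .cons (encNat 1) (encNat n)
  | .closed n => .cons (encNat 2) (encNat n)

/-- Semi-naive tables with a global condition. -/
def encTable {T : Schema} (τ : CondTable T) : Data :=
  .cons (encList (encFact encVal) τ.facts)
    (encList (encList fun e => .cons (encVal e.1) (encVal e.2)) τ.cond)

/-- Optional values. -/
def encOption {α : Type} (f : α → Data) : Option α → Data
  | none => .nil
  | some a => .cons (f a) .nil

end ABD

/-!
The proof has a semantic part, which describes the solutions, and a computational part, which
provides programs with polynomial running time.

*Solutions.* As the annotation density is one, an annotated symbol determines the abd and the head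
atom in which it occurs. So the source instance determines a chase: each match of a source side (a
trigger) yields an instance of each head atom, with existential variables of unknown value. By
GAV-reducibility these values can be chosen separately for each head atom. By safety, whether the
body of an aegd matches does not depend on the unknown values, and as no aegd equates two of them,
the effect of an aegd is either to fail or to force a constant for one of them (`aegds_sat_iff`).
The right-to-left directions of the abds only concern the known values. It follows that there are no
solutions, or else the solutions are the instances that consist of admissible facts, called
candidates, and contain a candidate for each trigger and each head atom (`mem_Sol_iff`). The
minimality condition in the semantics is what excludes other facts.

*Universal representatives.* Hence, if there are solutions, they are represented by the table with
one fact for each trigger and head atom, in which the unknown values that no aegd forces are open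
nulls and different facts have no nulls in common; no closed nulls and no condition are needed
(`rep_plainTable`, `Sol_of_not_fails`).

*Certain answers.* A tuple is not certain if some solution contains, for each match of the positive
atom that yields the tuple, the fact for one of the negated atoms; such sets of facts refute the
tuple, and they are closed under unions. Let `τ` be any universal representative with a satisfiable
condition. A comparison of generic instances shows that `τ` and the table above have the same
instances of facts, so that nulls shared between facts of `τ`, as well as its condition, can be
ignored: the tuple is refuted on a solution if and only if each fact of `τ` separately has an
instance in a finite refuting set of instances of facts of `τ` (`exists_refutes_iff`). As all
variables of the query occur in its positive atom, it suffices to consider the constants that occur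
and a bounded number of fresh values, and the greatest refuting set over this domain is found by
deleting facts (`exists_mem_refuter_iff`).

*Polynomial time.* `PT f` says that `f` is computed by a program with polynomial time and output
size that can be placed anywhere in the store. Such functions are closed under composition, pairing,
case distinction, and folds over lists whose values grow polynomially; equality of trees is decided
by a loop with a stack. So quantifiers over lists and over fixed finite sets can be evaluated, which
is all that the conditions above require, when they are restricted to the constants of the instance.
-/

namespace ABD

/-! ### A calculus of polynomial-time functions -/

theorem eval_le_eval_nat (p : Polynomial ℕ) {m n : ℕ} (h : m ≤ n) :
    p.eval m ≤ p.eval n := by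
  simp only [Polynomial.eval_eq_sum_range]
  gcongr

/-- A presentation of the elements of a type by trees. It has to be injective, so that equality of
elements is equality of trees. -/
class Enc (α : Type) where
  enc : α → Data
  enc_inj : Function.Injective enc

open Enc

/-- The size of the presentation of an element. -/
def esize {α : Type} [Enc α] (a : α) : ℕ := (enc a).size

section Framework

variable {α β γ δ σ : Type} [Enc α] [Enc β] [Enc γ] [Enc δ] [Enc σ]

/-- The program `c` replaces in variable `k` the argument of `f` by its value, within the time
bound `b`, from any store and without changing the variables below `k`. The variables above `k` are
scratch space. -/
def Impl (c : Prog) (k : ℕ) (f : α → β) (b : Polynomial ℕ) : Prop :=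
  ∀ a s, s k = enc a → ∃ s' n, Exec c s s' n ∧ s' k = enc (f a) ∧ (∀ i < k, s' i = s i) ∧
    n ≤ b.eval (esize a)

/-- Polynomial-time computable functions: for every `k` there is a program that works in the
variables from `k` on. The bound on the size of the value does not follow from the bound on the
time, as trees are shared. -/
def PT (f : α → β) : Prop :=
  ∃ b : Polynomial ℕ, (∀ a, esize (f a) ≤ b.eval (esize a)) ∧ ∀ k, ∃ c, Impl c k f b

theorem PT.of_bounds {f : α → β} (p q : Polynomial ℕ) (hp : ∀ a, esize (f a) ≤ p.eval (esize a))
    (hq : ∀ k, ∃ c, Impl c k f q) : PT f := by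
  refine ⟨p + q, fun a => (hp a).trans (by simp), fun k => ?_⟩
  obtain ⟨c, hc⟩ := hq k
  refine ⟨c, fun a s h => ?_⟩
  obtain ⟨s', n, h1, h2, h3, h4⟩ := hc a s h
  exact ⟨s', n, h1, h2, h3, h4.trans (by simp)⟩

/-- A function is polynomial-time computable if it acts on presentations as such a function. -/
theorem PT.recode {f : α → β} {F : γ → δ} (hF : PT F)
    (h : ∀ a, ∃ c, enc a = enc c ∧ enc (f a) = enc (F c)) : PT f := by
  obtain ⟨b, hb, hc⟩ := hF
  refine ⟨b, fun a => ?_, fun k => ?_⟩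
  · obtain ⟨c, h1, h2⟩ := h a
    have := hb c
    simp only [esize] at this ⊢
    rwa [h1, h2]
  · obtain ⟨c, hc⟩ := hc k
    refine ⟨c, fun a s hs => ?_⟩
    obtain ⟨d, h1, h2⟩ := h a
    obtain ⟨s', n, e1, e2, e3, e4⟩ := hc d s (hs.trans h1)
    refine ⟨s', n, e1, e2.trans h2.symm, e3, ?_⟩
    simp only [esize] at e4 ⊢
    rwa [h1]

theorem PT.congr {f g : α → β} (hf : PT f) (h : ∀ a, g a = f a) : PT g := by
  rwa [show g = f from funext h]

theorem PT.id : PT (fun a : α => a) :=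
  PT.of_bounds .X 1 (by simp) fun _ => ⟨.skip, fun _ s hs => ⟨s, 1, .skip s, hs, by simp, by simp⟩⟩

theorem PT.comp {g : β → γ} {f : α → β} (hg : PT g) (hf : PT f) : PT (fun a => g (f a)) := by
  obtain ⟨p, hp, hc⟩ := hf
  obtain ⟨q, hq, hd⟩ := hg
  refine PT.of_bounds (q.comp p) (p + q.comp p) (fun a => ?_) fun k => ?_
  · rw [Polynomial.eval_comp]
    exact (hq _).trans (eval_le_eval_nat q (hp a))
  · obtain ⟨c, hc⟩ := hc k
    obtain ⟨d, hd⟩ := hd k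
    refine ⟨.seq c d, fun a s hs => ?_⟩
    obtain ⟨s1, n1, e1, f1, g1, t1⟩ := hc a s hs
    obtain ⟨s2, n2, e2, f2, g2, t2⟩ := hd _ s1 f1
    refine ⟨s2, _, .seq e1 e2, f2, fun i hi => (g2 i hi).trans (g1 i hi), ?_⟩
    rw [Polynomial.eval_add, Polynomial.eval_comp]
    exact Nat.add_le_add t1 (t2.trans (eval_le_eval_nat q (hp a)))

/-- An expression whose value is a given tree. -/
def Data.toExpr : Data → Expr
  | .nil => .nil
  | .cons l r => .cons l.toExpr r.toExpr

theorem Data.eval_toExpr (d : Data) (s : ℕ → Data) : d.toExpr.eval s = d := by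
  induction d <;> simp_all [Data.toExpr, Expr.eval]

theorem PT.const (b : β) : PT (fun _ : α => b) := by
  refine PT.of_bounds (.C (esize b)) (.C ((enc b).toExpr.cost + 1)) (by simp) fun k =>
    ⟨.assign k (enc b).toExpr, fun a s hs => ⟨_, _, .assign _ _ _, ?_, ?_, by simp⟩⟩
  · simp [Data.eval_toExpr]
  · intro i hi
    simp [Function.update_of_ne hi.ne]

instance : Enc Data := ⟨fun d => d, fun _ _ h => h⟩

theorem PT.dataHd : PT Data.hd := by
  refine PT.of_bounds .X 3 (fun a => ?_) fun k => ⟨.assign k (.hd (.var k)), fun a s hs =>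
    ⟨_, _, .assign _ _ _, ?_, fun i hi => by simp [Function.update_of_ne hi.ne], ?_⟩⟩
  · cases a <;> simp [esize, enc, Data.hd, Data.size]
    omega
  · simp only [Expr.eval, hs, Function.update_self, enc]
  · simp [Expr.cost]

theorem PT.dataTl : PT Data.tl := by
  refine PT.of_bounds .X 3 (fun a => ?_) fun k => ⟨.assign k (.tl (.var k)), fun a s hs =>
    ⟨_, _, .assign _ _ _, ?_, fun i hi => by simp [Function.update_of_ne hi.ne], ?_⟩⟩
  · cases a <;> simp [esize, enc, Data.tl, Data.size]
    omega
  · simp only [Expr.eval, hs, Function.update_self, enc]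
  · simp [Expr.cost]

instance : Enc (α × β) :=
  ⟨fun p => .cons (enc p.1) (enc p.2), fun p q h => by
    injection h with h1 h2
    exact Prod.ext (enc_inj h1) (enc_inj h2)⟩

theorem enc_prod (p : α × β) : enc p = .cons (enc p.1) (enc p.2) := rfl

theorem esize_prod (p : α × β) : esize p = esize p.1 + esize p.2 + 1 := rfl

theorem PT.fst : PT (fun p : α × β => p.1) := PT.dataHd.recode fun p => ⟨enc p, rfl, rfl⟩

theorem PT.snd : PT (fun p : α × β => p.2) := PT.dataTl.recode fun p => ⟨enc p, rfl, rfl⟩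

theorem PT.pair {f : α → β} {g : α → γ} (hf : PT f) (hg : PT g) : PT (fun a => (f a, g a)) := by
  obtain ⟨p, hp, hc⟩ := hf
  obtain ⟨q, hq, hd⟩ := hg
  refine PT.of_bounds (p + q + 1) (p + q + 8) (fun a => ?_) fun k => ?_
  · have := hp a
    have := hq a
    rw [esize_prod]
    simp only [Polynomial.eval_add, Polynomial.eval_one]
    omega
  · obtain ⟨c, hc⟩ := hc (k + 1)
    obtain ⟨d, hd⟩ := hd (k + 2)
    refine ⟨.seq (.assign (k + 1) (.var k)) (.seq c (.seq (.assign (k + 2) (.var k))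
      (.seq d (.assign k (.cons (.var (k + 1)) (.var (k + 2))))))), fun a s hs => ?_⟩
    obtain ⟨s1, n1, e1, f1, g1, t1⟩ := hc a (Function.update s (k + 1) (s k)) (by simpa using hs)
    obtain ⟨s2, n2, e2, f2, g2, t2⟩ := hd a (Function.update s1 (k + 2) (s1 k)) (by
      rw [Function.update_self, g1 k (by omega), Function.update_of_ne (by omega), hs])
    refine ⟨_, _, .seq (.assign _ _ _) (.seq e1 (.seq (.assign _ _ _) (.seq e2
      (.assign _ _ _)))), ?_, fun i hi => ?_, ?_⟩
    · rw [Function.update_self, enc_prod, ← f1, ← f2]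
      simp only [Expr.eval]
      rw [g2 (k + 1) (by omega), Function.update_of_ne (by omega)]
    · rw [Function.update_of_ne hi.ne, g2 i (by omega), Function.update_of_ne (by omega),
        g1 i (by omega), Function.update_of_ne (by omega)]
    · simp only [Expr.cost, Polynomial.eval_add, Polynomial.eval_ofNat]
      omega

/-- Case distinction on whether the second component of the input is the empty tree. -/
theorem PT.dispatch {h : α → β} {f : γ → β} {g : δ → β} (hf : PT f) (hg : PT g)
    (hh : ∀ x, (∃ c, enc x = .cons (enc c) .nil ∧ h x = f c) ∨
      ∃ d, enc x = enc d ∧ (enc x).tl ≠ .nil ∧ h x = g d) : PT h := by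
  obtain ⟨p, hp, hc⟩ := hf
  obtain ⟨q, hq, hd⟩ := hg
  refine PT.of_bounds (p + q) (p + q + 6) (fun x => ?_) fun k => ?_
  · rcases hh x with ⟨c, h1, h2⟩ | ⟨d, h1, -, h2⟩
    · have h3 : esize c ≤ esize x := by simp only [esize, h1, Data.size]; omega
      have := (hp c).trans (eval_le_eval_nat p h3)
      rw [h2, Polynomial.eval_add]
      omega
    · have := hq d
      rw [h2, Polynomial.eval_add]
      simp only [esize] at this ⊢
      rw [h1]
      omega
  · obtain ⟨c, hc⟩ := hc k
    obtain ⟨d, hd⟩ := hd k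
    refine ⟨.ite (.tl (.var k)) d (.seq (.assign k (.hd (.var k))) c), fun x s hs => ?_⟩
    rcases hh x with ⟨c', h1, h2⟩ | ⟨d', h1, h3, h2⟩
    · obtain ⟨s1, n1, e1, f1, g1, t1⟩ := hc c' (Function.update s k (Expr.eval s (.hd (.var k))))
        (by simp [Expr.eval, hs, h1, Data.hd])
      refine ⟨s1, _, .ite_false (by simp [Expr.eval, hs, h1, Data.tl])
        (.seq (.assign _ _ _) e1), by rw [f1, h2], fun i hi => ?_, ?_⟩
      · rw [g1 i hi, Function.update_of_ne hi.ne]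
      · have h3 : esize c' ≤ esize x := by simp only [esize, h1, Data.size]; omega
        have := t1.trans (eval_le_eval_nat p h3)
        simp only [Polynomial.eval_add, Polynomial.eval_ofNat, Expr.cost]
        omega
    · obtain ⟨s1, n1, e1, f1, g1, t1⟩ := hd d' s (hs.trans h1)
      refine ⟨s1, _, .ite_true (by simpa [Expr.eval, hs] using h3) e1, by rw [f1, h2], g1, ?_⟩
      simp only [Polynomial.eval_add, Polynomial.eval_ofNat, Expr.cost, esize] at t1 ⊢
      rw [h1]
      omega

theorem encBool_injective : Function.Injective encBool := by
  intro a b h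
  cases a <;> cases b <;> simp_all [encBool]

instance : Enc Bool := ⟨encBool, encBool_injective⟩

theorem PT.ite {t : α → Bool} {f g : α → β} (ht : PT t) (hf : PT f) (hg : PT g) :
    PT (fun a => if t a = true then f a else g a) := by
  have h : PT (fun x : α × Bool => if x.2 = true then f x.1 else g x.1) := by
    refine PT.dispatch hg (hf.comp (PT.fst (β := Bool))) (fun x => ?_)
    obtain ⟨a, b⟩ := x
    cases b
    · exact .inl ⟨a, rfl, rfl⟩
    · exact .inr ⟨(a, true), rfl, by simp [enc, encBool, Data.tl], rfl⟩
  exact h.comp (PT.id.pair ht)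

/-- Iteration as long as a test succeeds, for a polynomial number of steps and with a polynomial
bound on all intermediate values. -/
theorem PT.loop {test : σ → Bool} {step : σ → σ} (htest : PT test) (hstep : PT step) (n : σ → ℕ)
    (B : Polynomial ℕ) (htrue : ∀ s, ∀ i < n s, test (step^[i] s) = true)
    (hfalse : ∀ s, test (step^[n s] s) = false) (hn : ∀ s, n s ≤ B.eval (esize s))
    (hsize : ∀ s, ∀ i ≤ n s, esize (step^[i] s) ≤ B.eval (esize s)) :
    PT (fun s => step^[n s] s) := by
  obtain ⟨p, hp, hc⟩ := htest
  obtain ⟨q, hq, hd⟩ := hstep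
  refine PT.of_bounds B (2 + p + (B + 1) * (q.comp B + p.comp B + 4))
    (fun s => hsize s _ le_rfl) fun k => ?_
  obtain ⟨c, hc⟩ := hc (k + 1)
  obtain ⟨d, hd⟩ := hd k
  have key : ∀ (Z m : ℕ) (x : σ) (s : ℕ → Data), (∀ i < m, test (step^[i] x) = true) →
      test (step^[m] x) = false → (∀ i ≤ m, esize (step^[i] x) ≤ Z) → s k = enc x →
      s (k + 1) = enc (test x) → ∃ s' t, Exec (.loop (.var (k + 1))
        (.seq d (.seq (.assign (k + 1) (.var k)) c))) s s' t ∧ s' k = enc (step^[m] x) ∧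
        (∀ i < k, s' i = s i) ∧ t ≤ (m + 1) * (q.eval Z + p.eval Z + 4) := by
    intro Z m
    induction m with
    | zero =>
      intro x s _ h2 _ h4 h5
      refine ⟨s, _, .loop_done ?_, h4, fun _ _ => rfl, ?_⟩
      · simp only [Expr.eval, h5]
        simp only [Function.iterate_zero, id_eq] at h2
        rw [h2]; rfl
      · simp only [Expr.cost]; omega
    | succ m ih =>
      intro x s h1 h2 h3 h4 h5
      have hx : test x = true := h1 0 (by omega)
      obtain ⟨s1, n1, e1, f1, g1, t1⟩ := hd x s h4
      obtain ⟨s2, n2, e2, f2, g2, t2⟩ := hc (step x) (Function.update s1 (k + 1) (s1 k))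
        (by simpa using f1)
      obtain ⟨s3, n3, e3, f3, g3, t3⟩ := ih (step x) s2
        (fun i hi => h1 (i + 1) (by omega)) h2 (fun i hi => h3 (i + 1) (by omega))
        (by rw [g2 k (by omega), Function.update_of_ne (by omega), f1]) f2
      refine ⟨s3, _, .loop_step ?_ (.seq e1 (.seq (.assign _ _ _) e2)) e3, f3, fun i hi => ?_, ?_⟩
      · simp only [Expr.eval, h5, hx]
        simp [enc, encBool]
      · rw [g3 i hi, g2 i (by omega), Function.update_of_ne (by omega), g1 i hi]
      · have u1 := t1.trans (eval_le_eval_nat q (h3 0 (by omega)))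
        have u2 := t2.trans (eval_le_eval_nat p (h3 1 (by omega)))
        simp only [Expr.cost]
        rw [add_mul (m + 1) 1]
        omega
  refine ⟨.seq (.assign (k + 1) (.var k)) (.seq c (.loop (.var (k + 1))
        (.seq d (.seq (.assign (k + 1) (.var k)) c)))), fun x s hs => ?_⟩
  obtain ⟨s1, n1, e1, f1, g1, t1⟩ := hc x (Function.update s (k + 1) (s k)) (by simpa using hs)
  obtain ⟨s2, n2, e2, f2, g2, t2⟩ := key (B.eval (esize x)) (n x) x s1 (htrue x) (hfalse x)
    (hsize x) (by rw [g1 k (by omega), Function.update_of_ne (by omega), hs]) f1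
  refine ⟨s2, _, .seq (.assign _ _ _) (.seq e1 e2), f2, fun i hi => ?_, ?_⟩
  · rw [g2 i hi, g1 i (by omega), Function.update_of_ne (by omega)]
  · have := t2.trans (Nat.mul_le_mul_right _ (Nat.add_le_add_right (hn x) 1))
    simp only [Polynomial.eval_add, Polynomial.eval_mul, Polynomial.eval_comp,
      Polynomial.eval_ofNat, Polynomial.eval_one, Expr.cost]
    omega

/-! ### Lists -/

theorem encList_injective {ι : Type} {f : ι → Data} (hf : Function.Injective f) :
    Function.Injective (encList f) := by
  intro l
  induction l with
  | nil => intro m h; cases m <;> simp_all [encList]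
  | cons a l ih =>
    intro m h
    cases m with
    | nil => simp [encList] at h
    | cons b m =>
      simp only [encList, Data.cons.injEq] at h
      rw [hf h.1, ih h.2]

instance : Enc (List α) := ⟨encList enc, encList_injective enc_inj⟩

theorem enc_cons (a : α) (l : List α) : enc (a :: l) = .cons (enc a) (enc l) := rfl

theorem esize_nil : esize ([] : List α) = 1 := rfl

theorem esize_cons (a : α) (l : List α) : esize (a :: l) = esize a + esize l + 1 := rfl

theorem esize_append (l m : List α) : esize (l ++ m) + 1 = esize l + esize m := by
  induction l with
  | nil => simp [esize_nil]; omega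
  | cons a l ih => simp only [List.cons_append, esize_cons]; omega

theorem length_le_esize (l : List α) : l.length ≤ esize l := by
  induction l with
  | nil => simp
  | cons a l ih => rw [esize_cons, List.length_cons]; omega

theorem PT.cons {f : α → β} {g : α → List β} (hf : PT f) (hg : PT g) :
    PT (fun a => f a :: g a) :=
  (hf.pair hg).recode fun a => ⟨a, rfl, rfl⟩

theorem PT.listCases {n : γ → β} {f : γ × α × List α → β} (hn : PT n) (hf : PT f) :
    PT (fun x : γ × List α => match x.2 with
      | [] => n x.1
      | a :: l => f (x.1, a, l)) := by
  refine PT.dispatch hn hf fun x => ?_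
  obtain ⟨c, l⟩ := x
  cases l with
  | nil => exact .inl ⟨c, rfl, rfl⟩
  | cons a l => exact .inr ⟨(c, a, l), rfl, by simp [enc_prod, enc_cons, Data.tl], rfl⟩

theorem PT.tail {l : γ → List α} (hl : PT l) : PT (fun c => (l c).tail) :=
  PT.dataTl.recode (F := Data.tl) (fun a : List α => ⟨enc a, rfl, by cases a <;> rfl⟩) |>.comp hl

theorem PT.headD {l : γ → List α} {d : γ → α} (hl : PT l) (hd : PT d) :
    PT (fun c => (l c).headD (d c)) := by
  refine ((PT.listCases (n := d) (f := fun x : γ × α × List α => x.2.1) hd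
    (PT.fst.comp PT.snd)).comp (PT.id.pair hl)).congr fun c => ?_
  dsimp only
  cases l c <;> rfl

/-- A fold is polynomial-time computable if its step is and all intermediate values have polynomial
size. -/
theorem PT.foldl {l : γ → List α} {s : γ → σ} {g : γ → σ → α → σ} (hl : PT l) (hs : PT s)
    (hg : PT (fun x : γ × σ × α => g x.1 x.2.1 x.2.2))
    (hB : ∃ B : Polynomial ℕ, ∀ c (x : σ) (a : α),
      esize (g c x a) ≤ esize x + B.eval (esize c + esize a)) :
    PT (fun c => (l c).foldl (g c) (s c)) := by
  obtain ⟨B, hB⟩ := hB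
  let step : γ × σ × List α → γ × σ × List α := fun x => match x.2.2 with
    | [] => x
    | a :: l => (x.1, g x.1 x.2.1 a, l)
  let test : γ × σ × List α → Bool := fun x => match x.2.2 with
    | [] => false
    | _ :: _ => true
  have regroup : PT (fun x : γ × σ × List α => ((x.1, x.2.1), x.2.2)) :=
    (PT.fst.pair (PT.fst.comp PT.snd)).pair (PT.snd.comp PT.snd)
  have htest : PT test :=
    ((PT.listCases (γ := γ × σ) (n := fun _ => false) (f := fun _ : (γ × σ) × α × List α => true)
      (PT.const _) (PT.const _)).comp regroup).congr
      fun x => by obtain ⟨c, x, l⟩ := x; cases l <;> rfl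
  have hstep : PT step := by
    have h1 : PT (fun x : γ × σ => (x.1, x.2, ([] : List α))) :=
      PT.fst.pair (PT.snd.pair (PT.const _))
    have h2 : PT (fun x : (γ × σ) × α × List α => (x.1.1, g x.1.1 x.1.2 x.2.1, x.2.2)) :=
      (PT.fst.comp PT.fst).pair (((hg.comp ((PT.fst.comp PT.fst).pair
        ((PT.snd.comp PT.fst).pair (PT.fst.comp PT.snd))))).pair (PT.snd.comp PT.snd))
    exact ((PT.listCases h1 h2).comp regroup).congr
      fun x => by obtain ⟨c, x, l⟩ := x; cases l <;> rfl
  have hiter : ∀ (l : List α) (c : γ) (x : σ), step^[l.length] (c, x, l) =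
      (c, l.foldl (g c) x, []) := by
    intro l
    induction l with
    | nil => intro c x; rfl
    | cons a l ih => intro c x; rw [List.length_cons, Function.iterate_succ_apply]; exact ih c _
  have hinv : ∀ (i : ℕ) (l : List α) (c : γ) (x : σ), i ≤ l.length →
      (step^[i] (c, x, l)).2.2.length = l.length - i ∧
      esize (step^[i] (c, x, l)) ≤ esize (c, x, l) + i * B.eval (esize c + esize l) := by
    intro i
    induction i with
    | zero => intro l c x _; simp
    | succ i ih =>
      intro l c x hi
      cases l with
      | nil => simp at hi
      | cons a l =>
        rw [Function.iterate_succ_apply]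
        have e : step (c, x, a :: l) = (c, g c x a, l) := rfl
        rw [e]
        obtain ⟨h1, h2⟩ := ih l c (g c x a) (by simpa using hi)
        refine ⟨by rw [h1]; simp, h2.trans ?_⟩
        have h3 := hB c x a
        have h4 : B.eval (esize c + esize a) ≤ B.eval (esize c + esize (a :: l)) :=
          eval_le_eval_nat B (by rw [esize_cons]; omega)
        have h5 : i * B.eval (esize c + esize l) ≤ i * B.eval (esize c + esize (a :: l)) :=
          Nat.mul_le_mul_left _ (eval_le_eval_nat B (by rw [esize_cons]; omega))
        have h6 : esize (a :: l) = esize a + esize l + 1 := rfl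
        simp only [esize_prod] at *
        rw [add_mul]
        omega
  have main := PT.loop htest hstep (fun x => x.2.2.length)
    (.X + .X * B) (fun x i hi => ?_) (fun x => ?_) (fun x => ?_) (fun x i hi => ?_)
  · exact (PT.fst.comp (PT.snd.comp (main.comp (PT.id.pair (hs.pair hl))))).congr
      fun c => by simp only [hiter]
  · obtain ⟨c, x, l⟩ := x
    obtain ⟨h1, -⟩ := hinv i l c x hi.le
    simp only [test]
    split
    · next h => rw [h] at h1; simp at h1 hi; omega
    · rfl
  · obtain ⟨c, x, l⟩ := x
    rw [hiter]
  · obtain ⟨c, x, l⟩ := x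
    have := length_le_esize l
    simp only [esize_prod, Polynomial.eval_add, Polynomial.eval_X]
    omega
  · obtain ⟨c, x, l⟩ := x
    refine (hinv i l c x hi).2.trans ?_
    simp only [Polynomial.eval_add, Polynomial.eval_X, Polynomial.eval_mul]
    have h1 := length_le_esize l
    dsimp only at hi
    gcongr
    · simp only [esize_prod]; omega
    · exact eval_le_eval_nat B (by simp only [esize_prod]; omega)

theorem PT.exists_bound {g : α → β} (hg : PT g) :
    ∃ B : Polynomial ℕ, ∀ a, esize (g a) ≤ B.eval (esize a) :=
  let ⟨b, hb, _⟩ := hg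
  ⟨b, hb⟩

theorem PT.reverse {l : γ → List α} (hl : PT l) : PT (fun c => (l c).reverse) := by
  refine (PT.foldl (g := fun _ (x : List α) (a : α) => a :: x) hl (PT.const [])
    (PT.cons (PT.snd.comp PT.snd) (PT.fst.comp PT.snd)) ⟨.X + 1, fun c x a => ?_⟩).congr fun c => ?_
  · simp only [esize_cons, Polynomial.eval_add, Polynomial.eval_X, Polynomial.eval_one]; omega
  · simp

theorem PT.append {l m : γ → List α} (hl : PT l) (hm : PT m) : PT (fun c => l c ++ m c) := by
  refine (PT.foldl (g := fun _ (x : List α) (a : α) => a :: x) hl.reverse hm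
    (PT.cons (PT.snd.comp PT.snd) (PT.fst.comp PT.snd)) ⟨.X + 1, fun c x a => ?_⟩).congr fun c => ?_
  · simp only [esize_cons, Polynomial.eval_add, Polynomial.eval_X, Polynomial.eval_one]; omega
  · simp

theorem PT.flatMap {l : γ → List α} {f : γ → α → List β} (hl : PT l)
    (hf : PT (fun x : γ × α => f x.1 x.2)) : PT (fun c => (l c).flatMap (f c)) := by
  have hfold : ∀ (c : γ) (l : List α) (x : List β),
      l.foldl (fun x a => x ++ f c a) x = x ++ l.flatMap (f c) := by
    intro c l
    induction l with
    | nil => simp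
    | cons a l ih => intro x; simp [ih]
  obtain ⟨B, hB⟩ := hf.exists_bound
  refine (PT.foldl (g := fun c (x : List β) (a : α) => x ++ f c a) hl (PT.const [])
    (PT.append (PT.fst.comp PT.snd) (hf.comp (PT.fst.pair (PT.snd.comp PT.snd))))
    ⟨B.comp (.X + 1), fun c x a => ?_⟩).congr fun c => by rw [hfold]; rfl
  have h1 := esize_append x (f c a)
  have h2 := hB (c, a)
  simp only [esize_prod, Polynomial.eval_comp, Polynomial.eval_add, Polynomial.eval_X,
    Polynomial.eval_one] at h2 ⊢
  omega

theorem PT.map {l : γ → List α} {f : γ → α → β} (hl : PT l)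
    (hf : PT (fun x : γ × α => f x.1 x.2)) : PT (fun c => (l c).map (f c)) :=
  (PT.flatMap (f := fun c a => [f c a]) hl (hf.cons (PT.const []))).congr fun c => by
    rw [List.map_eq_flatMap]

theorem PT.getD {l : γ → List α} (d : α) (hl : PT l) (j : ℕ) : PT (fun c => (l c).getD j d) := by
  induction j generalizing l with
  | zero => exact (hl.headD (PT.const d)).congr fun c => by cases l c <;> rfl
  | succ j ih => exact (ih hl.tail).congr fun c => by cases l c <;> simp

/-! ### Predicates decidable in polynomial time -/

/-- Predicates decidable in polynomial time. -/
def PTP (p : α → Prop) : Prop :=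
  ∃ t : α → Bool, PT t ∧ ∀ a, t a = true ↔ p a

theorem PTP.congr {p q : α → Prop} (hp : PTP p) (h : ∀ a, q a ↔ p a) : PTP q :=
  let ⟨t, ht, h'⟩ := hp
  ⟨t, ht, fun a => (h' a).trans (h a).symm⟩

theorem PTP.comp {p : β → Prop} {f : α → β} (hp : PTP p) (hf : PT f) : PTP (fun a => p (f a)) :=
  let ⟨t, ht, h⟩ := hp
  ⟨fun a => t (f a), ht.comp hf, fun a => h (f a)⟩

theorem PTP.const (p : Prop) : PTP (fun _ : α => p) := by
  classical
  exact ⟨fun _ => decide p, PT.const _, fun _ => by simp⟩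

theorem PTP.not {p : α → Prop} (hp : PTP p) : PTP (fun a => ¬ p a) := by
  obtain ⟨t, ht, h⟩ := hp
  refine ⟨_, ht.ite (PT.const false) (PT.const true), fun a => ?_⟩
  change _ ↔ ¬ p a
  rw [← h]
  cases t a <;> simp

theorem PTP.and {p q : α → Prop} (hp : PTP p) (hq : PTP q) : PTP (fun a => p a ∧ q a) := by
  obtain ⟨t, ht, h⟩ := hp
  obtain ⟨u, hu, h'⟩ := hq
  refine ⟨_, ht.ite hu (PT.const false), fun a => ?_⟩
  change _ ↔ p a ∧ q a
  rw [← h, ← h']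
  cases t a <;> simp

theorem PTP.or {p q : α → Prop} (hp : PTP p) (hq : PTP q) : PTP (fun a => p a ∨ q a) :=
  (hp.not.and hq.not).not.congr fun a => by tauto

theorem PTP.imp {p q : α → Prop} (hp : PTP p) (hq : PTP q) : PTP (fun a => p a → q a) :=
  (hp.not.or hq).congr fun a => by tauto

theorem PTP.ite {p : α → Prop} [DecidablePred p] {f g : α → β} (hp : PTP p) (hf : PT f)
    (hg : PT g) : PT (fun a => if p a then f a else g a) := by
  obtain ⟨t, ht, h⟩ := hp
  refine (ht.ite hf hg).congr fun a => ?_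
  by_cases ha : p a
  · rw [if_pos ha, if_pos ((h a).2 ha)]
  · rw [if_neg ha, if_neg (fun h' => ha ((h a).1 h'))]

theorem PTP.exists_mem {l : γ → List α} {p : γ → α → Prop} (hl : PT l)
    (hp : PTP (fun x : γ × α => p x.1 x.2)) : PTP (fun c => ∃ a ∈ l c, p c a) := by
  obtain ⟨t, ht, h⟩ := hp
  refine ⟨_, PT.foldl (s := fun _ => false)
    (g := fun c (b : Bool) a => if b = true then true else t (c, a)) hl (PT.const _)
    (PT.ite (PT.fst.comp PT.snd) (PT.const _) (ht.comp (PT.fst.pair (PT.snd.comp PT.snd))))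
    ⟨3, fun c x a => ?_⟩, fun c => ?_⟩
  · have : ∀ b : Bool, esize b ≤ 3 := by
      intro b; cases b <;> simp [esize, enc, encBool, Data.size]
    simp only [Polynomial.eval_ofNat]
    exact (this _).trans (by omega)
  · have key : ∀ (l : List α) (b : Bool), l.foldl (fun (b : Bool) a =>
        if b = true then true else t (c, a)) b = true ↔ b = true ∨ ∃ a ∈ l, p c a := by
      intro l
      induction l with
      | nil => simp
      | cons a l ih =>
        intro b
        rw [List.foldl_cons, ih]
        cases b <;> simp [h]
    rw [key]
    simp

theorem PTP.forall_mem {l : γ → List α} {p : γ → α → Prop} (hl : PT l)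
    (hp : PTP (fun x : γ × α => p x.1 x.2)) : PTP (fun c => ∀ a ∈ l c, p c a) :=
  (PTP.exists_mem (p := fun c a => ¬ p c a) hl hp.not).not.congr fun c => by push Not; rfl

/-- Conjunctions over a fixed finite set. -/
theorem PTP.forall_finite {ι : Type} {s : Set ι} (hs : s.Finite) {p : ι → α → Prop}
    (hp : ∀ i ∈ s, PTP (p i)) : PTP (fun a => ∀ i ∈ s, p i a) := by
  induction s, hs using Set.Finite.induction_on with
  | empty => exact (PTP.const True).congr fun a => by simp
  | insert _ _ ih =>
    exact ((hp _ (Set.mem_insert _ _)).and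
      (ih fun i hi => hp i (Set.mem_insert_of_mem _ hi))).congr fun a => by simp

/-- Disjunctions over a fixed finite set. -/
theorem PTP.exists_finite {ι : Type} {s : Set ι} (hs : s.Finite) {p : ι → α → Prop}
    (hp : ∀ i ∈ s, PTP (p i)) : PTP (fun a => ∃ i ∈ s, p i a) :=
  (PTP.forall_finite hs (p := fun i a => ¬ p i a) fun i hi => (hp i hi).not).not.congr
    fun a => by push Not; rfl

theorem PT.filter {l : γ → List α} {p : γ → α → Prop} [∀ c, DecidablePred (p c)] (hl : PT l)
    (hp : PTP (fun x : γ × α => p x.1 x.2)) : PT (fun c => (l c).filter (fun a => p c a)) := by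
  refine (PT.flatMap (f := fun c a => if p c a then [a] else []) hl
    (PTP.ite (p := fun x : γ × α => p x.1 x.2) hp (PT.snd.cons (PT.const []))
      (PT.const []))).congr fun c => ?_
  induction l c with
  | nil => rfl
  | cons a l ih =>
    by_cases h : p c a <;> simp [h, ih]

/-- Lists with a fixed number of entries. -/
theorem PT.mapFixed {ι : Type} {f : ι → α → β} (L : List ι) (hf : ∀ i ∈ L, PT (f i)) :
    PT (fun a => L.map (fun i => f i a)) := by
  induction L with
  | nil => exact PT.const []
  | cons i L ih =>
    exact (hf i List.mem_cons_self).cons (ih fun j hj => hf j (List.mem_cons_of_mem _ hj))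

/-- Concatenations of a fixed number of lists. -/
theorem PT.flatMapFixed {ι : Type} {f : ι → α → List β} (L : List ι) (hf : ∀ i ∈ L, PT (f i)) :
    PT (fun a => L.flatMap (fun i => f i a)) := by
  induction L with
  | nil => exact PT.const []
  | cons i L ih =>
    exact ((hf i List.mem_cons_self).append
      (ih fun j hj => hf j (List.mem_cons_of_mem _ hj))).congr fun a => by simp

/-! ### Equality of trees -/

/-- One step of the comparison of two trees: `x.1` is a stack of pairs of trees that remain to be
compared, `x.2` is false when a difference has been found. -/
def eqStep (x : List (Data × Data) × Bool) : List (Data × Data) × Bool :=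
  match x.1 with
  | [] => x
  | (.nil, .nil) :: r => (r, x.2)
  | (.cons a b, .cons c d) :: r => ((a, c) :: (b, d) :: r, x.2)
  | _ => ([], false)

theorem PT.dataCases {n : γ → β} {f : γ × Data × Data → β} (hn : PT n) (hf : PT f) :
    PT (fun x : γ × Data => match x.2 with
      | .nil => n x.1
      | .cons a b => f (x.1, a, b)) := by
  refine PT.dispatch hn hf fun x => ?_
  obtain ⟨c, d⟩ := x
  cases d with
  | nil => exact .inl ⟨c, rfl, rfl⟩
  | cons a b => exact .inr ⟨(c, a, b), rfl, by simp [enc, Data.tl], rfl⟩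

theorem PT.eqStep : PT eqStep := by
  -- the context consists of the remaining stack and the flag
  have g0 : PT (fun x : (List (Data × Data) × Bool) × Data => match x.2 with
      | .nil => x.1
      | .cons _ _ => ([], false)) :=
    PT.dataCases (γ := List (Data × Data) × Bool) (n := fun c => c) (f := fun _ => ([], false))
      PT.id (PT.const _)
  have g1 : PT (fun x : ((List (Data × Data) × Bool) × Data × Data) × Data =>
      match x.2 with
      | .nil => (([] : List (Data × Data)), false)
      | .cons c d => ((x.1.2.1, c) :: (x.1.2.2, d) :: x.1.1.1, x.1.1.2)) :=
    PT.dataCases (γ := (List (Data × Data) × Bool) × Data × Data) (n := fun _ => ([], false))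
      (f := fun y => ((y.1.2.1, y.2.1) :: (y.1.2.2, y.2.2) :: y.1.1.1, y.1.1.2))
      (PT.const _)
      ((((PT.fst.comp (PT.snd.comp PT.fst)).pair (PT.fst.comp PT.snd)).cons
        (((PT.snd.comp (PT.snd.comp PT.fst)).pair (PT.snd.comp PT.snd)).cons
          (PT.fst.comp (PT.fst.comp PT.fst)))).pair (PT.snd.comp (PT.fst.comp PT.fst)))
  have g2 := PT.dataCases (γ := (List (Data × Data) × Bool) × Data)
    (f := fun x : ((List (Data × Data) × Bool) × Data) × Data × Data =>
      match x.1.2 with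
      | .nil => (([] : List (Data × Data)), false)
      | .cons c d => ((x.2.1, c) :: (x.2.2, d) :: x.1.1.1, x.1.1.2)) g0
    (g1.comp (((PT.fst.comp PT.fst).pair PT.snd).pair (PT.snd.comp PT.fst)))
  have g3 := PT.listCases (γ := Bool) (α := Data × Data)
    (n := fun b : Bool => (([] : List (Data × Data)), b)) ((PT.const _).pair PT.id)
    (g2.comp (f := fun x : Bool × (Data × Data) × List (Data × Data) =>
      (((x.2.2, x.1), x.2.1.2), x.2.1.1))
      ((((PT.snd.comp PT.snd).pair PT.fst).pair (PT.snd.comp (PT.fst.comp PT.snd))).pair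
        (PT.fst.comp (PT.fst.comp PT.snd))))
  refine (g3.comp (PT.snd.pair PT.fst)).congr fun x => ?_
  obtain ⟨s, b⟩ := x
  rcases s with _ | ⟨⟨_ | ⟨a, a'⟩, _ | ⟨c, c'⟩⟩, r⟩ <;> rfl

theorem esize_eqStep (x : List (Data × Data) × Bool) : esize (eqStep x) ≤ esize x := by
  obtain ⟨s, b⟩ := x
  have hb : esize false ≤ esize b := by
    cases b <;> simp [esize, enc, encBool, Data.size]
  rcases s with _ | ⟨⟨_ | ⟨a, a'⟩, _ | ⟨c, c'⟩⟩, r⟩ <;>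
    simp only [eqStep, esize_prod, esize_cons, esize_nil, le_refl] <;>
    simp only [esize, enc, Data.size] at * <;> omega

/-- The number of steps that the comparison of all pairs on a stack takes. -/
def eqMeasure : List (Data × Data) → ℕ
  | [] => 0
  | (.nil, .nil) :: r => eqMeasure r + 1
  | (.cons a b, .cons c d) :: r => eqMeasure ((a, c) :: (b, d) :: r) + 1
  | _ => 1
termination_by s => (s.map fun p => p.1.size).sum
decreasing_by all_goals simp [Data.size]; try omega

theorem eqMeasure_le (s : List (Data × Data)) :
    eqMeasure s ≤ (s.map fun p => p.1.size).sum := by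
  induction s using eqMeasure.induct with
  | case1 => simp [eqMeasure]
  | case2 r ih => simp [eqMeasure, Data.size]; omega
  | case3 a b c d r ih => simp [eqMeasure, Data.size] at ih ⊢; omega
  | case4 s h1 h2 h3 =>
    rcases s with _ | ⟨⟨_ | ⟨a, a'⟩, _ | ⟨c, c'⟩⟩, r⟩
    · exact absurd rfl h1
    · exact absurd rfl (h2 r)
    · simp [eqMeasure, Data.size]
    · simp [eqMeasure, Data.size]; omega
    · exact absurd rfl (h3 _ _ _ _ _)

theorem eqStep_iterate (s : List (Data × Data)) (b : Bool) :
    ∃ b', eqStep^[eqMeasure s] (s, b) = ([], b') ∧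
      (b' = true ↔ b = true ∧ ∀ p ∈ s, p.1 = p.2) ∧
      ∀ i < eqMeasure s, (eqStep^[i] (s, b)).1 ≠ [] := by
  induction s using eqMeasure.induct generalizing b with
  | case1 => exact ⟨b, by simp [eqMeasure]⟩
  | case2 r ih =>
    obtain ⟨b', h1, h2, h3⟩ := ih b
    refine ⟨b', by rw [eqMeasure, Function.iterate_succ_apply]; exact h1, by simpa using h2, ?_⟩
    intro i hi
    cases i with
    | zero => simp
    | succ i =>
      rw [Function.iterate_succ_apply]
      exact h3 i (by simpa [eqMeasure] using hi)
  | case3 a b₁ c d r ih =>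
    obtain ⟨b', h1, h2, h3⟩ := ih b
    refine ⟨b', by rw [eqMeasure, Function.iterate_succ_apply]; exact h1,
      by simpa [and_assoc] using h2, ?_⟩
    intro i hi
    cases i with
    | zero => simp
    | succ i =>
      rw [Function.iterate_succ_apply]
      exact h3 i (by simpa [eqMeasure] using hi)
  | case4 s h1 h2 h3 =>
    rcases s with _ | ⟨⟨_ | ⟨a, a'⟩, _ | ⟨c, c'⟩⟩, r⟩
    · exact absurd rfl h1
    · exact absurd rfl (h2 r)
    · exact ⟨false, by simp [eqMeasure, ABD.eqStep]⟩
    · exact ⟨false, by simp [eqMeasure, ABD.eqStep]⟩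
    · exact absurd rfl (h3 _ _ _ _ _)

theorem PTP.eq {f g : γ → β} (hf : PT f) (hg : PT g) : PTP (fun c => f c = g c) := by
  have htest : PT (fun x : List (Data × Data) × Bool => match x.1 with
      | [] => false
      | _ :: _ => true) :=
    ((PT.listCases (γ := Bool) (α := Data × Data) (n := fun _ => false) (f := fun _ => true)
      (PT.const _) (PT.const _)).comp (PT.snd.pair PT.fst)).congr
        fun x => by obtain ⟨s, b⟩ := x; cases s <;> rfl
  have hle : ∀ s : List (Data × Data), (s.map fun p => p.1.size).sum ≤ esize s := by
    intro s
    induction s with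
    | nil => simp
    | cons p s ih =>
      simp only [List.map_cons, List.sum_cons, esize_cons]
      have : p.1.size ≤ esize p := by rw [esize_prod]; simp only [esize, enc]; omega
      omega
  have hloop := PT.loop htest PT.eqStep (fun x => eqMeasure x.1) .X (fun x i hi => ?_)
    (fun x => ?_) (fun x => ?_) (fun x i _ => ?_)
  · have henc : PT (fun b : β => (enc b : Data)) := PT.id.recode fun b => ⟨b, rfl, rfl⟩
    refine ⟨_, PT.snd.comp (hloop.comp (f := fun c => ([((enc (f c) : Data), (enc (g c) : Data))],
      true)) ((((henc.comp hf).pair (henc.comp hg)).cons (PT.const [])).pair (PT.const true))),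
      fun c => ?_⟩
    obtain ⟨b', h1, h2, -⟩ := eqStep_iterate [(enc (f c), enc (g c))] true
    dsimp only
    rw [h1]
    simp only [h2, List.mem_singleton, forall_eq, true_and]
    exact ⟨fun h => enc_inj h, fun h => by rw [h]⟩
  · obtain ⟨s, b⟩ := x
    obtain ⟨b', -, -, h3⟩ := eqStep_iterate s b
    have := h3 i hi
    cases h : (ABD.eqStep^[i] (s, b)).1 with
    | nil => exact absurd h this
    | cons => rfl
  · obtain ⟨s, b⟩ := x
    obtain ⟨b', h1, -, -⟩ := eqStep_iterate s b
    dsimp only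
    rw [h1]
  · have := (eqMeasure_le x.1).trans (hle x.1)
    rw [Polynomial.eval_X, esize_prod]
    omega
  · rw [Polynomial.eval_X]
    induction i with
    | zero => simp
    | succ i ih =>
      rw [Function.iterate_succ_apply']
      exact (esize_eqStep _).trans (ih (by omega))

theorem PTP.mem {f : γ → β} {l : γ → List β} (hf : PT f) (hl : PT l) :
    PTP (fun c => f c ∈ l c) :=
  (PTP.exists_mem (p := fun c b => b = f c) hl (PTP.eq PT.snd (hf.comp PT.fst))).congr
    fun c => by simp

end Framework

/-! ### Facts and their entries -/

instance : Inhabited Val := ⟨.const 0⟩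

/-- The `j`-th entry of a fact, with a default value beyond the arity. It serves to compare entries
of two facts without a proof that their relation symbols are the same. -/
def entry {S : Schema} {V : Type} [Inhabited V] (f : Fact S V) (j : ℕ) : V :=
  (List.ofFn f.2).getD j default

section Entry

variable {S : Schema} {V W : Type} [Inhabited V] [Inhabited W]

theorem entry_val (f : Fact S V) (j : Fin (S.arity f.1)) : entry f j = f.2 j := by
  simp [entry]

theorem entry_of_lt (f : Fact S V) {j : ℕ} (h : j < S.arity f.1) : entry f j = f.2 ⟨j, h⟩ :=
  entry_val f ⟨j, h⟩

theorem entry_mapFact (h : V → W) (f : Fact S V) {j : ℕ} (hj : j < S.arity f.1) :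
    entry (mapFact h f) j = h (entry f j) := by
  rw [entry_of_lt f hj, entry_of_lt (mapFact h f) hj]
  rfl

theorem fact_ext {f g : Fact S V} (h : f.1 = g.1)
    (h' : ∀ j < S.arity f.1, entry f j = entry g j) : f = g := by
  obtain ⟨R, u⟩ := f
  obtain ⟨R', u'⟩ := g
  obtain rfl : R = R' := h
  congr 1
  funext j
  have := h' j j.2
  rwa [entry_val ⟨R, u⟩ j, entry_val ⟨R, u'⟩ j] at this

theorem mapFact_congr {V W : Type} {f : Fact S V} {g h : V → W}
    (H : ∀ j, g (f.2 j) = h (f.2 j)) : mapFact g f = mapFact h f := by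
  simp only [mapFact]
  congr 1
  funext j
  exact H j

theorem mapFact_inj {V W : Type} {f : Fact S V} {g h : V → W} (H : mapFact g f = mapFact h f)
    (j : Fin (S.arity f.1)) : g (f.2 j) = h (f.2 j) := by
  simp only [mapFact, Sigma.mk.injEq, heq_eq_eq, true_and] at H
  exact congrFun H j

theorem mapFact_mapFact {V W X : Type} (g : W → X) (h : V → W) (f : Fact S V) :
    mapFact g (mapFact h f) = mapFact (fun x => g (h x)) f := rfl

theorem mem_avarsOf {T : Schema} {l : List (AFact T ℕ)} {A : AFact T ℕ} (hA : A ∈ l)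
    (j : Fin (T.arity A.2.1)) : A.2.2 j ∈ avarsOf l :=
  ⟨A, hA, j, rfl⟩

end Entry

/-! ### Annotation density one and safety -/

/-- The two annotated atoms have the same annotated symbol. -/
def SameSym {T : Schema} (A B : AFact T ℕ) : Prop := A.1 = B.1 ∧ A.2.1 = B.2.1

section Density

variable {S T : Schema} {M : Mapping S T}

theorem two_le_countP {α : Type} {p : α → Bool} {l : List α} {a b : α} (ha : a ∈ l)
    (hb : b ∈ l) (hne : a ≠ b) (hpa : p a = true) (hpb : p b = true) : 2 ≤ l.countP p := by
  classical
  rw [List.countP_eq_length_filter, ← Finset.card_pair hne]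
  refine le_trans (Finset.card_le_card ?_) (List.toFinset_card_le _)
  intro x hx
  simp only [Finset.mem_insert, Finset.mem_singleton] at hx
  rcases hx with rfl | rfl <;> simp [*]

/-- If the annotation density is one, an annotated symbol determines its head atom. -/
theorem eq_of_sameSym (hd : M.density = 1) {ξ ξ' : Abd S T} (hξ : ξ ∈ M.abds)
    (hξ' : ξ' ∈ M.abds) {A A' : AFact T ℕ} (hA : A ∈ ξ.head) (hA' : A' ∈ ξ'.head)
    (h : SameSym A A') : ξ = ξ' ∧ A = A' := by
  have hocc : M.occ A.2.1 A.1 ≤ 1 := by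
    have : (M.occ A.2.1 A.1 : ℕ∞) ≤ M.density :=
      le_iSup₂ (f := fun (R : Fin T.card) (i : ℤ) => (M.occ R i : ℕ∞)) A.2.1 A.1
    rw [hd] at this
    exact_mod_cast this
  set p : AFact T ℕ → Bool := fun B => decide (B.1 = A.1 ∧ B.2.1 = A.2.1) with hp
  have hpA : p A = true := by simp [hp]
  have hpA' : p A' = true := by simp [hp, h.1, h.2]
  have hocc' : ∑ ζ ∈ M.abds, ζ.head.countP p ≤ 1 := hocc
  by_cases hne : ξ = ξ'
  · subst hne
    refine ⟨rfl, ?_⟩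
    by_contra hAA
    have h1 := two_le_countP hA hA' hAA hpA hpA'
    have h2 := Finset.single_le_sum (f := fun ζ : Abd S T => ζ.head.countP p)
      (fun _ _ => Nat.zero_le _) hξ
    omega
  · exfalso
    classical
    have h1 : 0 < ξ.head.countP p := List.countP_pos_iff.2 ⟨A, hA, hpA⟩
    have h2 : 0 < ξ'.head.countP p := List.countP_pos_iff.2 ⟨A', hA', hpA'⟩
    have hsub : ({ξ, ξ'} : Finset (Abd S T)) ⊆ M.abds := by
      intro x hx
      simp only [Finset.mem_insert, Finset.mem_singleton] at hx
      rcases hx with rfl | rfl <;> assumption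
    have h3 := Finset.sum_le_sum_of_subset (f := fun ζ : Abd S T => ζ.head.countP p) hsub
    rw [Finset.sum_pair hne] at h3
    omega

theorem mem_frontier_iff {ξ : Abd S T} {A : AFact T ℕ} (hA : A ∈ ξ.head)
    (j : Fin (T.arity A.2.1)) : A.2.2 j ∈ ξ.frontier ↔ A.2.2 j ∉ ξ.exVars := by
  have := mem_avarsOf hA j
  simp only [Abd.frontier, Abd.exVars, Set.mem_inter_iff, Set.mem_sdiff]
  tauto

/-- If the annotation density is one, the affected positions of the symbol of a head atom are those
of the existential variables of this atom. -/
theorem mem_aff_iff (hd : M.density = 1) {ξ : Abd S T} (hξ : ξ ∈ M.abds) {A : AFact T ℕ}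
    (hA : A ∈ ξ.head) (j : Fin (T.arity A.2.1)) :
    ((A.1, ⟨A.2.1, j⟩) : APos T) ∈ M.aff ↔ A.2.2 j ∈ ξ.exVars := by
  constructor
  · rintro ⟨ξ', hξ', A', hA', j', hj', heq⟩
    simp only [Prod.mk.injEq, Sigma.mk.injEq] at heq
    obtain ⟨rfl, rfl⟩ := eq_of_sameSym hd hξ hξ' hA hA' ⟨heq.1, heq.2.1⟩
    rwa [eq_of_heq heq.2.2]
  · exact fun h => ⟨ξ, hξ, A, hA, j, h, rfl⟩

theorem add_le_sum_map {α : Type} (f : α → ℕ) {l : List α} {a b : α} (ha : a ∈ l)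
    (hb : b ∈ l) (hne : a ≠ b) : f a + f b ≤ (l.map f).sum := by
  induction l with
  | nil => simp at ha
  | cons c l ih =>
    have key : ∀ x ∈ l, f x ≤ (l.map f).sum := fun x hx =>
      List.single_le_sum (by simp) _ (List.mem_map_of_mem hx)
    rw [List.map_cons, List.sum_cons]
    rcases List.mem_cons.1 ha with rfl | ha' <;>
      rcases List.mem_cons.1 hb with rfl | hb'
    · exact absurd rfl hne
    · have := key b hb'; omega
    · have := key a ha'; omega
    · have := ih ha' hb'; omega

/-- A variable that occurs less than twice in the body of an aegd has only one occurrence. -/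
theorem Aegd.occurrence_unique {e : Aegd T} {x : ℕ} (hx : e.count x < 2) {B B' : AFact T ℕ}
    (hB : B ∈ e.body) (hB' : B' ∈ e.body) {j j' : ℕ} (hj : j < T.arity B.2.1)
    (hj' : j' < T.arity B'.2.1) (h : entry B.2 j = x) (h' : entry B'.2 j' = x) :
    B = B' ∧ j = j' := by
  have hpos : ∀ (C : AFact T ℕ) (i : ℕ), i < T.arity C.2.1 → entry C.2 i = x →
      0 < (List.ofFn C.2.2).count x := by
    intro C i hi hC
    rw [List.count_pos_iff, List.mem_ofFn]
    exact ⟨⟨i, hi⟩, by rw [← hC, entry_of_lt C.2 hi]⟩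
  by_cases hBB : B = B'
  · subst hBB
    refine ⟨rfl, ?_⟩
    by_contra hne
    have hdup : ∀ i i' : ℕ, i < i' → i' < T.arity B.2.1 → entry B.2 i = x → entry B.2 i' = x →
        False := by
      intro i i' hii hi' e1 e2
      have h1 : List.Duplicate x (List.ofFn B.2.2) := by
        rw [List.duplicate_iff_exists_distinct_get]
        refine ⟨⟨i, by simp; omega⟩, ⟨i', by simpa using hi'⟩, hii, ?_, ?_⟩
        · rw [← e1, entry_of_lt B.2 (hii.trans hi')]; simp
        · rw [← e2, entry_of_lt B.2 hi']; simp
      rw [List.duplicate_iff_two_le_count] at h1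
      have h2 : (List.ofFn B.2.2).count x ≤ e.count x :=
        List.single_le_sum (by simp) _
          (List.mem_map_of_mem (f := fun A : AFact T ℕ => (List.ofFn A.2.2).count x) hB)
      omega
    rcases Nat.lt_or_gt_of_ne hne with hlt | hlt
    · exact hdup j j' hlt hj' h h'
    · exact hdup j' j hlt hj h' h
  · exfalso
    have h1 := hpos B j hj h
    have h2 := hpos B' j' hj' h'
    have h3 : _ ≤ e.count x := add_le_sum_map
      (fun A : AFact T ℕ => (List.ofFn A.2.2).count x) hB hB' hBB
    omega

end Density

/-! ### Triggers and the equalities that are forced on a chase -/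

section Chase

variable {S T : Schema}

/-- The assignment `g` is a match of the source side of `ξ` in `I`. -/
def Trig (ξ : Abd S T) (I : Set (Fact S ℕ)) (g : ℕ → ℕ) : Prop :=
  ∀ A ∈ ξ.body, mapFact g A ∈ I

/-- The atom `b` under the assignment `h` agrees with the atom `a` of `ξ` under `g` in all positions
where `a` has a universally quantified variable. -/
def Fits (ξ : Abd S T) (a : Fact T ℕ) (g : ℕ → ℕ) (b : Fact T ℕ) (h : ℕ → ℕ) : Prop :=
  ∀ j < T.arity a.1, entry a j ∈ ξ.frontier → h (entry b j) = g (entry a j)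

/-- The assignment `h` matches the body of the aegd `e` in the chase of `I`, up to the values in
affected positions. -/
def Soft (M : Mapping S T) (I : Set (Fact S ℕ)) (e : Aegd T) (h : ℕ → ℕ) : Prop :=
  ∀ B ∈ e.body, ∃ ξ ∈ M.abds, ∃ A ∈ ξ.head, SameSym A B ∧ ∃ g, Trig ξ I g ∧ Fits ξ A.2 g B.2 h

/-- Some aegd forces the value `c` for the existential variable `z` in the fact that the trigger `g`
yields for the head atom `A` of `ξ`. -/
def ForcedBy (M : Mapping S T) (I : Set (Fact S ℕ)) (ξ : Abd S T) (A : AFact T ℕ) (g : ℕ → ℕ)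
    (z c : ℕ) : Prop :=
  z ∈ ξ.exVars ∧ ∃ e ∈ M.aegds, ∃ B ∈ e.body, SameSym A B ∧ ∃ h, Soft M I e h ∧
    Fits ξ A.2 g B.2 h ∧ ∃ l r, (l = e.lhs ∧ r = e.rhs ∨ l = e.rhs ∧ r = e.lhs) ∧ l ≠ r ∧
      (∃ j < T.arity A.2.1, entry A.2 j = z ∧ entry B.2 j = l) ∧ h r = c

/-- The aegds that do not involve affected positions hold in the chase of `I`. -/
def UnaffectedHold (M : Mapping S T) (I : Set (Fact S ℕ)) : Prop :=
  ∀ e ∈ M.aegds, ¬ M.OccursAffected e e.lhs → ¬ M.OccursAffected e e.rhs →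
    ∀ h, Soft M I e h → h e.lhs = h e.rhs

/-- The right-to-left directions of the abds hold in the chase of `I`: if each atom of a head comes
from some trigger, then they all come from one. -/
def BackHold (M : Mapping S T) (I : Set (Fact S ℕ)) : Prop :=
  ∀ ξ ∈ M.abds, ∀ h, (∀ A ∈ ξ.head, ∃ g, Trig ξ I g ∧ Fits ξ A.2 g A.2 h) →
    ∃ g, Trig ξ I g ∧ ∀ x ∈ ξ.frontier, g x = h x

/-- The facts that a solution may contain on account of the trigger `g` and the head atoms `a` of
`ξ`, annotations removed: all head atoms that differ from one another only in their annotations have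
to be instantiated by the same fact. -/
def Cand (M : Mapping S T) (I : Set (Fact S ℕ)) (ξ : Abd S T) (a : Fact T ℕ) (g : ℕ → ℕ) :
    Set (Fact T ℕ) :=
  {f | ∃ g', f = mapFact g' a ∧ Fits ξ a g a g' ∧
    ∀ A ∈ ξ.head, A.2 = a → ∀ z c, ForcedBy M I ξ A g z c → g' z = c}

theorem fits_self {ξ : Abd S T} {a : Fact T ℕ} {g h : ℕ → ℕ} :
    Fits ξ a g a h ↔ ∀ j, a.2 j ∈ ξ.frontier → h (a.2 j) = g (a.2 j) := by
  constructor
  · intro H j hj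
    have := H j j.2
    rw [entry_val] at this
    exact this hj
  · intro H j hj
    rw [entry_of_lt a hj]
    exact H _

theorem fits_self_of_eqOn {ξ : Abd S T} {A : AFact T ℕ} {g h : ℕ → ℕ}
    (H : ∀ x ∈ ξ.frontier, h x = g x) : Fits ξ A.2 g A.2 h :=
  fits_self.2 fun _ hj => H _ hj

theorem Fits.congr_left {ξ : Abd S T} {a b : Fact T ℕ} {g g' h : ℕ → ℕ} (H : Fits ξ a g b h)
    (H' : Fits ξ a g a g') : Fits ξ a g' b h :=
  fun j hj hx => (H j hj hx).trans (H' j hj hx).symm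

theorem Fits.symm {ξ : Abd S T} {a : Fact T ℕ} {g g' : ℕ → ℕ} (H : Fits ξ a g a g') :
    Fits ξ a g' a g :=
  fun j hj hx => (H j hj hx).symm

theorem Fits.trans {ξ : Abd S T} {a : Fact T ℕ} {g g' g'' : ℕ → ℕ} (H : Fits ξ a g a g')
    (H' : Fits ξ a g' a g'') : Fits ξ a g a g'' :=
  fun j hj hx => (H' j hj hx).trans (H j hj hx)

theorem Fits.of_mapFact {ξ : Abd S T} {a : Fact T ℕ} {g g' g'' : ℕ → ℕ} (H : Fits ξ a g a g')
    (h : mapFact g' a = mapFact g'' a) : Fits ξ a g a g'' :=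
  fits_self.2 fun j hj => (mapFact_inj h j).symm.trans (fits_self.1 H j hj)

theorem ForcedBy.congr {M : Mapping S T} {I : Set (Fact S ℕ)} {ξ : Abd S T} {A : AFact T ℕ}
    {g g' : ℕ → ℕ} {z c : ℕ} (H : ForcedBy M I ξ A g z c) (H' : Fits ξ A.2 g A.2 g') :
    ForcedBy M I ξ A g' z c := by
  obtain ⟨hz, e, he, B, hB, hs, h, h1, h2, h3⟩ := H
  exact ⟨hz, e, he, B, hB, hs, h, h1, h2.congr_left H', h3⟩

theorem Cand_congr {M : Mapping S T} {I : Set (Fact S ℕ)} {ξ : Abd S T} {a : Fact T ℕ}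
    {g g' : ℕ → ℕ} (H : Fits ξ a g a g') : Cand M I ξ a g = Cand M I ξ a g' := by
  have key : ∀ {g g' : ℕ → ℕ}, Fits ξ a g a g' → Cand M I ξ a g ⊆ Cand M I ξ a g' := by
    rintro g g' H f ⟨k, hf, hk, hF⟩
    refine ⟨k, hf, H.symm.trans hk, fun A hA hAa z c hz => hF A hA hAa z c ?_⟩
    subst hAa
    exact hz.congr H.symm
  exact (key H).antisymm (key H.symm)

/-- As a variable in an affected position occurs only once, a match up to affected positions can be
turned into a match with prescribed facts. -/
theorem exists_hard_match {M : Mapping S T} (hsafe : M.Safe) (hd : M.density = 1) {e : Aegd T}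
    (he : e ∈ M.aegds) {h : ℕ → ℕ} {k : AFact T ℕ → AFact T ℕ}
    (hk : ∀ B ∈ e.body, ∃ ξ ∈ M.abds, ∃ A ∈ ξ.head, SameSym A B ∧ ∃ g,
      k B = mapAFact g A ∧ Fits ξ A.2 g B.2 h) :
    ∃ h', (∀ B ∈ e.body, mapAFact h' B = k B) ∧ ∀ x, ¬ M.OccursAffected e x → h' x = h x := by
  classical
  have hch : ∀ x, ∃ v, (¬ M.OccursAffected e x → v = h x) ∧ (M.OccursAffected e x →
      ∀ B ∈ e.body, ∀ j < T.arity B.2.1, entry B.2 j = x → v = entry (k B).2 j) := by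
    intro x
    by_cases hx : M.OccursAffected e x
    · obtain ⟨B, hB, j, hj, -⟩ := id hx
      refine ⟨entry (k B).2 j, fun h' => absurd hx h', fun _ B' hB' j' hj' hx' => ?_⟩
      have hlt : e.count x < 2 := by
        by_contra hc
        exact hsafe e he x (by omega) hx
      obtain ⟨rfl, rfl⟩ := e.occurrence_unique hlt hB hB' j.2 hj' (by rw [entry_val, hj]) hx'
      rfl
    · exact ⟨h x, fun _ => rfl, fun h' => absurd h' hx⟩
  choose h' h1 h2 using hch
  refine ⟨h', fun B hB => ?_, h1⟩
  obtain ⟨ξ, hξ, A, hA, ⟨hs1, hs2⟩, g, hg, hfit⟩ := hk B hB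
  refine Prod.ext ?_ (fact_ext ?_ fun j hj => ?_)
  · rw [hg]; exact hs1.symm
  · rw [hg]; exact hs2.symm
  · have hj : j < T.arity B.2.1 := hj
    rw [show (mapAFact h' B).2 = mapFact h' B.2 from rfl, entry_mapFact h' B.2 hj]
    by_cases hx : M.OccursAffected e (entry B.2 j)
    · exact h2 _ hx B hB j hj rfl
    · rw [h1 _ hx, hg]
      have hjA : j < T.arity A.2.1 := by rwa [hs2]
      rw [show (mapAFact g A).2 = mapFact g A.2 from rfl, entry_mapFact g A.2 hjA]
      refine hfit j hjA ?_
      rw [entry_of_lt A.2 hjA, mem_frontier_iff hA, ← mem_aff_iff hd hξ hA]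
      intro hmem
      refine hx ⟨B, hB, ⟨j, hj⟩, (entry_of_lt B.2 hj).symm, ?_⟩
      obtain ⟨i, R, u⟩ := A
      obtain ⟨i', R', u'⟩ := B
      obtain rfl : i = i' := hs1
      obtain rfl : R = R' := hs2
      exact hmem

/-- Truth of the aegds in a set of annotated facts that consists of instances of the facts of the
chase and contains an instance of each of them. -/
theorem aegds_sat_iff {M : Mapping S T} (hsafe : M.Safe) (hd : M.density = 1)
    (haff : M.EquatesNoTwoAffected) {I : Set (Fact S ℕ)} {K : Set (AFact T ℕ)}
    (hK : ∀ p ∈ K, ∃ ξ ∈ M.abds, ∃ A ∈ ξ.head, ∃ g, Trig ξ I g ∧ ∃ g', Fits ξ A.2 g A.2 g' ∧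
      p = mapAFact g' A)
    (hK' : ∀ ξ ∈ M.abds, ∀ A ∈ ξ.head, ∀ g, Trig ξ I g → ∃ g', Fits ξ A.2 g A.2 g' ∧
      mapAFact g' A ∈ K) :
    (∀ e ∈ M.aegds, e.Sat K) ↔ UnaffectedHold M I ∧
      ∀ ξ ∈ M.abds, ∀ A ∈ ξ.head, ∀ g, Trig ξ I g → ∀ g', Fits ξ A.2 g A.2 g' →
        mapAFact g' A ∈ K → ∀ z c, ForcedBy M I ξ A g z c → g' z = c := by
  classical
  -- every match up to affected positions extends to a choice of facts in `K`
  have hsoft : ∀ e : Aegd T, ∀ h, Soft M I e h → ∃ k : AFact T ℕ → AFact T ℕ,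
      ∀ B ∈ e.body, k B ∈ K ∧ ∃ ξ ∈ M.abds, ∃ A ∈ ξ.head, SameSym A B ∧ ∃ g,
        k B = mapAFact g A ∧ Fits ξ A.2 g B.2 h := by
    intro e h hs
    have : ∀ B : AFact T ℕ, ∃ p : AFact T ℕ, B ∈ e.body → p ∈ K ∧ ∃ ξ ∈ M.abds, ∃ A ∈ ξ.head,
        SameSym A B ∧ ∃ g, p = mapAFact g A ∧ Fits ξ A.2 g B.2 h := by
      intro B
      by_cases hB : B ∈ e.body
      · obtain ⟨ξ, hξ, A, hA, hsym, g, hg, hfit⟩ := hs B hB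
        obtain ⟨g', hg', hmem⟩ := hK' ξ hξ A hA g hg
        exact ⟨_, fun _ => ⟨hmem, ξ, hξ, A, hA, hsym, g', rfl, hfit.congr_left hg'⟩⟩
      · exact ⟨B, fun h => absurd h hB⟩
    choose k hk using this
    exact ⟨k, fun B hB => hk B hB⟩
  constructor
  · intro hsat
    refine ⟨fun e he hl hr h hs => ?_, ?_⟩
    · obtain ⟨k, hk⟩ := hsoft e h hs
      obtain ⟨h', h1, h2⟩ := exists_hard_match hsafe hd he fun B hB => (hk B hB).2
      have := hsat e he h' fun B hB => by rw [h1 B hB]; exact (hk B hB).1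
      rwa [h2 _ hl, h2 _ hr] at this
    · rintro ξ hξ A hA g hg g' hfit hmem z c ⟨hz, e, he, B, hB, hsym, h, hs, hfitB, l, r, hlr, hne,
        ⟨j, hj, hjA, hjB⟩, hc⟩
      obtain ⟨k, hk⟩ := hsoft e h hs
      obtain ⟨h', h1, h2⟩ := exists_hard_match (k := Function.update k B (mapAFact g' A))
        hsafe hd he (h := h) fun B' hB' => by
          by_cases hBB : B' = B
          · subst hBB
            exact ⟨ξ, hξ, A, hA, hsym, g', by simp, hfitB.congr_left hfit⟩
          · rw [Function.update_of_ne hBB]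
            exact (hk B' hB').2
      have hjB' : j < T.arity B.2.1 := by rw [← hsym.2]; exact hj
      have hl : M.OccursAffected e l := by
        refine ⟨B, hB, ⟨j, hjB'⟩, by rw [← hjB, entry_of_lt B.2 hjB'], ?_⟩
        have := (mem_aff_iff hd hξ hA ⟨j, hj⟩).2 (by rw [← entry_of_lt A.2 hj, hjA]; exact hz)
        obtain ⟨i, R, u⟩ := A
        obtain ⟨i', R', u'⟩ := B
        obtain rfl : i = i' := hsym.1
        obtain rfl : R = R' := hsym.2
        exact this
      have hr : ¬ M.OccursAffected e r := by
        intro hr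
        rcases hlr with ⟨rfl, rfl⟩ | ⟨rfl, rfl⟩
        · exact haff e he hne ⟨hl, hr⟩
        · exact haff e he hne.symm ⟨hr, hl⟩
      have heq := hsat e he h' fun B' hB' => by
        rw [h1 B' hB']
        by_cases hBB : B' = B
        · subst hBB; simpa using hmem
        · rw [Function.update_of_ne hBB]
          exact (hk B' hB').1
      have heq' : h' l = h' r := by
        rcases hlr with ⟨rfl, rfl⟩ | ⟨rfl, rfl⟩
        · exact heq
        · exact heq.symm
      have h3 := h1 B hB
      rw [Function.update_self] at h3
      have h4 : entry (mapFact h' B.2) j = entry (mapFact g' A.2) j := by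
        rw [show mapFact h' B.2 = mapFact g' A.2 from congrArg Prod.snd h3]
      rw [entry_mapFact h' B.2 hjB', entry_mapFact g' A.2 hj, hjA, hjB] at h4
      rw [← h4, heq', h2 r hr, hc]
  · rintro ⟨hU, hF⟩ e he h hbody
    have hmatch : ∀ B ∈ e.body, ∃ ξ ∈ M.abds, ∃ A ∈ ξ.head, SameSym A B ∧ ∃ g, Trig ξ I g ∧
        ∃ g', Fits ξ A.2 g A.2 g' ∧ mapAFact h B = mapAFact g' A ∧ Fits ξ A.2 g B.2 h := by
      intro B hB
      obtain ⟨ξ, hξ, A, hA, g, hg, g', hfit, hp⟩ := hK _ (hbody B hB)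
      have hs : SameSym A B := ⟨(congrArg Prod.fst hp).symm,
        (congrArg (fun p : AFact T ℕ => p.2.1) hp).symm⟩
      refine ⟨ξ, hξ, A, hA, hs, g, hg, g', hfit, hp, fun j hj hx => ?_⟩
      rw [← hfit j hj hx, ← entry_mapFact g' A.2 hj, ← entry_mapFact h B.2 (by rwa [← hs.2])]
      rw [show mapFact h B.2 = mapFact g' A.2 from congrArg Prod.snd hp]
    have hs : Soft M I e h := fun B hB => by
      obtain ⟨ξ, hξ, A, hA, hs, g, hg, _, _, _, hfit⟩ := hmatch B hB
      exact ⟨ξ, hξ, A, hA, hs, g, hg, hfit⟩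
    have key : ∀ l r, (l = e.lhs ∧ r = e.rhs ∨ l = e.rhs ∧ r = e.lhs) → l ≠ r →
        M.OccursAffected e l → h l = h r := by
      rintro l r hlr hne ⟨B, hB, j, hj, haffj⟩
      obtain ⟨ξ, hξ, A, hA, hsym, g, hg, g', hfit, hp, hfitB⟩ := hmatch B hB
      have hjA : j.1 < T.arity A.2.1 := by rw [hsym.2]; exact j.2
      have hz : entry A.2 j ∈ ξ.exVars := by
        rw [entry_of_lt A.2 hjA, ← mem_aff_iff hd hξ hA]
        obtain ⟨i, R, u⟩ := A
        obtain ⟨i', R', u'⟩ := B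
        obtain rfl : i = i' := hsym.1
        obtain rfl : R = R' := hsym.2
        exact haffj
      have h5 := hF ξ hξ A hA g hg g' hfit (hp ▸ hbody B hB) (entry A.2 j) (h r)
        ⟨hz, e, he, B, hB, hsym, h, hs, hfitB, l, r, hlr, hne,
          ⟨j, hjA, rfl, by rw [entry_val, hj]⟩, rfl⟩
      rw [← h5, ← entry_mapFact g' A.2 hjA,
        ← show mapFact h B.2 = mapFact g' A.2 from congrArg Prod.snd hp,
        entry_mapFact h B.2 j.2, entry_val, hj]
    by_cases hne : e.lhs = e.rhs
    · rw [hne]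
    by_cases hl : M.OccursAffected e e.lhs
    · exact key _ _ (.inl ⟨rfl, rfl⟩) hne hl
    by_cases hr : M.OccursAffected e e.rhs
    · exact (key _ _ (.inr ⟨rfl, rfl⟩) (Ne.symm hne) hr).symm
    exact hU e he hl hr h hs

end Chase

/-! ### The solutions -/

section Solutions

variable {S T : Schema} {M : Mapping S T}

/-- In a GAV-reducible mapping the existential variables of distinct head atoms can be instantiated
independently. -/
theorem exists_glue (hgav : M.GAVReducible) {ξ : Abd S T} (hξ : ξ ∈ M.abds) (h : ℕ → ℕ)
    (G : Fact T ℕ → ℕ → ℕ) (hG : ∀ A ∈ ξ.head, Fits ξ A.2 h A.2 (G A.2)) :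
    ∃ g, (∀ x ∈ ξ.frontier, g x = h x) ∧ ∀ A ∈ ξ.head, mapFact g A.2 = mapFact (G A.2) A.2 := by
  classical
  have hch : ∀ x, ∃ v, (x ∈ ξ.frontier → v = h x) ∧ (x ∈ ξ.exVars →
      ∀ A ∈ ξ.head, (∃ j, A.2.2 j = x) → v = G A.2 x) := by
    intro x
    by_cases hx : x ∈ ξ.exVars
    · obtain ⟨A, hA, hj⟩ := hx.1
      refine ⟨G A.2 x, fun h' => absurd h'.1 hx.2, fun _ A' hA' hj' => ?_⟩
      rw [hgav ξ hξ x hx A hA A' hA' hj hj']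
    · exact ⟨h x, fun _ => rfl, fun h' => absurd h' hx⟩
  choose g h1 h2 using hch
  refine ⟨g, h1, fun A hA => mapFact_congr fun j => ?_⟩
  by_cases hx : A.2.2 j ∈ ξ.frontier
  · rw [h1 _ hx, fits_self.1 (hG A hA) j hx]
  · rw [mem_frontier_iff hA, not_not] at hx
    exact h2 _ hx A hA ⟨j, rfl⟩

/-- The left-to-right directions of the abds hold in a set of annotated facts that contains, for
each trigger and each set of head atoms with the same underlying fact, a common instance. -/
theorem exists_head_of_trig (hgav : M.GAVReducible) {K : Set (AFact T ℕ)} {ξ : Abd S T}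
    (hξ : ξ ∈ M.abds) {h : ℕ → ℕ}
    (hK : ∀ A ∈ ξ.head, ∃ g', Fits ξ A.2 h A.2 g' ∧
      ∀ A' ∈ ξ.head, A'.2 = A.2 → mapAFact g' A' ∈ K) :
    ∃ g, (∀ x ∈ ξ.frontier, g x = h x) ∧ ∀ A ∈ ξ.head, mapAFact g A ∈ K := by
  have : ∀ a : Fact T ℕ, ∃ g', ∀ A ∈ ξ.head, A.2 = a →
      Fits ξ A.2 h A.2 g' ∧ mapAFact g' A ∈ K := by
    intro a
    by_cases ha : ∃ A ∈ ξ.head, A.2 = a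
    · obtain ⟨A, hA, rfl⟩ := ha
      obtain ⟨g', h1, h2⟩ := hK A hA
      exact ⟨g', fun A' hA' hAA => ⟨by rw [hAA]; exact h1, h2 A' hA' hAA⟩⟩
    · exact ⟨h, fun A hA hAa => absurd ⟨A, hA, hAa⟩ ha⟩
  choose G hG using this
  obtain ⟨g, h1, h2⟩ := exists_glue hgav hξ h G fun A hA => (hG A.2 A hA rfl).1
  refine ⟨g, h1, fun A hA => ?_⟩
  rw [show mapAFact g A = mapAFact (G A.2) A from Prod.ext rfl (h2 A hA)]
  exact (hG A.2 A hA rfl).2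

theorem sameSym_of_mapAFact_eq {A B : AFact T ℕ} {g h : ℕ → ℕ}
    (H : mapAFact g A = mapAFact h B) : SameSym A B :=
  ⟨(Prod.ext_iff.1 H).1, (Sigma.ext_iff.1 (Prod.ext_iff.1 H).2).1⟩

/-- The right-to-left direction of an abd holds in a set of instances of facts of the chase. -/
theorem exists_trig_of_head (hd : M.density = 1) {I : Set (Fact S ℕ)} (hback : BackHold M I)
    {K : Set (AFact T ℕ)}
    (hK : ∀ p ∈ K, ∃ ξ ∈ M.abds, ∃ A ∈ ξ.head, ∃ g, Trig ξ I g ∧ ∃ g', Fits ξ A.2 g A.2 g' ∧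
      p = mapAFact g' A)
    {ξ : Abd S T} (hξ : ξ ∈ M.abds) {h g : ℕ → ℕ} (hg : ∀ x ∈ ξ.frontier, g x = h x)
    (hmem : ∀ A ∈ ξ.head, mapAFact g A ∈ K) :
    ∃ g, (∀ x ∈ ξ.frontier, g x = h x) ∧ ∀ A ∈ ξ.body, mapFact g A ∈ I := by
  obtain ⟨k, hk, hkh⟩ := hback ξ hξ h fun A hA => by
    obtain ⟨ξ', hξ', A', hA', g₁, hg₁, g₂, hfit, hp⟩ := hK _ (hmem A hA)
    obtain ⟨rfl, rfl⟩ := eq_of_sameSym hd hξ hξ' hA hA' (sameSym_of_mapAFact_eq hp)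
    refine ⟨g₁, hg₁, ?_⟩
    have h1 : Fits ξ A.2 g₁ A.2 g := hfit.of_mapFact (congrArg Prod.snd hp).symm
    exact h1.trans (fits_self_of_eqOn fun x hx => (hg x hx).symm)
  exact ⟨k, hkh, hk⟩

/-- The solutions are the instances that consist of candidates and contain a candidate for each
trigger and head atom, provided that the conditions hold that do not involve existential
variables. -/
theorem mem_Sol_iff (hsafe : M.Safe) (hd : M.density = 1) (hgav : M.GAVReducible)
    (haff : M.EquatesNoTwoAffected) {I : Inst S} {J : Inst T} :
    J ∈ Sol M I ↔ BackHold M ↑I ∧ UnaffectedHold M ↑I ∧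
      (∀ f ∈ J, ∃ ξ ∈ M.abds, ∃ A ∈ ξ.head, ∃ g, Trig ξ ↑I g ∧ f ∈ Cand M ↑I ξ A.2 g) ∧
      ∀ ξ ∈ M.abds, ∀ A ∈ ξ.head, ∀ g, Trig ξ ↑I g → ∃ f ∈ J, f ∈ Cand M ↑I ξ A.2 g := by
  classical
  constructor
  · rintro ⟨ℓ, hℓ, hsat, hmin⟩
    set L := labelled J ℓ with hL
    -- a fact of a minimal model belongs to an instance of a head for some trigger
    have hgen : ∀ p ∈ L, ∃ ξ ∈ M.abds, ∃ A ∈ ξ.head, ∃ g, Trig ξ (↑I : Set (Fact S ℕ)) g ∧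
        ∃ g', Fits ξ A.2 g A.2 g' ∧ p = mapAFact g' A ∧ ∀ A' ∈ ξ.head, mapAFact g' A' ∈ L := by
      intro p hp
      obtain ⟨I', hI', K, hKL, hpK, hKsat, hKmin⟩ := hmin p hp
      set K' : Set (AFact T ℕ) := {p ∈ K | ∃ ξ ∈ M.abds, ∃ A ∈ ξ.head, ∃ g, Trig ξ I' g ∧
        ∃ g', Fits ξ A.2 g A.2 g' ∧ p = mapAFact g' A ∧ ∀ A' ∈ ξ.head, mapAFact g' A' ∈ K}
        with hK'
      have hsub : K' ⊆ K := fun p hp => hp.1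
      have hK'sat : M.Sat I' K' := by
        refine ⟨fun ξ hξ h => ⟨?_, ?_⟩, fun e he h hb => hKsat.2 e he h fun B hB => hsub (hb B hB)⟩
        · rintro ⟨g, hgh, hg⟩
          obtain ⟨g', hg'h, hg'⟩ := (hKsat.1 ξ hξ h).1 ⟨g, hgh, hg⟩
          refine ⟨g', hg'h, fun A hA => ⟨hg' A hA, ξ, hξ, A, hA, g, hg, g', ?_, rfl, hg'⟩⟩
          exact fits_self_of_eqOn fun x hx => (hg'h x hx).trans (hgh x hx).symm
        · rintro ⟨g', hg'h, hg'⟩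
          exact (hKsat.1 ξ hξ h).2 ⟨g', hg'h, fun A hA => hsub (hg' A hA)⟩
      have hKK' : K' = K := by
        by_contra hne
        exact hKmin K' (hsub.ssubset_of_ne hne) hK'sat
      rw [← hKK'] at hpK
      obtain ⟨-, ξ, hξ, A, hA, g, hg, g', hfit, hpA, hall⟩ := hpK
      exact ⟨ξ, hξ, A, hA, g, fun B hB => hI' (hg B hB), g', hfit, hpA,
        fun A' hA' => hKL (hall A' hA')⟩
    have hfor : ∀ ξ ∈ M.abds, ∀ g, Trig ξ (↑I : Set (Fact S ℕ)) g → ∃ g',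
        (∀ x ∈ ξ.frontier, g' x = g x) ∧ ∀ A ∈ ξ.head, mapAFact g' A ∈ L := fun ξ hξ g hg =>
      (hsat.1 ξ hξ g).1 ⟨g, fun _ _ => rfl, hg⟩
    obtain ⟨hU, hF⟩ := (aegds_sat_iff hsafe hd haff (fun p hp => by
        obtain ⟨ξ, hξ, A, hA, g, hg, g', hfit, hpA, -⟩ := hgen p hp
        exact ⟨ξ, hξ, A, hA, g, hg, g', hfit, hpA⟩) (fun ξ hξ A hA g hg => by
        obtain ⟨g', h1, h2⟩ := hfor ξ hξ g hg
        exact ⟨g', fits_self_of_eqOn h1, h2 A hA⟩)).1 hsat.2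
    have hcand : ∀ ξ ∈ M.abds, ∀ A ∈ ξ.head, ∀ g, Trig ξ (↑I : Set (Fact S ℕ)) g → ∀ g',
        Fits ξ A.2 g A.2 g' → (∀ A' ∈ ξ.head, mapAFact g' A' ∈ L) →
        mapFact g' A.2 ∈ Cand M ↑I ξ A.2 g := by
      intro ξ hξ A hA g hg g' hfit hall
      refine ⟨g', rfl, hfit, fun A' hA' hAA z c hz =>
        hF ξ hξ A' hA' g hg g' ?_ (hall A' hA') z c hz⟩
      rw [hAA]
      exact hfit
    refine ⟨fun ξ hξ h hA => ?_, hU, fun f hf => ?_, fun ξ hξ A hA g hg => ?_⟩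
    · obtain ⟨g, h1, h2⟩ := exists_head_of_trig hgav (K := L) hξ (h := h) fun A hmem => by
        obtain ⟨g, hg, hfit⟩ := hA A hmem
        obtain ⟨g', h1, h2⟩ := hfor ξ hξ g hg
        exact ⟨g', hfit.symm.trans (fits_self_of_eqOn h1), fun A' hA' _ => h2 A' hA'⟩
      obtain ⟨k, hk1, hk2⟩ := (hsat.1 ξ hξ h).2 ⟨g, h1, h2⟩
      exact ⟨k, hk2, hk1⟩
    · obtain ⟨i, hi⟩ := hℓ f hf
      obtain ⟨ξ, hξ, A, hA, g, hg, g', hfit, hpA, hall⟩ := hgen (i, f) ⟨hf, hi⟩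
      refine ⟨ξ, hξ, A, hA, g, hg, ?_⟩
      rw [show f = mapFact g' A.2 from congrArg Prod.snd hpA]
      exact hcand ξ hξ A hA g hg g' hfit hall
    · obtain ⟨g', h1, h2⟩ := hfor ξ hξ g hg
      exact ⟨_, (h2 A hA).1, hcand ξ hξ A hA g hg g' (fits_self_of_eqOn h1) h2⟩
  · rintro ⟨hback, hU, hcov, hhit⟩
    -- a fact is labeled with all annotations of head atoms for which it is a candidate
    set ℓ : Fact T ℕ → Set ℤ := fun f => {i | ∃ ξ ∈ M.abds, ∃ A ∈ ξ.head,
      ∃ g, Trig ξ (↑I : Set (Fact S ℕ)) g ∧ f ∈ Cand M ↑I ξ A.2 g ∧ A.1 = i} with hℓ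
    have hin : ∀ ξ ∈ M.abds, ∀ A ∈ ξ.head, ∀ g, Trig ξ (↑I : Set (Fact S ℕ)) g →
        ∀ f ∈ J, f ∈ Cand M ↑I ξ A.2 g → (A.1, f) ∈ labelled J ℓ :=
      fun ξ hξ A hA g hg f hf hc => ⟨hf, ξ, hξ, A, hA, g, hg, hc, rfl⟩
    have hgen : ∀ p ∈ labelled J ℓ, ∃ ξ ∈ M.abds, ∃ A ∈ ξ.head, ∃ g,
        Trig ξ (↑I : Set (Fact S ℕ)) g ∧ ∃ g', Fits ξ A.2 g A.2 g' ∧ p = mapAFact g' A := by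
      rintro ⟨i, f⟩ ⟨hf, ξ, hξ, A, hA, g, hg, ⟨g', h1, h2, -⟩, hi⟩
      exact ⟨ξ, hξ, A, hA, g, hg, g', h2, Prod.ext hi.symm h1⟩
    have haegd : ∀ e ∈ M.aegds, e.Sat (labelled J ℓ) := by
      refine (aegds_sat_iff hsafe hd haff hgen fun ξ hξ A hA g hg => ?_).2 ⟨hU, ?_⟩
      · obtain ⟨f, hf, hc⟩ := hhit ξ hξ A hA g hg
        obtain ⟨g', h1, h2, -⟩ := id hc
        subst h1
        exact ⟨g', h2, hin ξ hξ A hA g hg _ hf hc⟩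
      · rintro ξ hξ A hA g hg g' hfit ⟨-, ξ', hξ', A', hA', g₁, hg₁, ⟨g₂, h1, h2, h3⟩, hi⟩ z c hz
        obtain ⟨rfl, rfl⟩ := eq_of_sameSym hd hξ hξ' hA hA'
          (sameSym_of_mapAFact_eq (g := g') (h := g₂) (Prod.ext hi.symm h1))
        have h4 := h3 A hA rfl z c (hz.congr (hfit.trans (h2.of_mapFact h1.symm).symm))
        -- `z` occurs in `A`, where `g'` and `g₂` agree
        obtain ⟨-, -, -, -, -, -, -, -, -, -, -, -, -, ⟨j, hj, hjz, -⟩, -⟩ := hz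
        rw [entry_of_lt A.2 hj] at hjz
        have h5 := mapFact_inj h1 ⟨j, hj⟩
        rwa [hjz, h4] at h5
    have hsat : ∀ K ⊆ labelled J ℓ, (∀ ξ ∈ M.abds, ∀ g, Trig ξ (↑I : Set (Fact S ℕ)) g → ∃ g',
        (∀ x ∈ ξ.frontier, g' x = g x) ∧ ∀ A ∈ ξ.head, mapAFact g' A ∈ K) → M.Sat ↑I K := by
      intro K hK hfor
      refine ⟨fun ξ hξ h => ⟨?_, ?_⟩, fun e he h hb => haegd e he h fun B hB => hK (hb B hB)⟩
      · rintro ⟨g, hgh, hg⟩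
        obtain ⟨g', h1, h2⟩ := hfor ξ hξ g hg
        exact ⟨g', fun x hx => (h1 x hx).trans (hgh x hx), h2⟩
      · rintro ⟨g, hgh, hg⟩
        exact exists_trig_of_head hd hback (fun p hp => hgen p (hK hp)) hξ hgh hg
    -- one candidate for each trigger and head atom, with a given one among them
    have hchoice : ∀ ch : Set (Fact T ℕ) → Fact T ℕ, (∀ ξ ∈ M.abds, ∀ A ∈ ξ.head, ∀ g,
        Trig ξ (↑I : Set (Fact S ℕ)) g → ch (Cand M ↑I ξ A.2 g) ∈ J ∧
          ch (Cand M ↑I ξ A.2 g) ∈ Cand M ↑I ξ A.2 g) → ∃ K ⊆ labelled J ℓ, M.Sat ↑I K ∧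
        (∀ K' ⊂ K, ¬ M.Sat ↑I K') ∧ ∀ ξ ∈ M.abds, ∀ A ∈ ξ.head, ∀ g,
          Trig ξ (↑I : Set (Fact S ℕ)) g → (A.1, ch (Cand M ↑I ξ A.2 g)) ∈ K := by
      intro ch hch
      set K : Set (AFact T ℕ) := {p | ∃ ξ ∈ M.abds, ∃ A ∈ ξ.head, ∃ g,
        Trig ξ (↑I : Set (Fact S ℕ)) g ∧ p = (A.1, ch (Cand M ↑I ξ A.2 g))} with hK
      have hKL : K ⊆ labelled J ℓ := by
        rintro p ⟨ξ, hξ, A, hA, g, hg, rfl⟩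
        obtain ⟨h1, h2⟩ := hch ξ hξ A hA g hg
        exact hin ξ hξ A hA g hg _ h1 h2
      refine ⟨K, hKL, hsat K hKL fun ξ hξ g hg => ?_, fun K' hK' hK's => ?_,
        fun ξ hξ A hA g hg => ⟨ξ, hξ, A, hA, g, hg, rfl⟩⟩
      · refine exists_head_of_trig hgav hξ fun A hA => ?_
        obtain ⟨-, g', h1, h2, -⟩ := hch ξ hξ A hA g hg
        refine ⟨g', h2, fun A' hA' hAA => ⟨ξ, hξ, A', hA', g, hg, Prod.ext rfl ?_⟩⟩
        change mapFact g' A'.2 = _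
        rw [hAA]
        exact h1.symm
      · refine hK'.2 ?_
        rintro p ⟨ξ, hξ, A, hA, g, hg, rfl⟩
        obtain ⟨g', h1, h2⟩ := (hK's.1 ξ hξ g).1 ⟨g, fun _ _ => rfl, hg⟩
        obtain ⟨ξ', hξ', A', hA', g₁, hg₁, hp⟩ := hK'.1 (h2 A hA)
        obtain ⟨-, g₂, h3, h4, -⟩ := hch ξ' hξ' A' hA' g₁ hg₁
        have hp2 : mapFact g' A.2 = ch (Cand M ↑I ξ' A'.2 g₁) := congrArg Prod.snd hp
        obtain ⟨rfl, rfl⟩ := eq_of_sameSym hd hξ hξ' hA hA'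
          (sameSym_of_mapAFact_eq (g := g') (h := g₂)
            (Prod.ext (Prod.ext_iff.1 hp).1 (hp2.trans h3)))
        have h5 : Fits ξ A.2 g A.2 g₁ :=
          (fits_self_of_eqOn h1).trans (h4.of_mapFact (hp2.trans h3).symm).symm
        have h6 := h2 A hA
        rw [hp] at h6
        rwa [Cand_congr h5]
    have hall : Nonempty (Fact T ℕ) →
        ∃ ch : Set (Fact T ℕ) → Fact T ℕ, ∀ ξ ∈ M.abds, ∀ A ∈ ξ.head, ∀ g,
        Trig ξ (↑I : Set (Fact S ℕ)) g → ch (Cand M ↑I ξ A.2 g) ∈ J ∧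
          ch (Cand M ↑I ξ A.2 g) ∈ Cand M ↑I ξ A.2 g := by
      intro hne
      have : ∀ C : Set (Fact T ℕ), ∃ f : Fact T ℕ, C ∈ {C | ∃ ξ ∈ M.abds, ∃ A ∈ ξ.head, ∃ g,
          Trig ξ (↑I : Set (Fact S ℕ)) g ∧ C = Cand M ↑I ξ A.2 g} → f ∈ J ∧ f ∈ C := by
        intro C
        by_cases hC : C ∈ {C | ∃ ξ ∈ M.abds, ∃ A ∈ ξ.head, ∃ g,
          Trig ξ (↑I : Set (Fact S ℕ)) g ∧ C = Cand M ↑I ξ A.2 g}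
        · obtain ⟨ξ, hξ, A, hA, g, hg, rfl⟩ := id hC
          obtain ⟨f, h1, h2⟩ := hhit ξ hξ A hA g hg
          exact ⟨f, fun _ => ⟨h1, h2⟩⟩
        · exact ⟨hne.some, fun h => absurd h hC⟩
      choose ch hch using this
      exact ⟨ch, fun ξ hξ A hA g hg => hch _ ⟨ξ, hξ, A, hA, g, hg, rfl⟩⟩
    refine ⟨ℓ, fun f hf => ?_, ?_, fun p hp => ?_⟩
    · obtain ⟨ξ, hξ, A, hA, g, hg, hc⟩ := hcov f hf
      exact ⟨A.1, ξ, hξ, A, hA, g, hg, hc, rfl⟩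
    · refine hsat _ subset_rfl fun ξ hξ g hg => ?_
      by_cases hne : Nonempty (Fact T ℕ)
      swap
      · exact ⟨g, fun _ _ => rfl, fun A _ => absurd ⟨A.2⟩ hne⟩
      obtain ⟨ch, hch⟩ := hall hne
      obtain ⟨K, hKL, hKs, -, -⟩ := hchoice ch hch
      obtain ⟨g', h1, h2⟩ := (hKs.1 ξ hξ g).1 ⟨g, fun _ _ => rfl, hg⟩
      exact ⟨g', h1, fun A hA => hKL (h2 A hA)⟩
    · obtain ⟨i, f⟩ := p
      obtain ⟨hf, ξ, hξ, A, hA, g, hg, hc, rfl⟩ := hp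
      obtain ⟨ch, hch⟩ := hall ⟨f⟩
      obtain ⟨K, hKL, hKs, hmin, hmem⟩ := hchoice
        (Function.update ch (Cand M ↑I ξ A.2 g) f) fun ξ' hξ' A' hA' g' hg' => by
          by_cases heq : Cand M ↑I ξ' A'.2 g' = Cand M ↑I ξ A.2 g
          · rw [heq, Function.update_self]
            exact ⟨hf, hc⟩
          · rw [Function.update_of_ne heq]
            exact hch ξ' hξ' A' hA' g' hg'
      refine ⟨↑I, subset_rfl, K, hKL, ?_, hKs, fun K' hK' => hmin K' hK'⟩
      have := hmem ξ hξ A hA g hg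
      rwa [Function.update_self] at this

end Solutions

/-! ### Presentations of facts and tables -/

theorem foldr_bit_bits (n : ℕ) : n.bits.foldr Nat.bit 0 = n := by
  induction n using Nat.binaryRec' with
  | zero => simp
  | bit b n h ih => rw [Nat.bits_append_bit _ _ h, List.foldr_cons, ih]

theorem encNat_injective : Function.Injective encNat := fun m n h => by
  have := encList_injective encBool_injective h
  rw [← foldr_bit_bits m, ← foldr_bit_bits n, this]

instance : Enc ℕ := ⟨encNat, encNat_injective⟩

section Presentations

variable {S T : Schema} {V γ : Type} [Enc V] [Enc γ]

theorem encFact_injective : Function.Injective (encFact (S := S) (enc : V → Data)) := by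
  rintro ⟨R, u⟩ ⟨R', u'⟩ h
  simp only [encFact, Data.cons.injEq] at h
  obtain rfl : R = R' := Fin.ext (encNat_injective h.1)
  rw [List.ofFn_injective (encList_injective enc_inj h.2)]

instance : Enc (Fact S V) := ⟨encFact enc, encFact_injective⟩

theorem encVal_injective : Function.Injective encVal := by
  intro a b h
  cases a <;> cases b <;> simp only [encVal, Data.cons.injEq] at h <;>
    first
    | exact absurd (encNat_injective h.1) (by decide)
    | rw [encNat_injective h.2]

instance : Enc Val := ⟨encVal, encVal_injective⟩

theorem encTable_eq (τ : CondTable T) : encTable τ = .cons (enc τ.facts) (enc τ.cond) := rfl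

instance : Enc (CondTable T) := ⟨encTable, fun τ τ' h => by
  rw [encTable_eq, encTable_eq, Data.cons.injEq] at h
  obtain ⟨f, c, _⟩ := τ
  obtain ⟨f', c', _⟩ := τ'
  obtain rfl := enc_inj h.1
  obtain rfl := enc_inj h.2
  rfl⟩

instance {k : ℕ} : Enc (Fin k → ℕ) :=
  ⟨encTuple, fun _ _ h => List.ofFn_injective (encList_injective encNat_injective h)⟩

instance : Enc (Option V) := ⟨encOption enc, fun a b h => by
  cases a <;> cases b <;> simp only [encOption, Data.cons.injEq, reduceCtorEq, and_true] at h
  · rfl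
  · rw [enc_inj h]⟩

theorem PT.some {f : γ → V} (hf : PT f) : PT (fun c => Option.some (f c)) :=
  (hf.pair (PT.const (Data.nil))).recode fun c => ⟨c, rfl, rfl⟩

theorem PT.tupleToList {k : ℕ} : PT (fun t : Fin k → ℕ => List.ofFn t) :=
  PT.id.recode fun t => ⟨List.ofFn t, rfl, rfl⟩

theorem PT.tupleApply {k : ℕ} (i : Fin k) : PT (fun t : Fin k → ℕ => t i) :=
  (PT.getD 0 PT.tupleToList i.1).congr fun t => by simp

theorem PT.symbol : PT (fun f : Fact S V => f.1.1) :=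
  PT.dataHd.recode fun f => ⟨enc f, rfl, rfl⟩

theorem PT.entries : PT (fun f : Fact S V => List.ofFn f.2) :=
  PT.dataTl.recode fun f => ⟨enc f, rfl, rfl⟩

theorem PT.entry [Inhabited V] (j : ℕ) : PT (fun f : Fact S V => entry f j) :=
  PT.getD default PT.entries j

/-- The fact that is obtained from a fixed one by replacing its entries by computed values. -/
theorem PT.mapFact {X : Type} (A : Fact S X) {u : X → γ → V} (hu : ∀ j, PT (u (A.2 j))) :
    PT (fun c => mapFact (fun x => u x c) A) := by
  have h : PT (fun c => (A.1.1, (List.ofFn A.2).map (fun x => u x c))) :=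
    (PT.const A.1.1).pair (PT.mapFixed _ fun x hx => by
      obtain ⟨j, rfl⟩ := (List.mem_ofFn' _ _).1 hx
      exact hu j)
  refine h.recode fun c => ⟨c, rfl, ?_⟩
  rw [List.map_ofFn]
  rfl

theorem PT.tableFacts : PT (fun τ : CondTable T => τ.facts) :=
  PT.dataHd.recode fun τ => ⟨enc τ, rfl, rfl⟩

theorem PT.tableCond : PT (fun τ : CondTable T => τ.cond) :=
  PT.dataTl.recode fun τ => ⟨enc τ, rfl, rfl⟩

/-- A table without a condition. -/
def plainTable (L : List (Fact T Val)) : CondTable T := ⟨L, [], by simp⟩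

theorem PT.plainTable {L : γ → List (Fact T Val)} (hL : PT L) :
    PT (fun c => plainTable (L c)) :=
  (hL.pair (PT.const ([] : List (List (Val × Val))))).recode fun c => ⟨c, rfl, rfl⟩

/-! ### Numbers and their bits -/

theorem PT.bits : PT Nat.bits := PT.id.recode fun n => ⟨n.bits, rfl, rfl⟩

/-- The number with the given bits, followed by a leading bit one. -/
def natOfBits (l : List Bool) : ℕ := l.foldr Nat.bit 1

theorem natOfBits_ne_zero (l : List Bool) : natOfBits l ≠ 0 := by
  induction l with
  | nil => decide
  | cons b l ih =>
    change Nat.bit b (natOfBits l) ≠ 0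
    rw [Ne, Nat.bit_eq_zero_iff]
    tauto

theorem bits_natOfBits (l : List Bool) : (natOfBits l).bits = l ++ [true] := by
  induction l with
  | nil => exact Nat.one_bits
  | cons b l ih =>
    change (Nat.bit b (natOfBits l)).bits = _
    rw [Nat.bits_append_bit _ _ fun h => absurd h (natOfBits_ne_zero l), ih]
    rfl

theorem natOfBits_injective : Function.Injective natOfBits := fun l l' h => by
  have := congrArg Nat.bits h
  rw [bits_natOfBits, bits_natOfBits] at this
  exact List.append_cancel_right this

theorem PT.natOfBits {l : γ → List Bool} (hl : PT l) : PT (fun c => natOfBits (l c)) :=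
  (hl.append (PT.const [true])).recode fun c => ⟨c, rfl, by
    change encList encBool (ABD.natOfBits (l c)).bits = _
    rw [bits_natOfBits]
    rfl⟩

/-- A self-delimiting code of a number: each bit is preceded by `true`, and `false` marks the
end. -/
def delimit (n : ℕ) : List Bool := n.bits.flatMap (fun b => [true, b]) ++ [false]

theorem delimit_append_inj {m n : ℕ} {r s : List Bool} (h : delimit m ++ r = delimit n ++ s) :
    m = n ∧ r = s := by
  have key : ∀ l l' : List Bool, l.flatMap (fun b => [true, b]) ++ (false :: r) =
      l'.flatMap (fun b => [true, b]) ++ (false :: s) → l = l' ∧ r = s := by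
    intro l
    induction l with
    | nil =>
      intro l' h
      cases l' <;> simp_all
    | cons b l ih =>
      intro l' h
      cases l' with
      | nil => simp at h
      | cons b' l' =>
        simp only [List.flatMap_cons, List.cons_append, List.nil_append, List.cons.injEq,
          true_and] at h
        obtain ⟨h1, h2⟩ := ih l' h.2
        exact ⟨by rw [h.1, h1], h2⟩
  obtain ⟨h1, h2⟩ := key m.bits n.bits (by simpa [delimit] using h)
  exact ⟨encNat_injective (by rw [encNat, encNat, h1]), h2⟩

/-- An injective code of lists of numbers by numbers. -/
def codeList (l : List ℕ) : ℕ := natOfBits (l.flatMap delimit)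

theorem codeList_injective : Function.Injective codeList := by
  intro l l' h
  replace h : l.flatMap delimit = l'.flatMap delimit := natOfBits_injective h
  induction l generalizing l' with
  | nil =>
    cases l' with
    | nil => rfl
    | cons n l' => simp [delimit] at h
  | cons m l ih =>
    cases l' with
    | nil => simp [delimit] at h
    | cons n l' =>
      obtain ⟨rfl, h2⟩ := delimit_append_inj (by simpa using h)
      rw [ih h2]

theorem PT.codeList {l : γ → List ℕ} (hl : PT l) : PT (fun c => codeList (l c)) :=
  PT.natOfBits (PT.flatMap (f := fun _ n => delimit n) hl
    ((PT.flatMap (f := fun _ b => [true, b]) (PT.bits.comp PT.snd)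
      ((PT.const true).cons (PT.snd.cons (PT.const [])))).append (PT.const [false])))

/-! ### Assignments of a fixed number of variables -/

/-- The lists of length `n` with entries from a given list. -/
def tuples : ℕ → List ℕ → List (List ℕ)
  | 0, _ => [[]]
  | n + 1, D => D.flatMap fun a => (tuples n D).map fun l => a :: l

theorem mem_tuples {n : ℕ} {D l : List ℕ} :
    l ∈ tuples n D ↔ l.length = n ∧ ∀ x ∈ l, x ∈ D := by
  induction n generalizing l with
  | zero => simp [tuples]; aesop
  | succ n ih =>
    simp only [tuples, List.mem_flatMap, List.mem_map, ih]
    constructor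
    · rintro ⟨a, ha, l, ⟨h1, h2⟩, rfl⟩
      simp [h1, ha]
      exact h2
    · rintro ⟨h1, h2⟩
      cases l with
      | nil => simp at h1
      | cons a l => exact ⟨a, h2 a (by simp), l, ⟨by simpa using h1,
          fun x hx => h2 x (by simp [hx])⟩, rfl⟩

theorem PT.tuples {D : γ → List ℕ} (n : ℕ) (hD : PT D) : PT (fun c => tuples n (D c)) := by
  induction n with
  | zero => exact PT.const _
  | succ n ih =>
    exact PT.flatMap (f := fun c a => (ABD.tuples n (D c)).map fun l => a :: l) hD
      (PT.map (f := fun (x : γ × ℕ) (l : List ℕ) => x.2 :: l) (ih.comp PT.fst)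
        ((PT.snd.comp PT.fst).cons PT.snd))

/-- The assignment given by the list of the values of the first variables. -/
def look (env : List ℕ) (x : ℕ) : ℕ := env.getD x 0

theorem PT.look (x : ℕ) {e : γ → List ℕ} (he : PT e) : PT (fun c => look (e c) x) :=
  PT.getD 0 he x

/-- The constants of an instance. The value `0` is added so that there is always an assignment. -/
def domList (I : List (Fact S ℕ)) : List ℕ := 0 :: I.flatMap fun f => List.ofFn f.2

theorem PT.domList {I : γ → List (Fact S ℕ)} (hI : PT I) : PT (fun c => domList (I c)) :=
  (PT.const 0).cons (PT.flatMap (f := fun _ f => List.ofFn f.2) hI (PT.entries.comp PT.snd))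

theorem mem_domList {I : List (Fact S ℕ)} {f : Fact S ℕ} (hf : f ∈ I) (j : Fin (S.arity f.1)) :
    f.2 j ∈ domList I :=
  List.mem_cons_of_mem _ (List.mem_flatMap.2 ⟨f, hf, by simp⟩)

/-- The assignments of the first `N` variables by constants of an instance. -/
def envs (N : ℕ) (I : List (Fact S ℕ)) : List (List ℕ) := tuples N (domList I)

theorem PT.envs (N : ℕ) {I : γ → List (Fact S ℕ)} (hI : PT I) : PT (fun c => envs N (I c)) :=
  PT.tuples N (PT.domList hI)

open Classical in
/-- The restriction of an assignment to the first `N` variables and the constants of an instance. -/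
noncomputable def restrictEnv (N : ℕ) (I : List (Fact S ℕ)) (h : ℕ → ℕ) : List ℕ :=
  (List.range N).map fun x => if h x ∈ domList I then h x else 0

theorem restrictEnv_mem (N : ℕ) (I : List (Fact S ℕ)) (h : ℕ → ℕ) :
    restrictEnv N I h ∈ envs N I := by
  rw [envs, mem_tuples]
  refine ⟨by simp [restrictEnv], fun x hx => ?_⟩
  obtain ⟨y, -, rfl⟩ := List.mem_map.1 hx
  split_ifs with h
  · exact h
  · exact List.mem_cons_self

theorem look_restrictEnv {N : ℕ} {I : List (Fact S ℕ)} {h : ℕ → ℕ} {x : ℕ} (hx : x < N)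
    (hd : h x ∈ domList I) : look (restrictEnv N I h) x = h x := by
  simp [look, restrictEnv, hx, hd]

end Presentations

/-! ### Restriction of the chase conditions to the constants of the source instance -/

section Relativize

variable {S T : Schema} {γ : Type} [Enc γ]

/-- The set of the facts in a list. -/
def factSet (I : List (Fact S ℕ)) : Set (Fact S ℕ) := {f | f ∈ I}

/-- All variables of the mapping are less than `N`. -/
def VarBound (M : Mapping S T) (N : ℕ) : Prop :=
  (∀ ξ ∈ M.abds, ∀ x ∈ varsOf ξ.body ∪ avarsOf ξ.head, x < N) ∧
    ∀ e ∈ M.aegds, ∀ x ∈ avarsOf e.body, x < N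

theorem finite_varsOf (l : List (Fact S ℕ)) : (varsOf l).Finite := by
  have : varsOf l = ⋃ A ∈ {A | A ∈ l}, Set.range A.2 := by
    ext x; simp [varsOf]
  rw [this]
  exact l.finite_toSet.biUnion fun A _ => Set.finite_range _

theorem finite_avarsOf (l : List (AFact T ℕ)) : (avarsOf l).Finite := by
  have : avarsOf l = ⋃ A ∈ {A | A ∈ l}, Set.range A.2.2 := by
    ext x; simp [avarsOf]
  rw [this]
  exact l.finite_toSet.biUnion fun A _ => Set.finite_range _

theorem exists_varBound (M : Mapping S T) : ∃ N, VarBound M N := by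
  have h : ((⋃ ξ ∈ (M.abds : Set (Abd S T)), (varsOf ξ.body ∪ avarsOf ξ.head)) ∪
      ⋃ e ∈ (M.aegds : Set (Aegd T)), avarsOf e.body).Finite :=
    (M.abds.finite_toSet.biUnion fun ξ _ => (finite_varsOf _).union (finite_avarsOf _)).union
      (M.aegds.finite_toSet.biUnion fun e _ => finite_avarsOf _)
  obtain ⟨N, hN⟩ := h.bddAbove
  refine ⟨N + 1, fun ξ hξ x hx => Nat.lt_succ_of_le (hN (.inl ?_)),
    fun e he x hx => Nat.lt_succ_of_le (hN (.inr ?_))⟩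
  · exact Set.mem_biUnion (Finset.mem_coe.2 hξ) hx
  · exact Set.mem_biUnion (Finset.mem_coe.2 he) hx

variable {M : Mapping S T} {N : ℕ} {I : List (Fact S ℕ)}

theorem Trig.mem_domList {ξ : Abd S T} {g : ℕ → ℕ} (hg : Trig ξ (factSet I) g) {x : ℕ}
    (hx : x ∈ varsOf ξ.body) : g x ∈ domList I := by
  obtain ⟨A, hA, j, rfl⟩ := hx
  exact ABD.mem_domList (hg A hA) j

theorem Trig.congr {ξ : Abd S T} {I : Set (Fact S ℕ)} {g g' : ℕ → ℕ} (hg : Trig ξ I g)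
    (h : ∀ x ∈ varsOf ξ.body, g' x = g x) : Trig ξ I g' := fun A hA => by
  rw [mapFact_congr fun j => h _ ⟨A, hA, j, rfl⟩]
  exact hg A hA

theorem Fits.congr_frontier {ξ : Abd S T} {a b : Fact T ℕ} {g g' h : ℕ → ℕ} (H : Fits ξ a g b h)
    (h' : ∀ x ∈ ξ.frontier, g' x = g x) : Fits ξ a g' b h :=
  fun j hj hx => (H j hj hx).trans (h' _ hx).symm

theorem Trig.look_restrictEnv (hN : VarBound M N) {ξ : Abd S T} (hξ : ξ ∈ M.abds) {g : ℕ → ℕ}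
    (hg : Trig ξ (factSet I) g) {x : ℕ} (hx : x ∈ varsOf ξ.body) :
    look (restrictEnv N I g) x = g x :=
  ABD.look_restrictEnv (hN.1 ξ hξ x (.inl hx)) (hg.mem_domList hx)

theorem exists_trig_iff (hN : VarBound M N) {ξ : Abd S T} (hξ : ξ ∈ M.abds)
    {P : (ℕ → ℕ) → Prop} (hP : ∀ g g', (∀ x ∈ varsOf ξ.body, g' x = g x) → P g → P g') :
    (∃ g, Trig ξ (factSet I) g ∧ P g) ↔
      ∃ env ∈ envs N I, Trig ξ (factSet I) (look env) ∧ P (look env) := by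
  constructor
  · rintro ⟨g, hg, hPg⟩
    have : ∀ x ∈ varsOf ξ.body, look (restrictEnv N I g) x = g x :=
      fun x hx => hg.look_restrictEnv hN hξ hx
    exact ⟨_, restrictEnv_mem N I g, hg.congr this, hP _ _ this hPg⟩
  · rintro ⟨env, -, h1, h2⟩
    exact ⟨_, h1, h2⟩

theorem Fits.restrict {ξ : Abd S T} {a b : Fact T ℕ} {g h : ℕ → ℕ} (hab : a.1 = b.1)
    (hg : Trig ξ (factSet I) g) (hb : ∀ j, b.2 j < N) (H : Fits ξ a g b h) :
    Fits ξ a g b (look (restrictEnv N I h)) := by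
  intro j hj hx
  have h1 := H j hj hx
  rw [← h1]
  refine ABD.look_restrictEnv ?_ ?_
  · rw [entry_of_lt b (by rwa [← hab])]
    exact hb _
  · rw [h1]
    exact hg.mem_domList hx.1

theorem Soft.restrict (hN : VarBound M N) {e : Aegd T} (he : e ∈ M.aegds) {h : ℕ → ℕ}
    (hs : Soft M (factSet I) e h) : Soft M (factSet I) e (look (restrictEnv N I h)) := by
  intro B hB
  obtain ⟨ξ, hξ, A, hA, hsym, g, hg, hfit⟩ := hs B hB
  exact ⟨ξ, hξ, A, hA, hsym, g, hg,
    hfit.restrict hsym.2 hg fun j => hN.2 e he _ (mem_avarsOf hB j)⟩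

theorem Soft.mem_domList {e : Aegd T} {h : ℕ → ℕ} (hs : Soft M (factSet I) e h) {x : ℕ}
    (hx : x ∈ avarsOf e.body) (hx' : ¬ M.OccursAffected e x) : h x ∈ domList I := by
  obtain ⟨B, hB, j, hj⟩ := hx
  obtain ⟨ξ, hξ, A, hA, hsym, g, hg, hfit⟩ := hs B hB
  have hjA : j.1 < T.arity A.2.1 := by rw [hsym.2]; exact j.2
  have hfr : entry A.2 j.1 ∈ ξ.frontier := by
    rw [entry_of_lt A.2 hjA, mem_frontier_iff hA]
    intro hex
    refine hx' ⟨B, hB, j, hj, ξ, hξ, A, hA, ⟨j.1, hjA⟩, hex, ?_⟩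
    obtain ⟨i, R, u⟩ := A
    obtain ⟨i', R', u'⟩ := B
    obtain rfl : i = i' := hsym.1
    obtain rfl : R = R' := hsym.2
    rfl
  have := hfit j.1 hjA hfr
  rw [entry_val, hj] at this
  rw [this]
  exact hg.mem_domList hfr.1

theorem Soft.look_restrictEnv (hN : VarBound M N) {e : Aegd T} (he : e ∈ M.aegds) {h : ℕ → ℕ}
    (hs : Soft M (factSet I) e h) {x : ℕ} (hx : x ∈ avarsOf e.body)
    (hx' : ¬ M.OccursAffected e x) : look (restrictEnv N I h) x = h x :=
  ABD.look_restrictEnv (hN.2 e he x hx) (hs.mem_domList hx hx')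

theorem unaffectedHold_iff (hN : VarBound M N) : UnaffectedHold M (factSet I) ↔
    ∀ e ∈ M.aegds, ¬ M.OccursAffected e e.lhs → ¬ M.OccursAffected e e.rhs →
      ∀ env ∈ envs N I, Soft M (factSet I) e (look env) → look env e.lhs = look env e.rhs := by
  constructor
  · exact fun H e he hl hr env _ hs => H e he hl hr _ hs
  · intro H e he hl hr h hs
    have := H e he hl hr _ (restrictEnv_mem N I h) (hs.restrict hN he)
    rwa [hs.look_restrictEnv hN he e.lhs_mem hl, hs.look_restrictEnv hN he e.rhs_mem hr] at this

theorem backHold_iff (hN : VarBound M N) : BackHold M (factSet I) ↔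
    ∀ ξ ∈ M.abds, ∀ env ∈ envs N I,
      (∀ A ∈ ξ.head, ∃ g, Trig ξ (factSet I) g ∧ Fits ξ A.2 g A.2 (look env)) →
      ∃ g, Trig ξ (factSet I) g ∧ ∀ x ∈ ξ.frontier, g x = look env x := by
  constructor
  · exact fun H ξ hξ env _ h => H ξ hξ _ h
  · intro H ξ hξ h hA
    obtain ⟨g, hg, hgx⟩ := H ξ hξ _ (restrictEnv_mem N I h) fun A hmem => by
      obtain ⟨g, hg, hfit⟩ := hA A hmem
      exact ⟨g, hg, hfit.restrict rfl hg fun j => hN.1 ξ hξ _ (.inr (mem_avarsOf hmem j))⟩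
    refine ⟨g, hg, fun x hx => (hgx x hx).trans (ABD.look_restrictEnv (hN.1 ξ hξ x (.inl hx.1)) ?_)⟩
    obtain ⟨A, hmem, j, rfl⟩ := hx.2
    obtain ⟨g', hg', hfit⟩ := hA A hmem
    rw [fits_self.1 hfit j hx]
    exact hg'.mem_domList hx.1

/-- Of the two sides of an aegd that forces a value, the one that yields the value is not
affected. -/
theorem ForcedBy.side_not_affected (haff : M.EquatesNoTwoAffected) {ξ : Abd S T}
    (hξ : ξ ∈ M.abds) {A B : AFact T ℕ} (hA : A ∈ ξ.head) {e : Aegd T} (he : e ∈ M.aegds)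
    (hB : B ∈ e.body) (hsym : SameSym A B) {z l r : ℕ} (hz : z ∈ ξ.exVars)
    (hlr : l = e.lhs ∧ r = e.rhs ∨ l = e.rhs ∧ r = e.lhs) (hne : l ≠ r)
    (hj : ∃ j < T.arity A.2.1, entry A.2 j = z ∧ entry B.2 j = l) :
    ¬ M.OccursAffected e r := by
  obtain ⟨j, hj, hjA, hjB⟩ := hj
  have hjB' : j < T.arity B.2.1 := by rw [← hsym.2]; exact hj
  have hl : M.OccursAffected e l := by
    refine ⟨B, hB, ⟨j, hjB'⟩, by rw [← hjB, entry_of_lt B.2 hjB'], ξ, hξ, A, hA, ⟨j, hj⟩,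
      by rwa [← entry_of_lt A.2 hj, hjA], ?_⟩
    obtain ⟨i, R, u⟩ := A
    obtain ⟨i', R', u'⟩ := B
    obtain rfl : i = i' := hsym.1
    obtain rfl : R = R' := hsym.2
    rfl
  intro hr
  rcases hlr with ⟨rfl, rfl⟩ | ⟨rfl, rfl⟩
  · exact haff e he hne ⟨hl, hr⟩
  · exact haff e he hne.symm ⟨hr, hl⟩

theorem side_mem {e : Aegd T} {l r : ℕ} (hlr : l = e.lhs ∧ r = e.rhs ∨ l = e.rhs ∧ r = e.lhs) :
    r ∈ avarsOf e.body := by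
  rcases hlr with ⟨-, rfl⟩ | ⟨-, rfl⟩
  · exact e.rhs_mem
  · exact e.lhs_mem

theorem ForcedBy.mem_domList (haff : M.EquatesNoTwoAffected) {ξ : Abd S T} (hξ : ξ ∈ M.abds)
    {A : AFact T ℕ} (hA : A ∈ ξ.head) {g : ℕ → ℕ} {z c : ℕ}
    (H : ForcedBy M (factSet I) ξ A g z c) : c ∈ domList I := by
  obtain ⟨hz, e, he, B, hB, hsym, h, hs, -, l, r, hlr, hne, hj, rfl⟩ := H
  exact hs.mem_domList (side_mem hlr)
    (ForcedBy.side_not_affected haff hξ hA he hB hsym hz hlr hne hj)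

theorem forcedBy_iff (hN : VarBound M N) (haff : M.EquatesNoTwoAffected) {ξ : Abd S T}
    (hξ : ξ ∈ M.abds) {A : AFact T ℕ} (hA : A ∈ ξ.head) {g : ℕ → ℕ}
    (hg : Trig ξ (factSet I) g) {z c : ℕ} :
    ForcedBy M (factSet I) ξ A g z c ↔ z ∈ ξ.exVars ∧ ∃ e ∈ M.aegds, ∃ B ∈ e.body,
      SameSym A B ∧ ∃ env ∈ envs N I, Soft M (factSet I) e (look env) ∧
      Fits ξ A.2 g B.2 (look env) ∧
      ∃ p ∈ ({(e.lhs, e.rhs), (e.rhs, e.lhs)} : Set (ℕ × ℕ)), p.1 ≠ p.2 ∧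
        (∃ j < T.arity A.2.1, entry A.2 j = z ∧ entry B.2 j = p.1) ∧ look env p.2 = c := by
  constructor
  · rintro ⟨hz, e, he, B, hB, hsym, h, hs, hfit, l, r, hlr, hne, hj, rfl⟩
    refine ⟨hz, e, he, B, hB, hsym, _, restrictEnv_mem N I h, hs.restrict hN he,
      hfit.restrict hsym.2 hg fun j => hN.2 e he _ (mem_avarsOf hB j), (l, r), ?_, hne, hj,
      hs.look_restrictEnv hN he (side_mem hlr)
        (ForcedBy.side_not_affected haff hξ hA he hB hsym hz hlr hne hj)⟩
    simpa using hlr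
  · rintro ⟨hz, e, he, B, hB, hsym, env, -, hs, hfit, ⟨l, r⟩, hlr, hne, hj, rfl⟩
    exact ⟨hz, e, he, B, hB, hsym, look env, hs, hfit, l, r, by simpa using hlr, hne, hj, rfl⟩

/-! ### Deciding the chase conditions -/

theorem PTP.trig (ξ : Abd S T) {I : γ → List (Fact S ℕ)} {e : γ → List ℕ} (hI : PT I)
    (he : PT e) : PTP (fun c => Trig ξ (factSet (I c)) (look (e c))) :=
  PTP.forall_finite (s := {A | A ∈ ξ.body}) ξ.body.finite_toSet fun A _ =>
    PTP.mem (PT.mapFact (u := fun x c => look (e c) x) A fun _ => PT.look _ he) hI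

theorem PTP.fits (ξ : Abd S T) (a b : Fact T ℕ) {e e' : γ → List ℕ} (he : PT e) (he' : PT e') :
    PTP (fun c => Fits ξ a (look (e c)) b (look (e' c))) :=
  PTP.forall_finite (s := {j | j < T.arity a.1}) (Set.finite_lt_nat _) fun _ _ =>
    (PTP.const _).imp (PTP.eq (PT.look _ he') (PT.look _ he))

theorem PTP.exists_trig (hN : VarBound M N) {ξ : Abd S T} (hξ : ξ ∈ M.abds)
    {I : γ → List (Fact S ℕ)} (hI : PT I) {P : γ → (ℕ → ℕ) → Prop}
    (hloc : ∀ c g g', (∀ x ∈ varsOf ξ.body, g' x = g x) → P c g → P c g')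
    (hP : PTP (fun x : γ × List ℕ => P x.1 (look x.2))) :
    PTP (fun c => ∃ g, Trig ξ (factSet (I c)) g ∧ P c g) :=
  (PTP.exists_mem (p := fun c env => Trig ξ (factSet (I c)) (look env) ∧ P c (look env))
    (PT.envs N hI) ((PTP.trig ξ (hI.comp PT.fst) PT.snd).and hP)).congr
    fun c => exists_trig_iff hN hξ (hloc c)

theorem PTP.soft (hN : VarBound M N) (e : Aegd T) {I : γ → List (Fact S ℕ)} {h : γ → List ℕ}
    (hI : PT I) (hh : PT h) : PTP (fun c => Soft M (factSet (I c)) e (look (h c))) :=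
  PTP.forall_finite (s := {B | B ∈ e.body}) e.body.finite_toSet fun B _ =>
    PTP.exists_finite (s := {ξ | ξ ∈ M.abds}) M.abds.finite_toSet fun ξ hξ =>
      PTP.exists_finite (s := {A | A ∈ ξ.head}) ξ.head.finite_toSet fun A _ =>
        (PTP.const _).and (PTP.exists_trig hN hξ hI
          (P := fun c g => Fits ξ A.2 g B.2 (look (h c)))
          (fun _ _ _ hg hf => hf.congr_frontier fun x hx => hg x hx.1)
          (PTP.fits ξ A.2 B.2 PT.snd (hh.comp PT.fst)))

theorem PTP.unaffectedHold (hN : VarBound M N) {I : γ → List (Fact S ℕ)} (hI : PT I) :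
    PTP (fun c => UnaffectedHold M (factSet (I c))) :=
  (PTP.forall_finite (s := {e | e ∈ M.aegds}) M.aegds.finite_toSet fun e _ =>
    (PTP.const _).imp ((PTP.const _).imp (PTP.forall_mem
      (p := fun c env => Soft M (factSet (I c)) e (look env) → look env e.lhs = look env e.rhs)
      (PT.envs N hI) ((PTP.soft hN e (hI.comp PT.fst) PT.snd).imp
        (PTP.eq (PT.look _ PT.snd) (PT.look _ PT.snd)))))).congr
    fun _ => unaffectedHold_iff hN

theorem PTP.backHold (hN : VarBound M N) {I : γ → List (Fact S ℕ)} (hI : PT I) :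
    PTP (fun c => BackHold M (factSet (I c))) :=
  (PTP.forall_finite (s := {ξ | ξ ∈ M.abds}) M.abds.finite_toSet fun ξ hξ =>
    PTP.forall_mem (p := fun c env =>
      (∀ A ∈ ξ.head, ∃ g, Trig ξ (factSet (I c)) g ∧ Fits ξ A.2 g A.2 (look env)) →
        ∃ g, Trig ξ (factSet (I c)) g ∧ ∀ x ∈ ξ.frontier, g x = look env x) (PT.envs N hI)
      ((PTP.forall_finite (s := {A | A ∈ ξ.head}) ξ.head.finite_toSet fun A _ =>
        PTP.exists_trig hN hξ (hI.comp PT.fst)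
          (P := fun (x : γ × List ℕ) g => Fits ξ A.2 g A.2 (look x.2))
          (fun _ _ _ hg hf => hf.congr_frontier fun x hx => hg x hx.1)
          (PTP.fits ξ A.2 A.2 PT.snd (PT.snd.comp PT.fst))).imp
      (PTP.exists_trig hN hξ (hI.comp PT.fst)
          (P := fun (x : γ × List ℕ) g => ∀ y ∈ ξ.frontier, g y = look x.2 y)
          (fun _ _ _ hg hf y hy => (hg y hy.1).trans (hf y hy))
          (PTP.forall_finite ((finite_varsOf _).subset fun _ h => h.1) fun _ _ =>
            PTP.eq (PT.look _ PT.snd) (PT.look _ (PT.snd.comp PT.fst)))))).congr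
    fun _ => backHold_iff hN

/-- Some aegd forces the value `c` for `z` in one of the head atoms that agree with `a` up to their
annotations. -/
def Forced (M : Mapping S T) (I : Set (Fact S ℕ)) (ξ : Abd S T) (a : Fact T ℕ) (g : ℕ → ℕ)
    (z c : ℕ) : Prop :=
  ∃ A ∈ ξ.head, A.2 = a ∧ ForcedBy M I ξ A g z c

/-- Forced values are only decided for triggers, as for these it suffices to consider assignments
with values in the instance. -/
theorem PTP.trig_and_forced (hN : VarBound M N) (haff : M.EquatesNoTwoAffected) {ξ : Abd S T}
    (hξ : ξ ∈ M.abds) (a : Fact T ℕ) (z : ℕ) {I : γ → List (Fact S ℕ)} {env : γ → List ℕ}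
    {v : γ → ℕ} (hI : PT I) (henv : PT env) (hv : PT v) :
    PTP (fun c => Trig ξ (factSet (I c)) (look (env c)) ∧
      Forced M (factSet (I c)) ξ a (look (env c)) z (v c)) := by
  refine ((PTP.trig ξ hI henv).and (PTP.exists_finite (s := {A | A ∈ ξ.head})
    ξ.head.finite_toSet fun A _ => (PTP.const (A.2 = a)).and ((PTP.const (z ∈ ξ.exVars)).and
    (PTP.exists_finite (s := {e | e ∈ M.aegds}) M.aegds.finite_toSet fun e _ =>
      PTP.exists_finite (s := {B | B ∈ e.body}) e.body.finite_toSet fun B _ =>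
        (PTP.const (SameSym A B)).and (PTP.exists_mem (p := fun c h =>
          Soft M (factSet (I c)) e (look h) ∧ Fits ξ A.2 (look (env c)) B.2 (look h) ∧
          ∃ p ∈ ({(e.lhs, e.rhs), (e.rhs, e.lhs)} : Set (ℕ × ℕ)), p.1 ≠ p.2 ∧
          (∃ j < T.arity A.2.1, entry A.2 j = z ∧ entry B.2 j = p.1) ∧ look h p.2 = v c)
          (PT.envs N hI) ((PTP.soft hN e (hI.comp PT.fst) PT.snd).and
            ((PTP.fits ξ A.2 B.2 (henv.comp PT.fst) PT.snd).and
              (PTP.exists_finite (Set.toFinite _) fun p _ => (PTP.const _).and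
                ((PTP.const _).and (PTP.eq (PT.look _ PT.snd) (hv.comp PT.fst)))))))))
      )).congr fun c => ?_
  refine and_congr_right fun hg => exists_congr fun A => and_congr_right fun hA =>
    and_congr_right fun _ => ?_
  exact forcedBy_iff hN haff hξ hA hg

/-- Different values are forced for the same existential variable. -/
def Conflict (M : Mapping S T) (I : Set (Fact S ℕ)) : Prop :=
  ∃ ξ ∈ M.abds, ∃ A ∈ ξ.head, ∃ g, Trig ξ I g ∧ ∃ z c c', Forced M I ξ A.2 g z c ∧
    Forced M I ξ A.2 g z c' ∧ c ≠ c'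

theorem Forced.congr {I : Set (Fact S ℕ)} {ξ : Abd S T} {a : Fact T ℕ}
    {g g' : ℕ → ℕ} {z c : ℕ} (H : Forced M I ξ a g z c) (H' : Fits ξ a g a g') :
    Forced M I ξ a g' z c := by
  obtain ⟨A, hA, rfl, h⟩ := H
  exact ⟨A, hA, rfl, h.congr H'⟩

theorem Forced.mem_domList (haff : M.EquatesNoTwoAffected) {ξ : Abd S T} (hξ : ξ ∈ M.abds)
    {a : Fact T ℕ} {g : ℕ → ℕ} {z c : ℕ} (H : Forced M (factSet I) ξ a g z c) :
    c ∈ domList I := by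
  obtain ⟨A, hA, rfl, h⟩ := H
  exact h.mem_domList haff hξ hA

theorem Forced.mem_exVars {I : Set (Fact S ℕ)} {ξ : Abd S T} {a : Fact T ℕ} {g : ℕ → ℕ} {z c : ℕ}
    (H : Forced M I ξ a g z c) : z ∈ ξ.exVars := by
  obtain ⟨A, hA, rfl, h⟩ := H
  exact h.1

theorem PTP.conflict (hN : VarBound M N) (haff : M.EquatesNoTwoAffected)
    {I : γ → List (Fact S ℕ)} (hI : PT I) : PTP (fun c => Conflict M (factSet (I c))) := by
  refine (PTP.exists_finite (s := {ξ | ξ ∈ M.abds}) M.abds.finite_toSet fun ξ hξ =>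
    PTP.exists_finite (s := {A | A ∈ ξ.head}) ξ.head.finite_toSet fun A _ =>
    PTP.exists_mem (p := fun c env => ∃ z ∈ ξ.exVars, ∃ v ∈ domList (I c), ∃ v' ∈ domList (I c),
      (Trig ξ (factSet (I c)) (look env) ∧ Forced M (factSet (I c)) ξ A.2 (look env) z v) ∧
      (Trig ξ (factSet (I c)) (look env) ∧ Forced M (factSet (I c)) ξ A.2 (look env) z v') ∧
      v ≠ v') (PT.envs N hI)
    (PTP.exists_finite ((finite_avarsOf _).subset fun _ h => h.1) fun z _ =>
      PTP.exists_mem (PT.domList (hI.comp PT.fst))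
        (PTP.exists_mem (PT.domList (hI.comp (PT.fst.comp PT.fst)))
          ((PTP.trig_and_forced hN haff hξ A.2 z (hI.comp (PT.fst.comp (PT.fst.comp PT.fst)))
            (PT.snd.comp (PT.fst.comp PT.fst)) (PT.snd.comp PT.fst)).and
          ((PTP.trig_and_forced hN haff hξ A.2 z (hI.comp (PT.fst.comp (PT.fst.comp PT.fst)))
            (PT.snd.comp (PT.fst.comp PT.fst)) PT.snd).and
            (PTP.eq (PT.snd.comp PT.fst) PT.snd).not))))).congr fun c => ?_
  refine exists_congr fun ξ => and_congr_right fun hξ => exists_congr fun A =>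
    and_congr_right fun _ => ?_
  constructor
  · intro H
    obtain ⟨env, henv, hg, z, v, v', h1, h2, h3⟩ := (exists_trig_iff hN hξ
      fun g g' hgg ⟨z, v, v', h1, h2, h3⟩ => by
        have := fits_self_of_eqOn (A := A) fun x hx => hgg x (hx : x ∈ ξ.frontier).1
        exact ⟨z, v, v', h1.congr this, h2.congr this, h3⟩).1 H
    exact ⟨env, henv, z, h1.mem_exVars, v, h1.mem_domList haff hξ, v', h2.mem_domList haff hξ,
      ⟨hg, h1⟩, ⟨hg, h2⟩, h3⟩
  · rintro ⟨env, -, z, -, v, -, v', -, ⟨hg, h1⟩, ⟨-, h2⟩, h3⟩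
    exact ⟨look env, hg, z, v, v', h1, h2, h3⟩

end Relativize

/-! ### Tables whose facts have no nulls in common -/

section FreeTables

variable {T : Schema}

/-- The instances of a fact with nulls. -/
def instances (r : Fact T Val) : Set (Fact T ℕ) := {f | ∃ v w, f = mapFact (Val.eval v w) r}

/-- The instances that consist of instances of facts in `L` and contain an instance of each of
them. -/
def freeRep (L : List (Fact T Val)) : Set (Inst T) :=
  {J | (∀ f ∈ J, ∃ r ∈ L, f ∈ instances r) ∧ ∀ r ∈ L, ∃ f ∈ J, f ∈ instances r}

theorem rep_plainTable {L : List (Fact T Val)} (hc : ∀ f ∈ L, ∀ j n, f.2 j ≠ .closed n)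
    (hp : ∀ f ∈ L, ∀ f' ∈ L, ∀ j j' n, f.2 j = .opn n → f'.2 j' = .opn n → f = f') :
    (plainTable L).Rep = freeRep L := by
  classical
  ext J
  constructor
  · rintro ⟨n, hn, v, w, -, hJ⟩
    refine ⟨fun f hf => ?_, fun r hr => ?_⟩
    · obtain ⟨i, g, hg, rfl⟩ := (hJ f).1 hf
      exact ⟨g, hg, v, w i, rfl⟩
    · exact ⟨_, (hJ _).2 ⟨⟨0, hn⟩, r, hr, rfl⟩, v, w ⟨0, hn⟩, rfl⟩
  · rintro ⟨hcov, hhit⟩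
    -- for each target fact `t`, an instance of each row, which is `t` where this is possible
    have hval : ∀ (t : Option (Fact T ℕ)) (r : Fact T Val), ∃ w : ℕ → ℕ, r ∈ L →
        mapFact (Val.eval (fun _ => 0) w) r ∈ J ∧
        ∀ f, t = some f → f ∈ J → f ∈ instances r →
          mapFact (Val.eval (fun _ => 0) w) r = f := by
      have hv : ∀ r ∈ L, ∀ v w, mapFact (Val.eval v w) r = mapFact (Val.eval (fun _ => 0) w) r :=
        fun r hr v w => mapFact_congr fun j => by
          cases h : r.2 j with
          | const | opn => rfl
          | closed n => exact absurd h (hc r hr j n)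
      intro t r
      by_cases hr : r ∈ L
      swap
      · exact ⟨fun _ => 0, fun h => absurd h hr⟩
      by_cases ht : ∃ f, t = some f ∧ f ∈ J ∧ f ∈ instances r
      · obtain ⟨f, rfl, hf, v, w, rfl⟩ := ht
        rw [hv r hr] at hf ⊢
        refine ⟨w, fun _ => ⟨hf, fun f h _ _ => ?_⟩⟩
        injection h
      · obtain ⟨f, hf, v, w, rfl⟩ := hhit r hr
        rw [hv r hr] at hf
        exact ⟨w, fun _ => ⟨hf, fun f h1 h2 h3 => absurd ⟨f, h1, h2, h3⟩ ht⟩⟩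
    choose w hw using hval
    set W : Option (Fact T ℕ) → ℕ → ℕ := fun t n =>
      if h : ∃ r, r ∈ L ∧ ∃ j, r.2 j = .opn n then w t h.choose n else 0 with hW
    have hWr : ∀ t, ∀ r ∈ L, mapFact (Val.eval (fun _ => 0) (W t)) r =
        mapFact (Val.eval (fun _ => 0) (w t r)) r := fun t r hr => mapFact_congr fun j => by
      cases h : r.2 j with
      | const | closed => rfl
      | opn n =>
        change W t n = w t r n
        have h2 : ∃ r, r ∈ L ∧ ∃ j, r.2 j = .opn n := ⟨r, hr, j, h⟩
        have h3 : h2.choose = r := by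
          obtain ⟨h4, j', h5⟩ := h2.choose_spec
          exact hp _ h4 r hr j' j n h5 h
        simp only [hW, dif_pos h2, h3]
    refine ⟨J.card + 1, by omega, fun _ => 0, fun i => W (J.toList[i.1]?), ?_, fun f => ⟨?_, ?_⟩⟩
    · intro δ hδ
      simp [plainTable] at hδ
    · intro hf
      obtain ⟨r, hr, hfr⟩ := hcov f hf
      obtain ⟨i, hi, hif⟩ := List.mem_iff_getElem.1 (Finset.mem_toList.2 hf)
      refine ⟨⟨i, by simp at hi; omega⟩, r, hr, ?_⟩
      rw [hWr _ r hr]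
      exact ((hw _ r hr).2 f (by rw [List.getElem?_eq_getElem hi, hif]) hf hfr).symm
    · rintro ⟨i, r, hr, rfl⟩
      rw [hWr _ r hr]
      exact (hw _ r hr).1

end FreeTables

/-! ### The table computed from a source instance -/

section ChaseTable

variable {S T : Schema} {γ : Type} [Enc γ]

/-- The name of the open null for the existential variable `x` of the head atom `A` under the
assignment `env`. The annotated symbol of `A` stands for `A` and the abd in which it occurs, which
it determines if the annotation density is one. -/
def nullName (A : AFact T ℕ) (x : ℕ) (env : List ℕ) : ℕ :=
  codeList (Encodable.encode A.1 :: A.2.1.1 :: x :: env)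

theorem nullName_inj {A A' : AFact T ℕ} {x x' : ℕ} {env env' : List ℕ}
    (h : nullName A x env = nullName A' x' env') : SameSym A A' ∧ x = x' ∧ env = env' := by
  have := codeList_injective h
  simp only [List.cons.injEq, Encodable.encode_inj] at this
  exact ⟨⟨this.1, Fin.ext this.2.1⟩, this.2.2⟩

open Classical in
/-- The entry that replaces the variable `x` of a head atom `A` of `ξ`: its value, if it is
universally quantified, the value that some aegd forces, if there is one, and otherwise an open
null. -/
noncomputable def cell (M : Mapping S T) (I : List (Fact S ℕ)) (ξ : Abd S T) (A : AFact T ℕ)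
    (env : List ℕ) (x : ℕ) : Val :=
  if x ∈ ξ.frontier then .const (look env x) else
    (((domList I).filter fun c => Trig ξ (factSet I) (look env) ∧
      Forced M (factSet I) ξ A.2 (look env) x c).map Val.const).headD (.opn (nullName A x env))

open Classical in
/-- The facts that all matches of source sides yield. -/
noncomputable def chaseTable (M : Mapping S T) (N : ℕ) (I : List (Fact S ℕ)) :
    List (Fact T Val) :=
  M.abds.toList.flatMap fun ξ => ξ.head.flatMap fun A =>
    ((envs N I).filter fun env => Trig ξ (factSet I) (look env)).map fun env =>
      mapFact (cell M I ξ A env) A.2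

variable {M : Mapping S T} {N : ℕ} {I : List (Fact S ℕ)}

theorem mem_chaseTable {r : Fact T Val} : r ∈ chaseTable M N I ↔ ∃ ξ ∈ M.abds, ∃ A ∈ ξ.head,
    ∃ env ∈ envs N I, Trig ξ (factSet I) (look env) ∧ r = mapFact (cell M I ξ A env) A.2 := by
  simp only [chaseTable, List.mem_flatMap, Finset.mem_toList, List.mem_map, List.mem_filter,
    decide_eq_true_eq, and_assoc, eq_comm (b := r)]

theorem PT.valConst {f : γ → ℕ} (hf : PT f) : PT (fun c => Val.const (f c)) :=
  ((PT.const 0).pair hf).recode fun c => ⟨c, rfl, rfl⟩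

theorem PT.valOpn {f : γ → ℕ} (hf : PT f) : PT (fun c => Val.opn (f c)) :=
  ((PT.const 1).pair hf).recode fun c => ⟨c, rfl, rfl⟩

theorem PT.chaseTable (hN : VarBound M N) (haff : M.EquatesNoTwoAffected) :
    PT (chaseTable M N) := by
  classical
  refine PT.flatMapFixed _ fun ξ hξ => PT.flatMapFixed _ fun A _ => ?_
  rw [Finset.mem_toList] at hξ
  refine PT.map (f := fun I env => ABD.mapFact (cell M I ξ A env) A.2)
    (PT.filter (PT.envs N PT.id) (PTP.trig ξ PT.fst PT.snd)) ?_
  refine PT.mapFact (u := fun x (c : List (Fact S ℕ) × List ℕ) => cell M c.1 ξ A c.2 x) A.2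
    fun j => ?_
  by_cases hx : A.2.2 j ∈ ξ.frontier
  · simp only [cell, if_pos hx]
    exact PT.valConst (PT.look _ PT.snd)
  · simp only [cell, if_neg hx]
    refine PT.headD (PT.map (f := fun _ v => Val.const v) (PT.filter (PT.domList PT.fst) ?_)
      (PT.valConst PT.snd)) (PT.valOpn ?_)
    · exact PTP.trig_and_forced hN haff hξ A.2 _ (PT.fst.comp PT.fst) (PT.snd.comp PT.fst) PT.snd
    · exact PT.codeList ((PT.const _).cons ((PT.const _).cons ((PT.const _).cons PT.snd)))

theorem cell_of_forced (haff : M.EquatesNoTwoAffected) (hcon : ¬ Conflict M (factSet I))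
    {ξ : Abd S T} (hξ : ξ ∈ M.abds) {A : AFact T ℕ} (hA : A ∈ ξ.head) {env : List ℕ}
    (hg : Trig ξ (factSet I) (look env)) {x c : ℕ}
    (hF : Forced M (factSet I) ξ A.2 (look env) x c) : cell M I ξ A env x = .const c := by
  classical
  rw [cell, if_neg fun h => hF.mem_exVars.2 h.1]
  set l := (domList I).filter fun c => Trig ξ (factSet I) (look env) ∧
      Forced M (factSet I) ξ A.2 (look env) x c with hl
  have hmem : c ∈ l := by simp [hl, hg, hF, hF.mem_domList haff hξ]
  cases hl' : l with
  | nil => rw [hl'] at hmem; simp at hmem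
  | cons c' l' =>
    have : c' ∈ l := by rw [hl']; exact List.mem_cons_self
    simp only [hl, List.mem_filter, decide_eq_true_eq] at this
    have hcc : c = c' := by
      by_contra hne
      exact hcon ⟨ξ, hξ, A, hA, _, hg, x, c, c', hF, this.2.2, hne⟩
    simp [hcc]

theorem cell_of_not_forced {ξ : Abd S T} {A : AFact T ℕ} {env : List ℕ} {x : ℕ}
    (hx : x ∉ ξ.frontier) (hF : ∀ c, ¬ Forced M (factSet I) ξ A.2 (look env) x c) :
    cell M I ξ A env x = .opn (nullName A x env) := by
  classical
  rw [cell, if_neg hx, List.filter_eq_nil_iff.2 fun c _ => by simp [hF c]]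
  rfl

theorem cell_eq_opn {ξ : Abd S T} {A : AFact T ℕ} {env : List ℕ} {x n : ℕ}
    (h : cell M I ξ A env x = .opn n) : n = nullName A x env := by
  classical
  rw [cell] at h
  split_ifs at h
  cases hl : (domList I).filter fun c => Trig ξ (factSet I) (look env) ∧
      Forced M (factSet I) ξ A.2 (look env) x c with
  | nil => rw [hl] at h; simpa using h.symm
  | cons => rw [hl] at h; simp at h

theorem cell_ne_closed {ξ : Abd S T} {A : AFact T ℕ} {env : List ℕ} {x n : ℕ} :
    cell M I ξ A env x ≠ .closed n := by
  classical
  rw [cell]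
  split_ifs
  · simp
  · cases (domList I).filter fun c => Trig ξ (factSet I) (look env) ∧
      Forced M (factSet I) ξ A.2 (look env) x c <;> simp

theorem instances_cell (haff : M.EquatesNoTwoAffected) (hcon : ¬ Conflict M (factSet I))
    {ξ : Abd S T} (hξ : ξ ∈ M.abds) {A : AFact T ℕ} (hA : A ∈ ξ.head) {env : List ℕ}
    (hg : Trig ξ (factSet I) (look env)) :
    instances (mapFact (cell M I ξ A env) A.2) = Cand M (factSet I) ξ A.2 (look env) := by
  ext f
  constructor
  · rintro ⟨v, w, rfl⟩
    refine ⟨fun x => Val.eval v w (cell M I ξ A env x), rfl, fits_self.2 fun j hj => ?_,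
      fun A' hA' hAA z c hz => ?_⟩
    · simp only [cell, if_pos hj, Val.eval]
    · simp only [cell_of_forced haff hcon hξ hA hg ⟨A', hA', hAA, hz⟩, Val.eval]
  · rintro ⟨g', rfl, hfit, hF⟩
    have hinj : Function.Injective fun x => nullName A x env :=
      fun x x' h => (nullName_inj h).2.1
    refine ⟨fun _ => 0, fun n => g' (Function.invFun (fun x => nullName A x env) n), ?_⟩
    rw [mapFact_mapFact]
    refine mapFact_congr fun j => ?_
    by_cases hx : A.2.2 j ∈ ξ.frontier
    · simp only [cell, if_pos hx, Val.eval]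
      exact fits_self.1 hfit j hx
    by_cases hc : ∃ c, Forced M (factSet I) ξ A.2 (look env) (A.2.2 j) c
    · obtain ⟨c, hc⟩ := hc
      rw [cell_of_forced haff hcon hξ hA hg hc]
      obtain ⟨A', hA', hAA, hz⟩ := hc
      exact hF A' hA' hAA _ c hz
    · rw [cell_of_not_forced hx (not_exists.1 hc)]
      simp only [Val.eval]
      rw [Function.leftInverse_invFun hinj]

theorem rep_chaseTable (hd : M.density = 1) :
    (plainTable (chaseTable M N I)).Rep = freeRep (chaseTable M N I) := by
  refine rep_plainTable (fun f hf j n => ?_) fun f hf f' hf' j j' n h h' => ?_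
  · obtain ⟨ξ, hξ, A, hA, env, -, -, rfl⟩ := mem_chaseTable.1 hf
    exact cell_ne_closed
  · obtain ⟨ξ, hξ, A, hA, env, -, -, rfl⟩ := mem_chaseTable.1 hf
    obtain ⟨ξ', hξ', A', hA', env', -, -, rfl⟩ := mem_chaseTable.1 hf'
    obtain ⟨hs, -, rfl⟩ := nullName_inj ((cell_eq_opn h).symm.trans (cell_eq_opn h'))
    obtain ⟨rfl, rfl⟩ := eq_of_sameSym hd hξ hξ' hA hA' hs
    rfl

/-- There are no solutions on account of one of the conditions that can be checked on the chase. -/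
def Fails (M : Mapping S T) (I : Set (Fact S ℕ)) : Prop :=
  ¬ BackHold M I ∨ ¬ UnaffectedHold M I ∨ Conflict M I

theorem PTP.fails (hN : VarBound M N) (haff : M.EquatesNoTwoAffected) :
    PTP (fun I => Fails M (factSet I)) :=
  (PTP.backHold hN PT.id).not.or ((PTP.unaffectedHold hN PT.id).not.or
    (PTP.conflict hN haff PT.id))

theorem coe_toFinset (I : List (Fact S ℕ)) : (↑I.toFinset : Set (Fact S ℕ)) = factSet I := by
  ext f
  simp [factSet]

theorem Sol_of_fails (hsafe : M.Safe) (hd : M.density = 1) (hgav : M.GAVReducible)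
    (haff : M.EquatesNoTwoAffected) (h : Fails M (factSet I)) : Sol M I.toFinset = ∅ := by
  rw [Set.eq_empty_iff_forall_notMem]
  intro J hJ
  rw [mem_Sol_iff hsafe hd hgav haff, coe_toFinset] at hJ
  obtain ⟨h1, h2, -, h3⟩ := hJ
  rcases h with h | h | ⟨ξ, hξ, A, hA, g, hg, z, c, c', ⟨A₁, hA₁, h4, hz₁⟩, ⟨A₂, hA₂, h5, hz₂⟩, hne⟩
  · exact h h1
  · exact h h2
  · obtain ⟨f, -, g', -, -, hF⟩ := h3 ξ hξ A hA g hg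
    exact hne ((hF A₁ hA₁ h4 z c hz₁).symm.trans (hF A₂ hA₂ h5 z c' hz₂))

theorem Sol_of_not_fails (hN : VarBound M N) (hsafe : M.Safe) (hd : M.density = 1)
    (hgav : M.GAVReducible) (haff : M.EquatesNoTwoAffected) (h : ¬ Fails M (factSet I)) :
    Sol M I.toFinset = freeRep (chaseTable M N I) := by
  simp only [Fails, not_or, not_not] at h
  obtain ⟨h1, h2, h3⟩ := h
  have hrow : ∀ ξ ∈ M.abds, ∀ A ∈ ξ.head, ∀ g, Trig ξ (factSet I) g → ∃ r ∈ chaseTable M N I,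
      instances r = Cand M (factSet I) ξ A.2 g := by
    intro ξ hξ A hA g hg
    have hx : ∀ x ∈ varsOf ξ.body, look (restrictEnv N I g) x = g x :=
      fun x hx => hg.look_restrictEnv hN hξ hx
    have hg' := hg.congr hx
    refine ⟨_, mem_chaseTable.2 ⟨ξ, hξ, A, hA, _, restrictEnv_mem N I g, hg', rfl⟩, ?_⟩
    rw [instances_cell haff h3 hξ hA hg']
    exact Cand_congr (fits_self_of_eqOn fun x hx' => (hx x hx'.1).symm)
  ext J
  rw [mem_Sol_iff hsafe hd hgav haff, coe_toFinset]
  constructor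
  · rintro ⟨-, -, h4, h5⟩
    refine ⟨fun f hf => ?_, fun r hr => ?_⟩
    · obtain ⟨ξ, hξ, A, hA, g, hg, hc⟩ := h4 f hf
      obtain ⟨r, hr, he⟩ := hrow ξ hξ A hA g hg
      exact ⟨r, hr, he ▸ hc⟩
    · obtain ⟨ξ, hξ, A, hA, env, -, hg, rfl⟩ := mem_chaseTable.1 hr
      rw [instances_cell haff h3 hξ hA hg]
      exact h5 ξ hξ A hA _ hg
  · rintro ⟨h4, h5⟩
    refine ⟨h1, h2, fun f hf => ?_, fun ξ hξ A hA g hg => ?_⟩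
    · obtain ⟨r, hr, hfr⟩ := h4 f hf
      obtain ⟨ξ, hξ, A, hA, env, -, hg, rfl⟩ := mem_chaseTable.1 hr
      rw [instances_cell haff h3 hξ hA hg] at hfr
      exact ⟨ξ, hξ, A, hA, _, hg, hfr⟩
    · obtain ⟨r, hr, he⟩ := hrow ξ hξ A hA g hg
      rw [← he]
      exact h5 r hr

end ChaseTable

/-! ### Queries with one positive atom on the instances represented by a table -/

section Queries

variable {T : Schema} {k : ℕ}

/-- A set of facts on which `t` is not an answer of `q`: for each match of the positive atom that
yields `t`, it contains the fact for one of the negated atoms. -/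
def Refutes (q : NegCQ1 T k) (t : Fin k → ℕ) (J : Set (Fact T ℕ)) : Prop :=
  ∀ h : ℕ → ℕ, (∀ i, h (q.head i) = t i) → mapFact (Term.eval h) q.pos ∈ J →
    ∃ A ∈ q.neg, mapFact (Term.eval h) A ∈ J

theorem notMem_answers_iff {q : NegCQ1 T k} {t : Fin k → ℕ} {J : Inst T} :
    t ∉ q.answers J ↔ Refutes q t ↑J := by
  simp only [NegCQ1.answers, Refutes, Set.mem_ofPred_eq, Finset.mem_coe]
  push Not
  rfl

/-- The syntactic criterion for the satisfiability of a global condition. -/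
def CondTable.Consistent (τ : CondTable T) : Prop := ∀ δ ∈ τ.cond, ∃ e ∈ δ, e.1 ≠ e.2

/-- The constants in an entry of a table. -/
def Val.consts : Val → List ℕ
  | .const a => [a]
  | _ => []

/-- The constants in a list of facts with nulls. -/
def tableConsts (L : List (Fact T Val)) : List ℕ :=
  L.flatMap fun f => (List.ofFn f.2).flatMap Val.consts

theorem mem_tableConsts {L : List (Fact T Val)} {f : Fact T Val} (hf : f ∈ L)
    {j : Fin (T.arity f.1)} {a : ℕ} (h : f.2 j = .const a) : a ∈ tableConsts L := by
  simp only [tableConsts, List.mem_flatMap, List.mem_ofFn]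
  exact ⟨f, hf, _, ⟨j, rfl⟩, by rw [h]; exact List.mem_singleton_self a⟩

theorem lt_sum_succ {l : List ℕ} {a : ℕ} (h : a ∈ l) : a < l.sum + 1 :=
  Nat.lt_succ_of_le (List.single_le_sum (by simp) _ h)

/-- A valuation that maps distinct nulls to distinct values that are at least `m`. -/
def genericVal (m : ℕ) : Val → ℕ := Val.eval (fun n => m + 2 * n) (fun n => m + 2 * n + 1)

theorem genericVal_inj {m : ℕ} {e e' : Val} (he : ∀ a, e = .const a → a < m)
    (he' : ∀ a, e' = .const a → a < m) (h : genericVal m e = genericVal m e') : e = e' := by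
  cases e with
  | const a =>
    have := he a rfl
    cases e' <;> simp [genericVal, Val.eval] at h ⊢ <;> omega
  | opn n =>
    cases e' with
    | const a => have := he' a rfl; simp [genericVal, Val.eval] at h; omega
    | _ => simp [genericVal, Val.eval] at h ⊢; omega
  | closed n =>
    cases e' with
    | const a => have := he' a rfl; simp [genericVal, Val.eval] at h; omega
    | _ => simp [genericVal, Val.eval] at h ⊢; omega

open Classical in
/-- Some represented instance is the image of the table under a generic valuation. -/
theorem generic_mem_rep {τ : CondTable T} (hτ : τ.Consistent) {m : ℕ}
    (hm : ∀ a ∈ tableConsts τ.facts, a < m) :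
    (τ.facts.map (mapFact (genericVal m))).toFinset ∈ τ.Rep := by
  refine ⟨1, le_rfl, fun n => m + 2 * n, fun _ n => m + 2 * n + 1, fun δ hδ => ?_, fun f => ?_⟩
  · obtain ⟨e, he, hne⟩ := hτ δ hδ
    refine ⟨e, he, fun _ _ h => hne ?_⟩
    obtain ⟨⟨f, hf, j, hj⟩, f', hf', j', hj'⟩ := τ.cond_dom δ hδ e he
    exact genericVal_inj (fun a ha => hm a (mem_tableConsts hf (hj.trans ha)))
      (fun a ha => hm a (mem_tableConsts hf' (hj'.trans ha))) h
  · simp only [List.mem_toFinset, List.mem_map]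
    constructor
    · rintro ⟨g, hg, rfl⟩
      exact ⟨0, g, hg, rfl⟩
    · rintro ⟨-, g, hg, rfl⟩
      exact ⟨g, hg, rfl⟩

theorem consistent_of_mem_rep {τ : CondTable T} {J : Inst T} (h : J ∈ τ.Rep) : τ.Consistent := by
  obtain ⟨n, hn, v, w, hc, -⟩ := h
  intro δ hδ
  obtain ⟨e, he, hne⟩ := hc δ hδ
  refine ⟨e, he, fun h => hne ⟨0, hn⟩ ⟨0, hn⟩ (by rw [h])⟩

/-- If a generic instance of `f` is an instance of `r`, then so are all instances of `f`. -/
theorem instances_subset {f r : Fact T Val} {m : ℕ} (hf : ∀ j a, f.2 j = .const a → a < m)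
    (hr : ∀ j a, r.2 j = .const a → a < m) (h : mapFact (genericVal m) f ∈ instances r) :
    instances f ⊆ instances r := by
  rintro - ⟨v, w, rfl⟩
  obtain ⟨v', w', h⟩ := h
  -- the map that takes the generic values to those under `v` and `w`
  set b : ℕ → ℕ := fun x => if x < m then x else
    if (x - m) % 2 = 0 then v ((x - m) / 2) else w ((x - m) / 2) with hb
  refine ⟨fun n => b (v' n), fun n => b (w' n), ?_⟩
  have h1 : mapFact (Val.eval v w) f = mapFact b (mapFact (genericVal m) f) := by
    rw [mapFact_mapFact]
    refine mapFact_congr fun j => ?_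
    cases hj : f.2 j with
    | const a => simp [hb, genericVal, Val.eval, hf j a hj]
    | opn n =>
      simp only [hb, genericVal, Val.eval]
      rw [if_neg (by omega), if_neg (by omega)]
      congr 1
      omega
    | closed n =>
      simp only [hb, genericVal, Val.eval]
      rw [if_neg (by omega), if_pos (by omega)]
      congr 1
      omega
  rw [h1, h, mapFact_mapFact]
  refine mapFact_congr fun j => ?_
  cases hj : r.2 j with
  | const a => simp [hb, Val.eval, hr j a hj]
  | opn n => rfl
  | closed n => rfl

/-- If a table represents the same instances as a table of facts without common nulls, then a tuple
can be refuted on one of them if each fact of the table separately has an instance in a set of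
facts that refutes the tuple. So the nulls that different facts of the table have in common do not
matter. -/
theorem exists_refutes_iff {τ : CondTable T} (hτ : τ.Consistent) {L : List (Fact T Val)}
    (hL : τ.Rep = freeRep L) (q : NegCQ1 T k) (t : Fin k → ℕ) :
    (∃ J ∈ τ.Rep, Refutes q t ↑J) ↔ ∀ f ∈ τ.facts, ∃ J : Inst T, Refutes q t ↑J ∧
      (∀ g ∈ J, ∃ f' ∈ τ.facts, g ∈ instances f') ∧ ∃ g ∈ J, g ∈ instances f := by
  classical
  constructor
  · rintro ⟨J, ⟨n, hn, v, w, -, hJ⟩, hr⟩ f hf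
    refine ⟨J, hr, fun g hg => ?_, _, (hJ _).2 ⟨⟨0, hn⟩, f, hf, rfl⟩, v, w ⟨0, hn⟩, rfl⟩
    obtain ⟨i, f', hf', rfl⟩ := (hJ g).1 hg
    exact ⟨f', hf', v, w i, rfl⟩
  · intro H
    set m := (tableConsts τ.facts).sum + 1 + ((tableConsts L).sum + 1) with hm
    have hmτ : ∀ f ∈ τ.facts, ∀ j a, f.2 j = .const a → a < m := fun f hf j a h =>
      (lt_sum_succ (mem_tableConsts hf h)).trans_le (by omega)
    have hmL : ∀ f ∈ L, ∀ j a, f.2 j = .const a → a < m := fun f hf j a h =>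
      (lt_sum_succ (mem_tableConsts hf h)).trans_le (by omega)
    have hgen := generic_mem_rep hτ (m := m) fun a ha => (lt_sum_succ ha).trans_le (by omega)
    rw [hL] at hgen
    obtain ⟨h1, h2⟩ := hgen
    have h1 : ∀ f ∈ τ.facts, ∃ r ∈ L, instances f ⊆ instances r := fun f hf => by
      obtain ⟨r, hr, h⟩ := h1 (mapFact (genericVal m) f)
        (List.mem_toFinset.2 (List.mem_map_of_mem hf))
      exact ⟨r, hr, instances_subset (hmτ f hf) (hmL r hr) h⟩
    have h2 : ∀ r ∈ L, ∃ f ∈ τ.facts, instances f ⊆ instances r := fun r hr => by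
      obtain ⟨g, hg, h⟩ := h2 r hr
      obtain ⟨f, hf, rfl⟩ := List.mem_map.1 (List.mem_toFinset.1 hg)
      exact ⟨f, hf, instances_subset (hmτ f hf) (hmL r hr) h⟩
    choose! F hF1 hF2 hF3 using H
    refine ⟨τ.facts.toFinset.biUnion F, ?_, ?_⟩
    · rw [hL]
      refine ⟨fun g hg => ?_, fun r hr => ?_⟩
      · obtain ⟨f, hf, hg⟩ := Finset.mem_biUnion.1 hg
        obtain ⟨f', hf', hg'⟩ := hF2 f (List.mem_toFinset.1 hf) g hg
        obtain ⟨r, hr, hsub⟩ := h1 f' hf'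
        exact ⟨r, hr, hsub hg'⟩
      · obtain ⟨f, hf, hsub⟩ := h2 r hr
        obtain ⟨g, hg, hg'⟩ := hF3 f hf
        exact ⟨g, Finset.mem_biUnion.2 ⟨f, List.mem_toFinset.2 hf, hg⟩, hsub hg'⟩
    · intro h hh hpos
      obtain ⟨f, hf, hpos⟩ := Finset.mem_biUnion.1 (Finset.mem_coe.1 hpos)
      obtain ⟨A, hA, hA'⟩ := hF1 f (List.mem_toFinset.1 hf) h hh hpos
      exact ⟨A, hA, Finset.mem_coe.2 (Finset.mem_biUnion.2 ⟨f, hf, hA'⟩)⟩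

/-! ### Reduction to finitely many values -/

/-- The constants in a term. -/
def Term.consts : Term → List ℕ
  | .const a => [a]
  | .var _ => []

/-- The constants in a query. -/
def NegCQ1.consts (q : NegCQ1 T k) : List ℕ :=
  (q.pos :: q.neg).flatMap fun A => (List.ofFn A.2).flatMap Term.consts

theorem NegCQ1.mem_consts {q : NegCQ1 T k} {A : Fact T Term} (hA : A = q.pos ∨ A ∈ q.neg)
    {j : Fin (T.arity A.1)} {a : ℕ} (h : A.2 j = .const a) : a ∈ q.consts := by
  simp only [NegCQ1.consts, List.mem_flatMap, List.mem_ofFn]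
  exact ⟨A, List.mem_cons.2 hA, _, ⟨j, rfl⟩, by rw [h]; exact List.mem_singleton_self a⟩

/-- Numbers that do not occur in a list, as they have more bits than all its entries together. -/
def fresh (C : List ℕ) (j : ℕ) : ℕ := natOfBits (List.replicate j false ++ C.flatMap Nat.bits)

theorem fresh_notMem (C : List ℕ) (j : ℕ) : fresh C j ∉ C := by
  intro h
  have h1 : (fresh C j).bits.length ≤ (C.flatMap Nat.bits).length := by
    rw [List.length_flatMap]
    exact List.single_le_sum (by simp) _ (List.mem_map_of_mem (f := fun n => n.bits.length) h)
  rw [fresh, bits_natOfBits] at h1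
  simp only [List.length_append, List.length_replicate, List.length_singleton] at h1
  omega

theorem fresh_injective (C : List ℕ) : Function.Injective (fresh C) := fun i j h => by
  have := congrArg List.length (natOfBits_injective h)
  simpa using this

/-- The constants that matter for refuting a tuple. -/
def relevantConsts (q : NegCQ1 T k) (τ : CondTable T) (t : Fin k → ℕ) : List ℕ :=
  tableConsts τ.facts ++ (q.consts ++ List.ofFn t)

/-- The values to which the search for a refutation is restricted: the relevant constants and as
many other values as a fact can have. -/
def searchDom (q : NegCQ1 T k) (τ : CondTable T) (t : Fin k → ℕ) : List ℕ :=
  relevantConsts q τ t ++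
    (List.range (Finset.univ.sup T.arity)).map (fresh (relevantConsts q τ t))

open Classical in
/-- The facts with values in the restricted domain that are instances of facts of the table. -/
noncomputable def searchSpace (q : NegCQ1 T k) (τ : CondTable T) (t : Fin k → ℕ) :
    List (Fact T ℕ) :=
  ((List.finRange T.card).flatMap fun R => (tuples (T.arity R) (searchDom q τ t)).map fun l =>
    mapFact (look l) (⟨R, fun j => j.1⟩ : Fact T ℕ)).filter fun g =>
      ∃ f ∈ τ.facts, g ∈ instances f

theorem mem_searchSpace {q : NegCQ1 T k} {τ : CondTable T} {t : Fin k → ℕ} {g : Fact T ℕ} :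
    g ∈ searchSpace q τ t ↔ (∀ j, g.2 j ∈ searchDom q τ t) ∧ ∃ f ∈ τ.facts, g ∈ instances f := by
  classical
  simp only [searchSpace, List.mem_filter, decide_eq_true_eq]
  refine and_congr_left fun _ => ?_
  simp only [List.mem_flatMap, List.mem_finRange, true_and, List.mem_map, mem_tuples]
  constructor
  · rintro ⟨R, l, ⟨h1, h2⟩, rfl⟩ j
    refine h2 _ ?_
    change l.getD j.1 0 ∈ l
    rw [List.getD_eq_getElem _ _ (by rw [h1]; exact j.2)]
    exact List.getElem_mem _
  · intro h
    obtain ⟨R, u⟩ := g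
    refine ⟨R, List.ofFn u, ⟨by simp, fun x hx => ?_⟩, ?_⟩
    · obtain ⟨j, rfl⟩ := (List.mem_ofFn' _ _).1 hx
      exact h j
    · simp [mapFact, look]

/-- The fact `g` does not make `t` an answer on a set of facts that contains `W`. -/
def Harmless (q : NegCQ1 T k) (t : Fin k → ℕ) (g : Fact T ℕ) (W : List (Fact T ℕ)) : Prop :=
  ∀ h : ℕ → ℕ, (∀ i, h (q.head i) = t i) → mapFact (Term.eval h) q.pos = g →
    ∃ A ∈ q.neg, mapFact (Term.eval h) A ∈ W

open Classical in
/-- Delete the facts that make `t` an answer. -/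
noncomputable def prune (q : NegCQ1 T k) (t : Fin k → ℕ) (W : List (Fact T ℕ)) :
    List (Fact T ℕ) :=
  W.filter fun g => Harmless q t g W

/-- The greatest set of facts in the search space that refutes `t`. -/
noncomputable def refuter (q : NegCQ1 T k) (τ : CondTable T) (t : Fin k → ℕ) : List (Fact T ℕ) :=
  (searchSpace q τ t).foldl (fun W _ => prune q t W) (searchSpace q τ t)

theorem prune_iterate (q : NegCQ1 T k) (t : Fin k → ℕ) (n : ℕ) (W : List (Fact T ℕ))
    (hn : W.length ≤ n) : prune q t ((prune q t)^[n] W) = (prune q t)^[n] W := by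
  classical
  induction n generalizing W with
  | zero =>
    obtain rfl := List.length_eq_zero_iff.1 (Nat.le_zero.1 hn)
    rfl
  | succ n ih =>
    by_cases h : prune q t W = W
    · rw [Function.iterate_fixed h, h]
    · rw [Function.iterate_succ_apply]
      refine ih _ ?_
      have h1 : (prune q t W).Sublist W := List.filter_sublist
      have h2 : (prune q t W).length ≠ W.length := fun he => h (h1.eq_of_length he)
      have := h1.length_le
      omega

theorem refutes_refuter (q : NegCQ1 T k) (τ : CondTable T) (t : Fin k → ℕ) :
    Refutes q t {g | g ∈ refuter q τ t} := by
  classical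
  intro h hh hpos
  have hfix : prune q t (refuter q τ t) = refuter q τ t := by
    rw [refuter, List.foldl_const]
    exact prune_iterate q t _ _ le_rfl
  have hmem : mapFact (Term.eval h) q.pos ∈ prune q t (refuter q τ t) := by
    rw [hfix]
    exact hpos
  simp only [prune, List.mem_filter, decide_eq_true_eq] at hmem
  exact hmem.2 h hh rfl

theorem refuter_subset (q : NegCQ1 T k) (τ : CondTable T) (t : Fin k → ℕ) :
    refuter q τ t ⊆ searchSpace q τ t := by
  rw [refuter, List.foldl_const]
  induction (searchSpace q τ t).length with
  | zero => exact fun _ h => h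
  | succ n ih =>
    rw [Function.iterate_succ_apply']
    exact fun g hg => ih (List.mem_filter.1 hg).1

theorem subset_refuter {q : NegCQ1 T k} {τ : CondTable T} {t : Fin k → ℕ} {J : Set (Fact T ℕ)}
    (hJ : Refutes q t J) (hs : ∀ g ∈ J, g ∈ searchSpace q τ t) : ∀ g ∈ J, g ∈ refuter q τ t := by
  rw [refuter, List.foldl_const]
  induction (searchSpace q τ t).length with
  | zero => exact hs
  | succ n ih =>
    intro g hg
    rw [Function.iterate_succ_apply']
    simp only [prune, List.mem_filter, decide_eq_true_eq]
    refine ⟨ih g hg, fun h hh hpos => ?_⟩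
    obtain ⟨A, hA, hmem⟩ := hJ h hh (by rw [hpos]; exact hg)
    exact ⟨A, hA, ih _ hmem⟩

theorem instances_mapFact {f : Fact T Val} {g : Fact T ℕ} (hg : g ∈ instances f) {b : ℕ → ℕ}
    (hb : ∀ j a, f.2 j = .const a → b a = a) : mapFact b g ∈ instances f := by
  obtain ⟨v, w, rfl⟩ := hg
  refine ⟨fun n => b (v n), fun n => b (w n), ?_⟩
  rw [mapFact_mapFact]
  refine mapFact_congr fun j => ?_
  cases hj : f.2 j with
  | const a => exact hb j a hj
  | opn n => rfl
  | closed n => rfl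

/-- If a fact of the table has an instance in some finite refuting set, then it has one in the
computed set. The values of this instance that are not relevant constants are renamed to the extra
values of the search domain; all facts that are needed to refute the tuple on account of this
instance have only such values and relevant constants. -/
theorem exists_mem_refuter_iff (q : NegCQ1 T k) (τ : CondTable T) (t : Fin k → ℕ)
    (f : Fact T Val) (hf : f ∈ τ.facts) :
    (∃ J : Inst T, Refutes q t ↑J ∧ (∀ g ∈ J, ∃ f' ∈ τ.facts, g ∈ instances f') ∧
      ∃ g ∈ J, g ∈ instances f) ↔ ∃ g ∈ refuter q τ t, g ∈ instances f := by
  classical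
  constructor
  swap
  · rintro ⟨g, hg, hgf⟩
    refine ⟨(refuter q τ t).toFinset, ?_, fun g hg => ?_, g, List.mem_toFinset.2 hg, hgf⟩
    · convert refutes_refuter q τ t using 1
      ext g
      simp
    · exact (mem_searchSpace.1 (refuter_subset q τ t (List.mem_toFinset.1 hg))).2
  · rintro ⟨J, hJ, hcov, g, hg, hgf⟩
    set C := relevantConsts q τ t with hC
    set b : ℕ → ℕ := fun x => if x ∈ C then x else fresh C ((List.ofFn g.2).idxOf x) with hb
    set r : ℕ → ℕ := fun y => if h : ∃ j, y = fresh C j then entry g h.choose else y with hr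
    have hbC : ∀ x ∈ C, b x = x := fun x hx => if_pos hx
    have hrC : ∀ x ∈ C, r x = x := fun x hx => dif_neg fun ⟨j, hj⟩ => fresh_notMem C j (hj ▸ hx)
    have hrb : ∀ x, x ∈ C ∨ x ∈ List.ofFn g.2 → r (b x) = x := by
      intro x hx
      by_cases hxC : x ∈ C
      · rw [hbC x hxC, hrC x hxC]
      · have hx := hx.resolve_left hxC
        have he : ∃ j, b x = fresh C j := ⟨_, if_neg hxC⟩
        have hch : he.choose = (List.ofFn g.2).idxOf x := fresh_injective C
          (he.choose_spec.symm.trans (if_neg hxC))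
        simp only [hr, dif_pos he, hch, entry]
        rw [List.getD_eq_getElem _ _ (List.idxOf_lt_length_iff.2 hx), List.getElem_idxOf]
    have hconst : ∀ f' ∈ τ.facts, ∀ j a, f'.2 j = .const a → b a = a := fun f' hf' j a h =>
      hbC a (List.mem_append.2 (.inl (mem_tableConsts hf' h)))
    have hqC : ∀ a ∈ q.consts, a ∈ C := fun a ha =>
      List.mem_append.2 (.inr (List.mem_append.2 (.inl ha)))
    have htC : ∀ i, t i ∈ C := fun i =>
      List.mem_append.2 (.inr (List.mem_append.2 (.inr (by simp))))
    set J' : Set (Fact T ℕ) := {g' | ∃ s ∈ J, (∀ j, s.2 j ∈ C ∨ s.2 j ∈ List.ofFn g.2) ∧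
      g' = mapFact b s} with hJ'
    have hsub : ∀ g' ∈ J', g' ∈ searchSpace q τ t := by
      rintro - ⟨s, hs, hsv, rfl⟩
      obtain ⟨f', hf', hsf⟩ := hcov s hs
      refine mem_searchSpace.2 ⟨fun j => ?_, f', hf', instances_mapFact hsf (hconst f' hf')⟩
      change b (s.2 j) ∈ C ++ _
      by_cases hx : s.2 j ∈ C
      · rw [hbC _ hx]
        exact List.mem_append.2 (.inl hx)
      · have hx' := (hsv j).resolve_left hx
        refine List.mem_append.2 (.inr (List.mem_map.2 ⟨(List.ofFn g.2).idxOf (s.2 j), ?_,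
          (if_neg hx).symm⟩))
        rw [List.mem_range]
        refine (List.idxOf_lt_length_iff.2 hx').trans_le ?_
        rw [List.length_ofFn]
        exact Finset.le_sup (f := T.arity) (Finset.mem_univ g.1)
    have hrefutes : Refutes q t J' := by
      rintro h hh ⟨s, hs, hsv, hpos⟩
      have hev : ∀ A, A = q.pos ∨ A ∈ q.neg → ∀ j, Term.eval (fun x => r (h x)) (A.2 j) =
          r (Term.eval h (A.2 j)) := by
        intro A hA j
        cases hj : A.2 j with
        | const a => exact (hrC a (hqC a (NegCQ1.mem_consts hA hj))).symm
        | var x => rfl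
      have hpos' : mapFact (Term.eval fun x => r (h x)) q.pos = s := by
        have h1 : mapFact (Term.eval fun x => r (h x)) q.pos =
            mapFact r (mapFact (Term.eval h) q.pos) := by
          rw [mapFact_mapFact]
          exact mapFact_congr (hev q.pos (.inl rfl))
        rw [h1, hpos, mapFact_mapFact, mapFact_congr (h := fun x => x) fun j => hrb _ (hsv j)]
        rfl
      obtain ⟨A, hA, hmem⟩ := hJ (fun x => r (h x)) (fun i => by rw [hh, hrC _ (htC i)])
        (by rw [hpos']; exact hs)
      -- values of variables come from the match of the positive atom
      have hvar : ∀ j x, A.2 j = .var x → (r (h x) ∈ C ∨ r (h x) ∈ List.ofFn g.2) ∧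
          b (r (h x)) = h x := by
        intro j x hj
        obtain ⟨j', hj'⟩ := q.neg_safe A hA j x hj
        have h1 : ∀ y, y ∈ C ∨ y ∈ List.ofFn g.2 → h x = b y → (r (h x) ∈ C ∨
            r (h x) ∈ List.ofFn g.2) ∧ b (r (h x)) = h x := by
          intro y hy hxy
          rw [hxy, hrb y hy]
          exact ⟨hy, rfl⟩
        have hsym : q.pos.1 = s.1 := congrArg Sigma.fst hpos'
        have hjs : j'.1 < T.arity s.1 := by rw [← hsym]; exact j'.2
        refine h1 (s.2 ⟨j', hjs⟩) (hsv _) ?_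
        have h2 : entry (mapFact (Term.eval h) q.pos) j'.1 = entry (mapFact b s) j'.1 := by
          rw [hpos]
        rw [entry_mapFact b s hjs, entry_of_lt s hjs,
          entry_of_lt (mapFact (Term.eval h) q.pos) j'.2] at h2
        rw [← h2]
        change h x = Term.eval h (q.pos.2 j')
        rw [hj']
        rfl
      refine ⟨A, hA, _, hmem, fun j => ?_, ?_⟩
      · change Term.eval (fun x => r (h x)) (A.2 j) ∈ C ∨
          Term.eval (fun x => r (h x)) (A.2 j) ∈ List.ofFn g.2
        cases hj : A.2 j with
        | const a => exact .inl (hqC a (NegCQ1.mem_consts (.inr hA) hj))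
        | var x => exact (hvar j x hj).1
      · rw [mapFact_mapFact]
        refine mapFact_congr fun j => ?_
        cases hj : A.2 j with
        | const a => exact (hbC a (hqC a (NegCQ1.mem_consts (.inr hA) hj))).symm
        | var x => exact (hvar j x hj).2.symm
    refine ⟨mapFact b g, subset_refuter hrefutes hsub _ ⟨g, hg, fun j => .inr (by simp), rfl⟩,
      instances_mapFact hgf (hconst f hf)⟩

/-! ### Deciding whether a tuple can be refuted -/

variable {γ : Type} [Enc γ]

theorem mem_instances_iff {f : Fact T Val} {g : Fact T ℕ} : g ∈ instances f ↔
    ∀ R ∈ (Set.univ : Set (Fin T.card)), f.1.1 = R.1 → g.1.1 = R.1 ∧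
      ∀ j ∈ {j | j < T.arity R}, (∀ a ∈ (entry f j).consts, a = entry g j) ∧
        ∀ j' ∈ {j | j < T.arity R}, entry f j = entry f j' → entry g j = entry g j' := by
  classical
  constructor
  · rintro ⟨v, w, rfl⟩ R - hR
    obtain rfl := Fin.ext hR
    refine ⟨rfl, fun j hj => ⟨fun a ha => ?_, fun j' hj' h => ?_⟩⟩
    · rw [entry_mapFact _ f hj]
      cases h : entry f j with
      | const b =>
        rw [h] at ha
        exact List.mem_singleton.1 ha
      | opn n | closed n => rw [h] at ha; simp [Val.consts] at ha
    · rw [entry_mapFact _ f hj, entry_mapFact _ f hj', h]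
  · intro H
    obtain ⟨h1, h2⟩ := H f.1 (Set.mem_univ _) rfl
    set u : Val → ℕ := fun e =>
      if h : ∃ j, j < T.arity f.1 ∧ entry f j = e then entry g h.choose else 0 with hu
    refine ⟨fun n => u (.closed n), fun n => u (.opn n), fact_ext (Fin.ext h1) fun j hj => ?_⟩
    have hj : j < T.arity f.1 := by rwa [← (Fin.ext h1 : g.1 = f.1)]
    rw [entry_mapFact _ f hj]
    have hue : u (entry f j) = entry g j := by
      have he : ∃ i, i < T.arity f.1 ∧ entry f i = entry f j := ⟨j, hj, rfl⟩
      simp only [hu, dif_pos he]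
      exact (h2 _ he.choose_spec.1).2 j hj he.choose_spec.2
    cases h : entry f j with
    | const a => exact ((h2 j hj).1 a (by rw [h]; exact List.mem_singleton_self a)).symm
    | opn n | closed n => rw [h] at hue; exact hue.symm

theorem encNat_zero : encNat 0 = .nil := by
  rw [encNat, Nat.zero_bits]
  rfl

theorem PT.valConsts : PT Val.consts := by
  classical
  have h : PT (fun d : Data => if d.hd = .nil then [d.tl] else []) :=
    PTP.ite (PTP.eq PT.dataHd (PT.const _)) (PT.dataTl.cons (PT.const [])) (PT.const [])
  refine h.recode fun e => ⟨enc e, rfl, ?_⟩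
  cases e with
  | const a =>
    have h0 : (enc (Val.const a)).hd = .nil := encNat_zero
    rw [if_pos h0]
    rfl
  | opn n =>
    rw [if_neg]
    · rfl
    · intro h
      have h : encNat 1 = .nil := h
      exact absurd (encNat_injective (h.trans encNat_zero.symm)) (by decide)
  | closed n =>
    rw [if_neg]
    · rfl
    · intro h
      have h : encNat 2 = .nil := h
      exact absurd (encNat_injective (h.trans encNat_zero.symm)) (by decide)

theorem PTP.mem_instances {g : γ → Fact T ℕ} {f : γ → Fact T Val} (hg : PT g) (hf : PT f) :
    PTP (fun c => g c ∈ instances (f c)) :=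
  (PTP.forall_finite Set.finite_univ fun R _ =>
    (PTP.eq (PT.symbol.comp hf) (PT.const R.1)).imp
      ((PTP.eq (PT.symbol.comp hg) (PT.const R.1)).and
        (PTP.forall_finite (Set.finite_lt_nat _) fun j _ =>
          (PTP.forall_mem (p := fun c a => a = entry (g c) j)
            (PT.valConsts.comp ((PT.entry j).comp hf))
            (PTP.eq PT.snd ((PT.entry j).comp (hg.comp PT.fst)))).and
          (PTP.forall_finite (Set.finite_lt_nat _) fun j' _ =>
            (PTP.eq ((PT.entry j).comp hf) ((PT.entry j').comp hf)).imp
              (PTP.eq ((PT.entry j).comp hg) ((PT.entry j').comp hg)))))).congr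
    fun _ => mem_instances_iff

open Classical in
/-- The only assignment under which the positive atom of `q` can be `g`. -/
noncomputable def NegCQ1.assignment (q : NegCQ1 T k) (g : Fact T ℕ) (x : ℕ) : ℕ :=
  if h : ∃ j, q.pos.2 j = .var x then entry g h.choose.1 else 0

theorem NegCQ1.assignment_eq {q : NegCQ1 T k} {h : ℕ → ℕ} {x : ℕ}
    (hx : ∃ j, q.pos.2 j = .var x) :
    q.assignment (mapFact (Term.eval h) q.pos) x = h x := by
  rw [NegCQ1.assignment, dif_pos hx, entry_of_lt (mapFact (Term.eval h) q.pos) hx.choose.2]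
  change Term.eval h (q.pos.2 hx.choose) = _
  rw [hx.choose_spec]
  rfl

theorem harmless_iff {q : NegCQ1 T k} {t : Fin k → ℕ} {g : Fact T ℕ} {W : List (Fact T ℕ)} :
    Harmless q t g W ↔ (∀ i ∈ (Set.univ : Set (Fin k)), q.assignment g (q.head i) = t i) →
      mapFact (Term.eval (q.assignment g)) q.pos = g →
      ∃ A ∈ {A | A ∈ q.neg}, mapFact (Term.eval (q.assignment g)) A ∈ W := by
  constructor
  · exact fun H h1 h2 => H _ (fun i => h1 i (Set.mem_univ i)) h2
  · rintro H h hh rfl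
    have hA : ∀ A : Fact T Term, (∀ j x, A.2 j = .var x → ∃ j', q.pos.2 j' = .var x) →
        mapFact (Term.eval (q.assignment (mapFact (Term.eval h) q.pos))) A =
          mapFact (Term.eval h) A := fun A hA => mapFact_congr fun j => by
      cases hj : A.2 j with
      | const a => rfl
      | var x => exact NegCQ1.assignment_eq (hA j x hj)
    obtain ⟨A, hA', hmem⟩ := H (fun i _ => by rw [NegCQ1.assignment_eq (q.head_safe i), hh])
      (hA q.pos fun j x hj => ⟨j, hj⟩)
    exact ⟨A, hA', by rwa [hA A (q.neg_safe A hA')] at hmem⟩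

theorem PT.evalAtom (q : NegCQ1 T k) (A : Fact T Term) {g : γ → Fact T ℕ} (hg : PT g) :
    PT (fun c => ABD.mapFact (Term.eval (q.assignment (g c))) A) := by
  refine PT.mapFact (u := fun e c => Term.eval (q.assignment (g c)) e) A fun j => ?_
  cases A.2 j with
  | const a => exact PT.const a
  | var x =>
    change PT fun c => q.assignment (g c) x
    by_cases h : ∃ j, q.pos.2 j = .var x
    · simp only [NegCQ1.assignment, dif_pos h]
      exact (PT.entry _).comp hg
    · simp only [NegCQ1.assignment, dif_neg h]
      exact PT.const 0

theorem PTP.harmless (q : NegCQ1 T k) {t : γ → Fin k → ℕ} {g : γ → Fact T ℕ}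
    {W : γ → List (Fact T ℕ)} (ht : PT t) (hg : PT g) (hW : PT W) :
    PTP (fun c => Harmless q (t c) (g c) (W c)) := by
  have hvar : ∀ x, PT (fun c => q.assignment (g c) x) := fun x => by
    by_cases h : ∃ j, q.pos.2 j = .var x
    · simp only [NegCQ1.assignment, dif_pos h]
      exact (PT.entry _).comp hg
    · simp only [NegCQ1.assignment, dif_neg h]
      exact PT.const 0
  exact ((PTP.forall_finite Set.finite_univ fun i _ =>
      PTP.eq (hvar _) ((PT.tupleApply i).comp ht)).imp
    ((PTP.eq (PT.evalAtom q q.pos hg) hg).imp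
      (PTP.exists_finite q.neg.finite_toSet fun A _ =>
        PTP.mem (PT.evalAtom q A hg) hW))).congr fun _ => harmless_iff

theorem PT.searchDom (q : NegCQ1 T k) :
    PT (fun a : CondTable T × (Fin k → ℕ) => searchDom q a.1 a.2) := by
  have h1 : PT (fun a : CondTable T × (Fin k → ℕ) => relevantConsts q a.1 a.2) :=
    (PT.flatMap (f := fun _ f => (List.ofFn f.2).flatMap Val.consts) (PT.tableFacts.comp PT.fst)
      (PT.flatMap (f := fun _ e => Val.consts e) (PT.entries.comp PT.snd)
        (PT.valConsts.comp PT.snd))).append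
    ((PT.const _).append (PT.tupleToList.comp PT.snd))
  exact h1.append (PT.mapFixed _ fun j _ => PT.natOfBits ((PT.const _).append
    (PT.flatMap (f := fun _ n => Nat.bits n) h1 (PT.bits.comp PT.snd))))

theorem PT.searchSpace (q : NegCQ1 T k) :
    PT (fun a : CondTable T × (Fin k → ℕ) => searchSpace q a.1 a.2) := by
  classical
  refine PT.filter (p := fun (a : CondTable T × (Fin k → ℕ)) g =>
    ∃ f ∈ a.1.facts, g ∈ instances f) (PT.flatMapFixed _ fun R _ =>
    PT.map (f := fun _ l => ABD.mapFact (ABD.look l) (⟨R, fun j => j.1⟩ : Fact T ℕ))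
      (PT.tuples _ (PT.searchDom q)) ?_) ?_
  · exact PT.mapFact (u := fun x (c : (CondTable T × (Fin k → ℕ)) × List ℕ) => ABD.look c.2 x) _
      fun j => PT.look _ PT.snd
  · exact PTP.exists_mem (p := fun (c : (CondTable T × (Fin k → ℕ)) × Fact T ℕ) f =>
      c.2 ∈ instances f) (PT.tableFacts.comp (PT.fst.comp PT.fst))
      (PTP.mem_instances (PT.snd.comp PT.fst) PT.snd)

theorem esize_filter_le {α : Type} [Enc α] (p : α → Bool) (l : List α) :
    esize (l.filter p) ≤ esize l := by
  induction l with
  | nil => exact le_rfl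
  | cons a l ih =>
    rw [List.filter_cons]
    split_ifs
    · rw [esize_cons, esize_cons]; omega
    · rw [esize_cons]; omega

theorem PT.refuter (q : NegCQ1 T k) :
    PT (fun a : CondTable T × (Fin k → ℕ) => refuter q a.1 a.2) := by
  classical
  refine PT.foldl (g := fun (a : CondTable T × (Fin k → ℕ)) W (_ : Fact T ℕ) => prune q a.2 W)
    (PT.searchSpace q) (PT.searchSpace q)
    (PT.filter (PT.fst.comp PT.snd) (PTP.harmless q (PT.snd.comp (PT.fst.comp PT.fst)) PT.snd
      (PT.fst.comp (PT.snd.comp PT.fst)))) ⟨0, fun a W _ => ?_⟩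
  exact (esize_filter_le _ _).trans (by simp)

/-- The criterion by which certain answers are recognized on a universal representative. -/
def CertCriterion (q : NegCQ1 T k) (τ : CondTable T) (t : Fin k → ℕ) : Prop :=
  τ.Consistent → ∃ f ∈ τ.facts, ∀ g ∈ refuter q τ t, g ∉ instances f

theorem PTP.certCriterion (q : NegCQ1 T k) :
    PTP (fun a : CondTable T × (Fin k → ℕ) => CertCriterion q a.1 a.2) :=
  (PTP.forall_mem (p := fun _ δ => ∃ e ∈ δ, e.1 ≠ e.2) (PT.tableCond.comp PT.fst)
    (PTP.exists_mem (p := fun _ (e : Val × Val) => e.1 ≠ e.2) PT.snd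
      (PTP.eq (PT.fst.comp PT.snd) (PT.snd.comp PT.snd)).not)).imp
  (PTP.exists_mem (p := fun a f => ∀ g ∈ ABD.refuter q a.1 a.2, g ∉ instances f)
    (PT.tableFacts.comp PT.fst)
    (PTP.forall_mem (p := fun c g => g ∉ instances c.2) ((PT.refuter q).comp PT.fst)
      (PTP.mem_instances PT.snd (PT.snd.comp PT.fst)).not))

end Queries

/-! ### The three problems -/

section Problems

variable {S T : Schema} {M : Mapping S T} {k : ℕ}

theorem decidablePolyTime_of_PTP {α β : Type} [Enc β] {e : α → Data} {D L : Set α} (f : α → β)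
    (hf : ∀ a, e a = enc (f a)) {p : β → Prop} (hp : PTP p) (h : ∀ a ∈ D, p (f a) ↔ a ∈ L) :
    DecidablePolyTime e D L := by
  obtain ⟨t, ⟨b, -, ht⟩, htp⟩ := hp
  obtain ⟨c, hc⟩ := ht 0
  refine ⟨c, b, fun a ha => ?_⟩
  obtain ⟨s', n, h1, h2, -, h3⟩ := hc (f a) (initStore (e a)) (by simp [initStore, hf])
  refine ⟨_, n, ⟨s', h1, rfl⟩, by rw [hf]; exact h3, ?_⟩
  rw [h2, ← h a ha, ← htp]
  cases t (f a) <;> simp [enc, encBool]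

theorem computablePolyTime_of_PT {α β : Type} [Enc α] [Enc β] {G : α → β → Prop} {f : α → β}
    (hf : PT f) (h : ∀ a, G a (f a)) : ComputablePolyTime (enc : α → Data) (enc : β → Data) G := by
  obtain ⟨b, hb, hc⟩ := hf
  obtain ⟨c, hc⟩ := hc 0
  refine ⟨c, b, fun a => ?_⟩
  obtain ⟨s', n, h1, h2, -, h3⟩ := hc a (initStore (enc a)) (by simp [initStore])
  exact ⟨f a, n, ⟨s', h1, h2⟩, h3, hb a, h a⟩

theorem notMem_cert_iff {q : NegCQ1 T k} {I : Inst S} {t : Fin k → ℕ} :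
    t ∉ cert M q I ↔ ∃ J ∈ Sol M I, Refutes q t ↑J := by
  simp only [cert, Set.mem_iInter, ← notMem_answers_iff]
  push Not
  rfl

theorem mem_cert_iff_certCriterion (hsafe : M.Safe) (hd : M.density = 1) (hgav : M.GAVReducible)
    (haff : M.EquatesNoTwoAffected) (q : NegCQ1 T k) {I : Inst S} {τ : CondTable T}
    (hτ : IsUniversalRep M I τ) (t : Fin k → ℕ) : t ∈ cert M q I ↔ CertCriterion q τ t := by
  classical
  by_cases hc : τ.Consistent
  swap
  · refine iff_of_true ?_ fun h => absurd h hc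
    by_contra hcert
    obtain ⟨J, hJ, -⟩ := notMem_cert_iff.1 hcert
    rw [hτ] at hJ
    exact hc (consistent_of_mem_rep hJ)
  obtain ⟨N, hN⟩ := exists_varBound M
  have hne : ¬ Fails M (factSet I.toList) := by
    intro hf
    have h1 := Sol_of_fails hsafe hd hgav haff hf
    rw [Finset.toList_toFinset, hτ] at h1
    have h2 := generic_mem_rep hc fun a ha => lt_sum_succ ha
    rw [h1] at h2
    exact h2
  have hL := Sol_of_not_fails hN hsafe hd hgav haff hne
  rw [Finset.toList_toFinset, hτ] at hL
  rw [← not_iff_not, notMem_cert_iff, hτ, exists_refutes_iff hc hL]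
  simp only [CertCriterion, hc, true_imp_iff]
  push Not
  exact forall₂_congr fun f hf => exists_mem_refuter_iff q τ t f hf

theorem isUniversalRep_chaseTable {N : ℕ} (hN : VarBound M N) (hsafe : M.Safe)
    (hd : M.density = 1) (hgav : M.GAVReducible) (haff : M.EquatesNoTwoAffected)
    {l : List (Fact S ℕ)} (h : ¬ Fails M (factSet l)) :
    IsUniversalRep M l.toFinset (plainTable (chaseTable M N l)) := by
  rw [IsUniversalRep, rep_chaseTable hd, Sol_of_not_fails hN hsafe hd hgav haff h]

end Problems

end ABD

theorem theorem11 {S T : ABD.Schema} (M : ABD.Mapping S T) (hsafe : M.Safe)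
    (hdensity : M.density = 1) (hgav : M.GAVReducible) (haff : M.EquatesNoTwoAffected)
    {k : ℕ} (q : ABD.NegCQ1 T k) :
    -- the evaluation problem, with input a source instance and a tuple over its domain
    ABD.DecidablePolyTime
      (fun a : List (ABD.Fact S ℕ) × (Fin k → ℕ) => .cons (ABD.encInst a.1) (ABD.encTuple a.2))
      {a | ∀ i, a.2 i ∈ ABD.dom a.1.toFinset}
      {a | a.2 ∈ ABD.cert M q a.1.toFinset} ∧
    -- a universal representative is found in polynomial time if there are solutions
    ABD.ComputablePolyTime
      (fun l : List (ABD.Fact S ℕ) => ABD.encInst l)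
      (fun r : Option (ABD.CondTable T) => ABD.encOption ABD.encTable r)
      (fun l r => (r = none ∧ ABD.Sol M l.toFinset = ∅) ∨
        ∃ τ, r = some τ ∧ ABD.IsUniversalRep M l.toFinset τ) ∧
    -- from any universal representative and the tuple alone, the question is decided
    ABD.DecidablePolyTime
      (fun a : ABD.Inst S × ABD.CondTable T × (Fin k → ℕ) =>
        .cons (ABD.encTable a.2.1) (ABD.encTuple a.2.2))
      {a | ABD.IsUniversalRep M a.1 a.2.1 ∧ ∀ i, a.2.2 i ∈ ABD.dom a.1}
      {a | a.2.2 ∈ ABD.cert M q a.1} := by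
  classical
  obtain ⟨N, hN⟩ := ABD.exists_varBound M
  have htable : ABD.PT (fun l : List (ABD.Fact S ℕ) =>
      ABD.plainTable (ABD.chaseTable M N l)) := (ABD.PT.chaseTable hN haff).plainTable
  have hfails := ABD.PTP.fails hN haff
  refine ⟨?_, ?_, ?_⟩
  · refine ABD.decidablePolyTime_of_PTP (fun a => a) (fun _ => rfl)
      ((hfails.comp ABD.PT.fst).or ((ABD.PTP.certCriterion q).comp
        ((htable.comp ABD.PT.fst).pair ABD.PT.snd))) fun a _ => ?_
    by_cases hf : ABD.Fails M (ABD.factSet a.1)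
    · refine iff_of_true (.inl hf) ?_
      by_contra hcert
      obtain ⟨J, hJ, -⟩ := ABD.notMem_cert_iff.1 hcert
      rw [ABD.Sol_of_fails hsafe hdensity hgav haff hf] at hJ
      exact hJ
    · exact (or_iff_right hf).trans (ABD.mem_cert_iff_certCriterion hsafe hdensity hgav haff q
        (ABD.isUniversalRep_chaseTable hN hsafe hdensity hgav haff hf) a.2).symm
  · refine ABD.computablePolyTime_of_PT
      (ABD.PTP.ite hfails (ABD.PT.const none) htable.some) fun l => ?_
    by_cases hf : ABD.Fails M (ABD.factSet l)
    · exact .inl ⟨if_pos hf, ABD.Sol_of_fails hsafe hdensity hgav haff hf⟩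
    · exact .inr ⟨_, if_neg hf, ABD.isUniversalRep_chaseTable hN hsafe hdensity hgav haff hf⟩
  · exact ABD.decidablePolyTime_of_PTP (fun a => a.2) (fun _ => rfl) (ABD.PTP.certCriterion q)
      fun a ha => (ABD.mem_cert_iff_certCriterion hsafe hdensity hgav haff q ha.1 a.2.2).symm
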